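/- Let $\ell\ge 1$, $\hbar>0$, $\underline\lambda=(\lambda_1,\dots,\lambda_{\ell+1})\in\mathbb{R}^{\ell+1}$ and $\epsilon>\max_j\lambda_j$. Consider complex variables $\gamma_{n,j}$, $1\le j\le n\le\ell$, put $\gamma_{\ell+1,j}=\lambda_j$, and let, on functions of these variables (with poles allowed where $\gamma_{n,i}-\gamma_{n,j}\in\hbar\mathbb{Z}$, $i\ne j$), $$E_{kk}=\tfrac1\hbar\Big(\sum_{j=1}^{k}\gamma_{k,j}-\sum_{i=1}^{k-1}\gamma_{k-1,i}\Big),\qquad E_{n,n+1}=-\tfrac1\hbar\sum_{i=1}^n\frac{\prod_{j=1}^{n+1}(\gamma_{n,i}-\gamma_{n+1,j}-\frac\hbar2)}{\prod_{s\ne i}(\gamma_{n,i}-\gamma_{n,s})}e^{-\hbar\partial_{n,i}},$$ $$E_{n+1,n}=\tfrac1\hbar\sum_{i=1}^n\frac{\prod_{j=1}^{n-1}(\gamma_{n,i}-\gamma_{n-1,j}+\frac\hbar2)}{\prod_{s\ne i}(\gamma_{n,i}-\gamma_{n,s})}e^{\hbar\partial_{n,i}},$$ where $1\le k\le \ell+1$,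 $1\le n\le\ell$, and $e^{\pm\hbar\partial_{n,i}}$ shifts $\gamma_{n,i}$ by $\pm\hbar$. Let $\mu(\gamma)=\prod_{n=2}^{\ell}\prod_{j\ne s}\Gamma\big(\frac{\gamma_{n,j}-\gamma_{n,s}}{\hbar}\big)^{-1}$ and $\langle\phi,\psi\rangle=\int\mu\,\phi\,\psi\prod d\gamma_{n,j}$, with the right action on $\phi$ transposed to the left action on $\psi$, and let $$\langle\psi_L|=\frac1{2\pi i\hbar},\qquad |\psi_R\rangle=\prod_{k=2}^{\ell}\delta\Big(\sum_{j=1}^k\gamma_{k,j}-\sum_{i=1}^{k-1}\gamma_{k-1,i}\Big)\prod_{1\le i\le k\le\ell-1}\delta\Big(\gamma_{k,i}-\gamma_{k+1,i}+\tfrac\hbar2\Big)$$ $$\times\prod_{n=2}^{\ell}\prod_{i\ne j}\Gamma\Big(\frac{\gamma_{n,i}-\gamma_{n,j}}\hbar\Big)\prod_{j=1}^{\ell+1}\hbar^{\frac{\gamma_{\ell,1}-\lambda_j}{\hbar}+\frac12}\,\Gamma\Big(\frac{\gamma_{\ell,1}-\lambda_j}{\hbar}+\frac12\Big).$$ Here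 the delta-functions restrict the integration to the complex line on which all their arguments vanish; on it the integration is over $\gamma_{\ell,1}\in\epsilon-\frac\hbar2+i\mathbb{R}$ with $d\gamma_{\ell,1}$, and the integrand (where zeros of $\mu$ cancel poles of $\psi_R$) is extended by continuity. Then: (1) The operators above satisfy the Chevalley–Serre relations of $\mathfrak{gl}_{\ell+1}$, i.e. they define a representation. (2) $\psi_L$ and $\psi_R$ are the $(1,\ell+1)$-parabolic Whittaker vectors with sign $(-1)^{\ell(\ell-1)/2+1}$: $$\langle\psi_L|E_{n+1,n}=\frac{(-1)^{n-1}}\hbar\langle\psi_L|\ (1\le n\le\ell),\qquad E_{kk}|\psi_R\rangle=0\ (2\le k\le\ell),$$ $$E_{k,k+1}|\psi_R\rangle=0\ (1\le k\le\ell-1),\qquad E_{1,\ell+1}|\psi_R\rangle=\frac{(-1)^{\ell(\ell-1)/2+1}}{\hbar}|\psi_R\rangle,$$ where $E_{1,\ell+1}=[\dots[E_{12},E_{23}],\dots,E_{\ell,\ell+1}]$ and the equations for $\psi_R$ hold in the sense of distributions, against entire test functions of $\gamma$ that grow at most polynomially where all $|\mathrm{Re}\,\gamma_{n,j}|$ are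 bounded. (3) For all $x\in\mathbb{R}$, the $(1,\ell+1)$-parabolic Whittaker function specialized to $x_1=x$, $x_i=0$ for $i\ne1$, that is $\Psi^{(1,\ell+1)}_{\underline\lambda}(x,0,\dots,0)=e^{-\ell x/2}\langle\psi_L|e^{-xE_{11}}|\psi_R\rangle$, is given by the Mellin–Barnes integral $$\Psi^{(1,\ell+1)}_{\underline\lambda}(x,0,\dots,0)=\frac1{2\pi\hbar}\int_{\mathbb{R}-i\epsilon}dH\,e^{-\frac{i}{\hbar}xH}\prod_{j=1}^{\ell+1}\Gamma_1(iH-\lambda_j|\hbar),\qquad \Gamma_1(z|\omega)=\omega^{z/\omega}\Gamma(z/\omega),$$ and it coincides with Givental's integral for the generating function of the $S^1\times U_{\ell+1}$-equivariant quantum cohomology of $\mathbb{P}^\ell$, $$\int_{\mathbb{R}^\ell}\prod_{j=1}^\ell dt_j\,\exp\Big(-\frac1\hbar\Big(\sum_{j=1}^\ell\lambda_jt_j+\lambda_{\ell+1}\big(x-\sum_{j=1}^\ell t_j\big)+\sum_{j=1}^\ell e^{t_j}+e^{x-\sum_{j=1}^\ell t_j}\Big)\Big).$$ All the integrals converge absolutely.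 -/

import Mathlib

open Filter Topology MeasureTheory

noncomputable section

/-! ### Gelfand–Zetlin arrays -/

/-- The index set of the variables `γ_{n,j}`, `1 ≤ j ≤ n ≤ ℓ`. -/
def gzIndex (ℓ : ℕ) : Finset (ℕ × ℕ) :=
  (Finset.Icc 1 ℓ ×ˢ Finset.Icc 1 ℓ).filter (fun p => p.2 ≤ p.1)

/-- Arrays `(γ_{n,j})_{1 ≤ j ≤ n ≤ ℓ}` of complex numbers. -/
abbrev GZArray (ℓ : ℕ) : Type := gzIndex ℓ → ℂ

/-- The entry `γ_{n,j}` of an array completed by the top row `γ_{ℓ+1,j} = λ_j`, `1 ≤ j ≤ ℓ+1`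
(and `0` outside the triangle). -/
def gzEntry {ℓ : ℕ} (lam : Fin (ℓ + 1) → ℝ) (γ : GZArray ℓ) (n j : ℕ) : ℂ :=
  if h : (n, j) ∈ gzIndex ℓ then γ ⟨(n, j), h⟩
  else if h : n = ℓ + 1 ∧ 1 ≤ j ∧ j ≤ ℓ + 1 then ((lam ⟨j - 1, by omega⟩ : ℝ) : ℂ)
  else 0

/-- The arrays at which no two entries of the same row differ by an element of `ħℤ`. This set is
stable under the shifts by `±ħ` and avoids all the poles of the coefficients below. -/
def gzRegular (ℓ : ℕ) (ħ : ℝ) : Set (GZArray ℓ) :=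
  {γ | ∀ p q : gzIndex ℓ, p.1.1 = q.1.1 → p ≠ q → ∀ k : ℤ, γ p - γ q ≠ (k : ℂ) * (ħ : ℂ)}

/-- The space of functions of the variables `γ_{n,j}` on which the operators act: all functions on
the regular arrays (so that meromorphic functions with poles at `γ_{n,i} - γ_{n,j} ∈ ħℤ` are
included). -/
abbrev GZFun (ℓ : ℕ) (ħ : ℝ) : Type := gzRegular ℓ ħ → ℂ

/-- The array obtained from `γ` by the shift `γ_{n,i} ↦ γ_{n,i} + kħ`. -/
def gzShift {ℓ : ℕ} {ħ : ℝ} (γ : gzRegular ℓ ħ) (n i : ℕ) (k : ℤ) : gzRegular ℓ ħ :=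
  ⟨fun q => γ.1 q + if q.1 = (n, i) then (k : ℂ) * (ħ : ℂ) else 0, by
    intro p q hpq hne m h
    have key : ∃ a : ℤ, (if p.1 = (n, i) then (k : ℂ) * (ħ : ℂ) else 0) -
        (if q.1 = (n, i) then (k : ℂ) * (ħ : ℂ) else 0) = (a : ℂ) * (ħ : ℂ) := by
      split_ifs
      · exact ⟨0, by simp⟩
      · exact ⟨k, by simp⟩
      · exact ⟨-k, by push_cast; ring⟩
      · exact ⟨0, by simp⟩
    obtain ⟨a, ha⟩ := key
    refine γ.2 p q hpq hne (m - a) ?_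
    push_cast
    linear_combination h - ha⟩

/-! ### The Gelfand–Zetlin operators -/

section Operators

variable {ℓ : ℕ} (ħ : ℝ) (lam : Fin (ℓ + 1) → ℝ)

/-- The function by which `E_{kk}` acts:
`(1/ħ) (∑_{j=1}^{k} γ_{k,j} - ∑_{i=1}^{k-1} γ_{k-1,i})`. -/
def gzWeight (k : ℕ) (γ : gzRegular ℓ ħ) : ℂ :=
  (1 / (ħ : ℂ)) * (∑ j ∈ Finset.Icc 1 k, gzEntry lam γ.1 k j -
    ∑ i ∈ Finset.Icc 1 (k - 1), gzEntry lam γ.1 (k - 1) i)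

/-- The coefficient of `e^{-ħ∂_{n,i}}` in `E_{n,n+1}`. -/
def gzRaiseCoeff (n i : ℕ) (γ : gzRegular ℓ ħ) : ℂ :=
  -(1 / (ħ : ℂ)) *
    ((∏ j ∈ Finset.Icc 1 (n + 1),
        (gzEntry lam γ.1 n i - gzEntry lam γ.1 (n + 1) j - (ħ : ℂ) / 2)) /
      ∏ s ∈ (Finset.Icc 1 n).erase i, (gzEntry lam γ.1 n i - gzEntry lam γ.1 n s))

/-- The coefficient of `e^{ħ∂_{n,i}}` in `E_{n+1,n}`. -/
def gzLowerCoeff (n i : ℕ) (γ : gzRegular ℓ ħ) : ℂ :=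
  (1 / (ħ : ℂ)) *
    ((∏ j ∈ Finset.Icc 1 (n - 1),
        (gzEntry lam γ.1 n i - gzEntry lam γ.1 (n - 1) j + (ħ : ℂ) / 2)) /
      ∏ s ∈ (Finset.Icc 1 n).erase i, (gzEntry lam γ.1 n i - gzEntry lam γ.1 n s))

/-- `E_{kk}`. -/
def gzCartan (k : ℕ) : Module.End ℂ (GZFun ℓ ħ) where
  toFun f := fun γ => gzWeight ħ lam k γ * f γ
  map_add' f g := by funext γ; simp [mul_add]
  map_smul' c f := by funext γ; simp; ring

/-- `E_{n,n+1} = ∑_i (coefficient) e^{-ħ∂_{n,i}}`. -/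
def gzRaise (n : ℕ) : Module.End ℂ (GZFun ℓ ħ) where
  toFun f := fun γ => ∑ i ∈ Finset.Icc 1 n, gzRaiseCoeff ħ lam n i γ * f (gzShift γ n i (-1))
  map_add' f g := by funext γ; simp [mul_add, Finset.sum_add_distrib]
  map_smul' c f := by
    funext γ
    simp only [Pi.smul_apply, smul_eq_mul, RingHom.id_apply, Finset.mul_sum]
    exact Finset.sum_congr rfl fun i _ => by ring

/-- `E_{n+1,n} = ∑_i (coefficient) e^{ħ∂_{n,i}}`. -/
def gzLower (n : ℕ) : Module.End ℂ (GZFun ℓ ħ) where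
  toFun f := fun γ => ∑ i ∈ Finset.Icc 1 n, gzLowerCoeff ħ lam n i γ * f (gzShift γ n i 1)
  map_add' f g := by funext γ; simp [mul_add, Finset.sum_add_distrib]
  map_smul' c f := by
    funext γ
    simp only [Pi.smul_apply, smul_eq_mul, RingHom.id_apply, Finset.mul_sum]
    exact Finset.sum_congr rfl fun i _ => by ring

/-- The operator `e^{-x E_{11}}`: since `E_{11}` acts by multiplication by a function, so does its
exponential. -/
def gzTorus (x : ℝ) : Module.End ℂ (GZFun ℓ ħ) where
  toFun f := fun γ => Complex.exp (-(x : ℂ) * gzWeight ħ lam 1 γ) * f γ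
  map_add' f g := by funext γ; simp [mul_add]
  map_smul' c f := by funext γ; simp; ring

/-- The density `μ(γ) = ∏_{n=2}^{ℓ} ∏_{j ≠ s} Γ((γ_{n,j} - γ_{n,s})/ħ)⁻¹` (over ordered pairs). -/
def gzMeasure (γ : gzRegular ℓ ħ) : ℂ :=
  ∏ n ∈ Finset.Icc 2 ℓ, ∏ j ∈ Finset.Icc 1 n, ∏ s ∈ (Finset.Icc 1 n).erase j,
    (Complex.Gamma ((gzEntry lam γ.1 n j - gzEntry lam γ.1 n s) / (ħ : ℂ)))⁻¹

/-! The dual module carries the right action `φ ↦ φ·X`, where `φ·X` is the transpose of `X` with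
respect to the pairing `∫ μ φ ψ dγ`; the transpose of `a(γ) e^{kħ∂_{n,i}}` sends `φ` to
`μ⁻¹ e^{-kħ∂_{n,i}} (μ a φ)`. -/

/-- `φ ↦ φ·E_{n,n+1}`. -/
def gzRaiseAdj (n : ℕ) : Module.End ℂ (GZFun ℓ ħ) where
  toFun φ := fun γ => (gzMeasure ħ lam γ)⁻¹ * ∑ i ∈ Finset.Icc 1 n,
    (gzMeasure ħ lam (gzShift γ n i 1) * gzRaiseCoeff ħ lam n i (gzShift γ n i 1)) *
      φ (gzShift γ n i 1)
  map_add' f g := by funext γ; simp [mul_add, Finset.sum_add_distrib]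
  map_smul' c f := by
    funext γ
    simp only [Pi.smul_apply, smul_eq_mul, RingHom.id_apply, Finset.mul_sum]
    exact Finset.sum_congr rfl fun i _ => by ring

/-- `φ ↦ φ·E_{n+1,n}`. -/
def gzLowerAdj (n : ℕ) : Module.End ℂ (GZFun ℓ ħ) where
  toFun φ := fun γ => (gzMeasure ħ lam γ)⁻¹ * ∑ i ∈ Finset.Icc 1 n,
    (gzMeasure ħ lam (gzShift γ n i (-1)) * gzLowerCoeff ħ lam n i (gzShift γ n i (-1))) *
      φ (gzShift γ n i (-1))
  map_add' f g := by funext γ; simp [mul_add, Finset.sum_add_distrib]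
  map_smul' c f := by
    funext γ
    simp only [Pi.smul_apply, smul_eq_mul, RingHom.id_apply, Finset.mul_sum]
    exact Finset.sum_congr rfl fun i _ => by ring

/-- `φ ↦ φ·E_{1,k+2}`, where `E_{1,j+1} = [E_{1,j}, E_{j,j+1}]`, so that
`φ·E_{1,j+1} = (φ·E_{1,j})·E_{j,j+1} - (φ·E_{j,j+1})·E_{1,j}`. -/
def gzRootAdj : ℕ → Module.End ℂ (GZFun ℓ ħ)
  | 0 => gzRaiseAdj ħ lam 1
  | k + 1 => gzRaiseAdj ħ lam (k + 2) * gzRootAdj k - gzRootAdj k * gzRaiseAdj ħ lam (k + 2)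

end Operators

/-- `h k` (`1 ≤ k ≤ N`), `e n` and `f n` (`1 ≤ n < N`) satisfy the defining (Chevalley–Serre)
relations of `E_{kk}`, `E_{n,n+1}` and `E_{n+1,n}` in `𝔤𝔩_N`, that is, they define a representation
of `𝔤𝔩_N` on `V`. -/
structure IsGlRepresentation {V : Type*} [AddCommGroup V] [Module ℂ V] (N : ℕ)
    (h e f : ℕ → Module.End ℂ V) : Prop where
  cartan_cartan : ∀ k ∈ Finset.Icc 1 N, ∀ j ∈ Finset.Icc 1 N, ⁅h k, h j⁆ = 0
  cartan_raise : ∀ k ∈ Finset.Icc 1 N, ∀ n ∈ Finset.Icc 1 (N - 1),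
    ⁅h k, e n⁆ = ((if k = n then 1 else 0) - (if k = n + 1 then 1 else 0) : ℂ) • e n
  cartan_lower : ∀ k ∈ Finset.Icc 1 N, ∀ n ∈ Finset.Icc 1 (N - 1),
    ⁅h k, f n⁆ = ((if k = n + 1 then 1 else 0) - (if k = n then 1 else 0) : ℂ) • f n
  raise_lower : ∀ n ∈ Finset.Icc 1 (N - 1), ∀ m ∈ Finset.Icc 1 (N - 1),
    ⁅e n, f m⁆ = if n = m then h n - h (n + 1) else 0
  raise_raise : ∀ n ∈ Finset.Icc 1 (N - 1), ∀ m ∈ Finset.Icc 1 (N - 1),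
    n + 2 ≤ m → ⁅e n, e m⁆ = 0
  lower_lower : ∀ n ∈ Finset.Icc 1 (N - 1), ∀ m ∈ Finset.Icc 1 (N - 1),
    n + 2 ≤ m → ⁅f n, f m⁆ = 0
  serre_raise : ∀ n ∈ Finset.Icc 1 (N - 1), ∀ m ∈ Finset.Icc 1 (N - 1),
    (m = n + 1 ∨ n = m + 1) → ⁅e n, ⁅e n, e m⁆⁆ = 0
  serre_lower : ∀ n ∈ Finset.Icc 1 (N - 1), ∀ m ∈ Finset.Icc 1 (N - 1),
    (m = n + 1 ∨ n = m + 1) → ⁅f n, ⁅f n, f m⁆⁆ = 0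

/-! ### The delta-functions and the pairing -/

/-- The point with `γ_{ℓ,1} = s` of the common zero set of the arguments of the delta-functions
`∏_{k=2}^{ℓ} δ(∑_{j≤k} γ_{k,j} - ∑_{i≤k-1} γ_{k-1,i})` and
`∏_{1≤i≤k≤ℓ-1} δ(γ_{k,i} - γ_{k+1,i} + ħ/2)`; see `gzSupport_iff`. -/
def gzSupport (ℓ : ℕ) (ħ : ℝ) (s : ℂ) : GZArray ℓ := fun p =>
  if p.1.2 = 1 then s - ((ℓ : ℂ) - (p.1.1 : ℂ)) * (ħ : ℂ) / 2
  else ((p.1.1 : ℂ) - 2 * (p.1.2 : ℂ) + 1) * (ħ : ℂ) / 2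

/-- `gzSupport ℓ ħ s` is the only array with `γ_{ℓ,1} = s` at which the arguments of all the
delta-functions vanish. -/
theorem gzSupport_iff {ℓ : ℕ} (hℓ : 1 ≤ ℓ) (ħ : ℝ) (lam : Fin (ℓ + 1) → ℝ) (s : ℂ)
    (γ : GZArray ℓ) :
    ((∀ k ∈ Finset.Icc 2 ℓ, ∑ j ∈ Finset.Icc 1 k, gzEntry lam γ k j -
          ∑ i ∈ Finset.Icc 1 (k - 1), gzEntry lam γ (k - 1) i = 0) ∧
      (∀ k ∈ Finset.Icc 1 (ℓ - 1), ∀ i ∈ Finset.Icc 1 k,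
          gzEntry lam γ k i - gzEntry lam γ (k + 1) i + (ħ : ℂ) / 2 = 0) ∧
      gzEntry lam γ ℓ 1 = s) ↔ γ = gzSupport ℓ ħ s := by
  have mem : ∀ k i : ℕ, 1 ≤ i → i ≤ k → k ≤ ℓ → (k, i) ∈ gzIndex ℓ := by
    intro k i h1 h2 h3
    simp only [gzIndex, Finset.mem_filter, Finset.mem_product, Finset.mem_Icc]
    omega
  constructor
  · rintro ⟨h1, h2, h3⟩
    have col : ∀ d k i : ℕ, k + d ≤ ℓ → 1 ≤ i → i ≤ k →
        gzEntry lam γ k i = gzEntry lam γ (k + d) i - (d : ℂ) * (ħ : ℂ) / 2 := by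
      intro d
      induction d with
      | zero => intro k i _ _ _; simp
      | succ d ih =>
        intro k i hk hi hik
        have e1 := ih k i (by omega) hi hik
        have e2 := h2 (k + d) (by simp; omega) i (by simp; omega)
        have e3 : k + (d + 1) = k + d + 1 := by omega
        rw [e3]
        push_cast
        linear_combination e1 + e2
    have diag : ∀ k : ℕ, 2 ≤ k → k ≤ ℓ →
        gzEntry lam γ k k = (1 - (k : ℂ)) * (ħ : ℂ) / 2 := by
      intro k hk hkl
      obtain ⟨m, rfl⟩ : ∃ m, k = m + 1 := ⟨k - 1, by omega⟩
      have e1 := h1 (m + 1) (by simp; omega)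
      rw [Finset.sum_Icc_succ_top (by omega), Nat.add_sub_cancel] at e1
      have e2 : ∑ j ∈ Finset.Icc 1 m, gzEntry lam γ (m + 1) j =
          ∑ j ∈ Finset.Icc 1 m, gzEntry lam γ m j + (m : ℂ) * ((ħ : ℂ) / 2) := by
        have : ∀ j ∈ Finset.Icc 1 m,
            gzEntry lam γ (m + 1) j = gzEntry lam γ m j + (ħ : ℂ) / 2 := by
          intro j hj
          have := h2 m (by simp; omega) j hj
          linear_combination -this
        rw [Finset.sum_congr rfl this, Finset.sum_add_distrib]
        simp
      rw [e2] at e1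
      push_cast
      linear_combination e1
    funext ⟨⟨k, i⟩, hp⟩
    have hp' := hp
    simp only [gzIndex, Finset.mem_filter, Finset.mem_product, Finset.mem_Icc] at hp'
    have ev : γ ⟨(k, i), hp⟩ = gzEntry lam γ k i := by simp [gzEntry, hp]
    rw [ev]
    simp only [gzSupport]
    obtain ⟨d, rfl⟩ : ∃ d, ℓ = k + d := ⟨ℓ - k, by omega⟩
    split_ifs with hi
    · subst hi
      rw [col d k 1 le_rfl le_rfl (by omega), h3]
      push_cast
      ring
    · obtain ⟨b, rfl⟩ : ∃ b, k = i + b := ⟨k - i, by omega⟩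
      have e1 := col b i i (by omega) (by omega) le_rfl
      rw [diag i (by omega) (by omega)] at e1
      push_cast
      linear_combination -e1
  · rintro rfl
    have ent : ∀ k i : ℕ, 1 ≤ i → i ≤ k → k ≤ ℓ → gzEntry lam (gzSupport ℓ ħ s) k i =
        if i = 1 then s - ((ℓ : ℂ) - (k : ℂ)) * (ħ : ℂ) / 2
        else ((k : ℂ) - 2 * (i : ℂ) + 1) * (ħ : ℂ) / 2 := by
      intro k i a b c
      simp [gzEntry, mem k i a b c, gzSupport]
    have step : ∀ k i : ℕ, 1 ≤ i → i ≤ k → k + 1 ≤ ℓ →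
        gzEntry lam (gzSupport ℓ ħ s) k i =
          gzEntry lam (gzSupport ℓ ħ s) (k + 1) i - (ħ : ℂ) / 2 := by
      intro k i a b c
      rw [ent k i a b (by omega), ent (k + 1) i a (by omega) c]
      split_ifs <;> push_cast <;> ring
    refine ⟨?_, ?_, ?_⟩
    · intro k hk
      simp only [Finset.mem_Icc] at hk
      obtain ⟨m, rfl⟩ : ∃ m, k = m + 1 := ⟨k - 1, by omega⟩
      rw [Finset.sum_Icc_succ_top (by omega), Nat.add_sub_cancel,
        Finset.sum_congr rfl (g := fun j => gzEntry lam (gzSupport ℓ ħ s) (m + 1) j - (ħ : ℂ) / 2)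
          (s₁ := Finset.Icc 1 m)
          (fun j hj => step m j (by simp at hj; omega) (by simp at hj; omega) (by omega)),
        Finset.sum_sub_distrib, ent (m + 1) (m + 1) (by omega) le_rfl (by omega),
        if_neg (by omega)]
      simp
      ring
    · intro k hk i hi
      simp only [Finset.mem_Icc] at hk hi
      rw [step k i hi.1 hi.2 (by omega)]
      ring
    · rw [ent ℓ 1 le_rfl hℓ le_rfl]
      simp

section Pairing

variable {ℓ : ℕ} (ħ : ℝ) (lam : Fin (ℓ + 1) → ℝ)

/-- The value of `μ φ ψ` at the point of the line carrying the delta-functions with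
`γ_{ℓ,1} = s`. Zeros of `μ` there cancel poles of `ψ`, so the value is taken by continuity from the
regular arrays. -/
def gzDensity (φ ψ : GZFun ℓ ħ) (s : ℂ) : ℂ :=
  limUnder (comap (Subtype.val : gzRegular ℓ ħ → GZArray ℓ) (𝓝 (gzSupport ℓ ħ s)))
    (fun γ => gzMeasure ħ lam γ * φ γ * ψ γ)

/-- The pairing `∫ μ φ Ψ ∏ dγ_{n,j}` of a function `φ` with the distribution `Ψ` that is the product
of `ψ` and the delta-functions. Their arguments are affine, and unimodular in the variables other
than `γ_{ℓ,1}`, so what remains is the integral over `γ_{ℓ,1} ∈ c + iℝ`, `dγ_{ℓ,1} = i dy`. -/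
def gzPairing (c : ℝ) (φ ψ : GZFun ℓ ħ) : ℂ :=
  ∫ y : ℝ, Complex.I * gzDensity ħ lam φ ψ ((c : ℂ) + (y : ℂ) * Complex.I)

/-- The pairing makes sense: `μ φ ψ` extends to almost every point of the line, and the integral
converges absolutely. -/
def GZPairable (c : ℝ) (φ ψ : GZFun ℓ ħ) : Prop :=
  (∀ᵐ y : ℝ, ∃ v : ℂ,
    Tendsto (fun γ => gzMeasure ħ lam γ * φ γ * ψ γ)
      (comap (Subtype.val : gzRegular ℓ ħ → GZArray ℓ)
        (𝓝 (gzSupport ℓ ħ ((c : ℂ) + (y : ℂ) * Complex.I)))) (𝓝 v)) ∧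
  Integrable (fun y : ℝ => gzDensity ħ lam φ ψ ((c : ℂ) + (y : ℂ) * Complex.I))

/-- The test functions: restrictions of entire functions of the array which on every domain
`|Re γ_{n,j}| ≤ R` grow at most polynomially. Constants, polynomials and their products with
`e^{-xγ_{1,1}/ħ}` are among them. -/
def IsGZTest (φ : GZFun ℓ ħ) : Prop :=
  ∃ F : GZArray ℓ → ℂ, Differentiable ℂ F ∧
    (∀ R : ℝ, ∃ (C : ℝ) (N : ℕ), ∀ γ : GZArray ℓ, (∀ p, |(γ p).re| ≤ R) →
      ‖F γ‖ ≤ C * (1 + ‖γ‖) ^ N) ∧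
    ∀ γ : gzRegular ℓ ħ, φ γ = F γ.1

/-! ### Whittaker vectors and the parabolic Whittaker function -/

/-- The left Whittaker vector equations
`⟨ψ_L| E_{n+1,n} = (-1)^{n-1} ħ⁻¹ ⟨ψ_L|`, `1 ≤ n ≤ ℓ`. -/
def IsLeftWhittakerVector (φ : GZFun ℓ ħ) : Prop :=
  ∀ n ∈ Finset.Icc 1 ℓ, gzLowerAdj ħ lam n φ = ((-1 : ℂ) ^ (n - 1) / (ħ : ℂ)) • φ

/-- The `(1,ℓ+1)`-parabolic right Whittaker vector equations with sign `(-1)^ε` for the distribution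
`|Ψ⟩` with coefficient `ψ`: `E_{kk} Ψ = 0` for `2 ≤ k ≤ ℓ`, `E_{k,k+1} Ψ = 0` for `1 ≤ k ≤ ℓ-1`, and
`E_{1,ℓ+1} Ψ = (-1)^ε ħ⁻¹ Ψ`. As usual for distributions, `X Ψ` is the functional
`φ ↦ ⟨φ·X, Ψ⟩` on test functions. -/
structure IsRightWhittakerVector (c : ℝ) (ε : ℕ) (ψ : GZFun ℓ ħ) : Prop where
  pairable : ∀ φ, IsGZTest ħ φ → GZPairable ħ lam c φ ψ
  cartan : ∀ k ∈ Finset.Icc 2 ℓ, ∀ φ, IsGZTest ħ φ →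
    GZPairable ħ lam c (gzCartan ħ lam k φ) ψ ∧ gzPairing ħ lam c (gzCartan ħ lam k φ) ψ = 0
  raise : ∀ k ∈ Finset.Icc 1 (ℓ - 1), ∀ φ, IsGZTest ħ φ →
    GZPairable ħ lam c (gzRaiseAdj ħ lam k φ) ψ ∧ gzPairing ħ lam c (gzRaiseAdj ħ lam k φ) ψ = 0
  root : ∀ φ, IsGZTest ħ φ →
    GZPairable ħ lam c (gzRootAdj ħ lam (ℓ - 1) φ) ψ ∧
      gzPairing ħ lam c (gzRootAdj ħ lam (ℓ - 1) φ) ψ =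
        ((-1 : ℂ) ^ ε / (ħ : ℂ)) * gzPairing ħ lam c φ ψ

/-- The left vector `⟨ψ_L| = 1/(2πiħ)`. -/
def gzLeftVector : GZFun ℓ ħ := fun _ => 1 / (2 * (Real.pi : ℂ) * Complex.I * (ħ : ℂ))

/-- The coefficient of the delta-functions in the right vector `|ψ_R⟩`:
`∏_{n=2}^{ℓ} ∏_{i≠j} Γ((γ_{n,i} - γ_{n,j})/ħ)
  ∏_{j=1}^{ℓ+1} ħ^{(γ_{ℓ,1} - λ_j)/ħ + 1/2} Γ((γ_{ℓ,1} - λ_j)/ħ + 1/2)`. -/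
def gzRightVector : GZFun ℓ ħ := fun γ =>
  (∏ n ∈ Finset.Icc 2 ℓ, ∏ i ∈ Finset.Icc 1 n, ∏ j ∈ (Finset.Icc 1 n).erase i,
    Complex.Gamma ((gzEntry lam γ.1 n i - gzEntry lam γ.1 n j) / (ħ : ℂ))) *
  ∏ j : Fin (ℓ + 1),
    ((ħ : ℂ) ^ ((gzEntry lam γ.1 ℓ 1 - (lam j : ℂ)) / (ħ : ℂ) + 1 / 2) *
      Complex.Gamma ((gzEntry lam γ.1 ℓ 1 - (lam j : ℂ)) / (ħ : ℂ) + 1 / 2))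

/-- The matrix element `e^{-ρ₁ x} ⟨φ| e^{-x E_{11}} |Ψ⟩`, `ρ₁ = ℓ/2`, that is, the matrix element
`e^{-ρ₁ (x_1 - x_{ℓ+1})} ⟨φ| exp(-∑ x_i H_i) |Ψ⟩`, `H_1 = E_{11}`, specialized to `x_1 = x` and
`x_i = 0` for `i ≠ 1`. -/
def gzMatrixElement (c : ℝ) (φ ψ : GZFun ℓ ħ) (x : ℝ) : ℂ :=
  Complex.exp (-((ℓ : ℂ) / 2) * (x : ℂ)) * gzPairing ħ lam c φ (gzTorus ħ lam x ψ)

/-- The `(1,ℓ+1)`-parabolic Whittaker function at `(x,0,…,0)`, with integration over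
`γ_{ℓ,1} ∈ ε - ħ/2 + iℝ`. -/
def parabolicWhittaker (ε : ℝ) (x : ℝ) : ℂ :=
  gzMatrixElement ħ lam (ε - ħ / 2) (gzLeftVector ħ) (gzRightVector ħ lam) x

end Pairing

/-! ### The integrals -/

/-- `Γ₁(z|ω) = ω^{z/ω} Γ(z/ω)`. -/
def modGamma (z : ℂ) (ω : ℝ) : ℂ := (ω : ℂ) ^ (z / (ω : ℂ)) * Complex.Gamma (z / (ω : ℂ))

/-- `e^{-ixH/ħ} ∏_{j=1}^{ℓ+1} Γ₁(iH - λ_j|ħ)`. -/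
def mellinBarnesIntegrand {ℓ : ℕ} (ħ : ℝ) (lam : Fin (ℓ + 1) → ℝ) (x : ℝ) (H : ℂ) : ℂ :=
  Complex.exp (-(Complex.I / (ħ : ℂ)) * (x : ℂ) * H) *
    ∏ j : Fin (ℓ + 1), modGamma (Complex.I * H - (lam j : ℂ)) ħ

/-- The integrand of Givental's integral. -/
def giventalIntegrand {ℓ : ℕ} (ħ : ℝ) (lam : Fin (ℓ + 1) → ℝ) (x : ℝ) (t : Fin ℓ → ℝ) : ℝ :=
  Real.exp (-(1 / ħ) *
    (∑ j : Fin ℓ, lam j.castSucc * t j + lam (Fin.last ℓ) * (x - ∑ j : Fin ℓ, t j) +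
      ∑ j : Fin ℓ, Real.exp (t j) + Real.exp (x - ∑ j : Fin ℓ, t j)))

end

/-!
The proof rests on one family of difference operators, `rowOp`: all `E_{n,n+1}`, all `E_{n+1,n}`
and all their transposes shift the entries of a row by `±ħ`, with coefficients that are rational
functions of that row and a neighbouring one. For the transposes this holds because
`1/(Γ(z)Γ(-z))` divided by `z` changes sign under `z ↦ z + 1`, so that `μ` is multiplied by a
rational function when an entry is shifted by `±ħ` (`gzMeasure_gzShift`).

*The representation.* In a double commutator the coefficient of each product of three shifts
vanishes once it is symmetrized in the two shifts of the repeated operator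
(`rowOp_lie_lie_eq_zero`), and this is an identity between rational functions of three entries. In
`[E_{n,n+1}, E_{n+1,n}]` the products of shifts of different entries cancel, and the diagonal terms
form a Lagrange sum of a monic polynomial of degree `2n` over the `2n` nodes `γ_{n,s}`,
`γ_{n,s} + ħ`, whose value, the sum of the nodes minus that of the roots, yields the weight
`E_{nn} - E_{n+1,n+1}` (`lie_gzRaise_gzLower_self`).

*The left vector.* The transpose of `E_{n+1,n}` multiplies a constant by `(-1)^{n-1}/ħ` times the
Lagrange sum of a monic polynomial of degree `n - 1` over `n` nodes, which is `1`.

*The right vector.* The product `μ ψ_R` is `∏_j Γ₁(γ_{ℓ,1} + ħ/2 - λ_j|ħ)`, so pairings reduce to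
integrals over the line `gzSupport`. There the factors `γ_{k,i} - γ_{k+1,i} + ħ/2` vanish, which
gives `E_{k,k+1} ψ_R = 0`. The transpose of `E_{1,ℓ+1}` is a sum over paths that choose one entry
from each row (`gzRootAdj_apply`); in the limit only the path through the first entries survives,
its coefficients telescope (`tendsto_gzPath`), and it shifts `γ_{ℓ,1}` by `ħ` while multiplying by
`∏_j (γ_{ℓ,1} + ħ/2 - λ_j)`. By the functional equation of `Γ` the result is the original integrand
translated by `ħ`, and the contour can be moved back because `Γ` decays rapidly in vertical strips
(`RapidDecayOnStrip.integral_eq`).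

*The Whittaker function.* With `γ_{ℓ,1} + ħ/2 = iH` the pairing is the Mellin–Barnes integral.
Givental's integral is a convolution of functions whose Fourier transforms are Gamma functions, by
Euler's integral; Fourier inversion for one factor and Fubini's theorem give the same
Mellin–Barnes integral (`integral_giventalIntegrand`).
-/

noncomputable section

/-! ### Entries of shifted arrays -/

section Entries

variable {ℓ : ℕ} {ħ : ℝ} (lam : Fin (ℓ + 1) → ℝ)

theorem mem_gzIndex {ℓ n i : ℕ} : (n, i) ∈ gzIndex ℓ ↔ 1 ≤ i ∧ i ≤ n ∧ n ≤ ℓ := by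
  simp only [gzIndex, Finset.mem_filter, Finset.mem_product, Finset.mem_Icc]
  omega

theorem gzEntry_gzShift {n i : ℕ} (h : (n, i) ∈ gzIndex ℓ) (γ : gzRegular ℓ ħ) (k : ℤ)
    (m j : ℕ) : gzEntry lam (gzShift γ n i k).1 m j =
      gzEntry lam γ.1 m j + if m = n ∧ j = i then (k : ℂ) * (ħ : ℂ) else 0 := by
  by_cases hm : (m, j) ∈ gzIndex ℓ
  · simp [gzEntry, hm, gzShift, Prod.ext_iff]
  · have : ¬ (m = n ∧ j = i) := by rintro ⟨rfl, rfl⟩; exact hm h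
    simp [gzEntry, hm, this]

theorem gzEntry_gzShift_self {n i : ℕ} (h : (n, i) ∈ gzIndex ℓ) (γ : gzRegular ℓ ħ) (k : ℤ) :
    gzEntry lam (gzShift γ n i k).1 n i = gzEntry lam γ.1 n i + k * ħ := by
  rw [gzEntry_gzShift lam h, if_pos ⟨rfl, rfl⟩]

theorem gzEntry_gzShift_of_ne {n i m j : ℕ} (h : (n, i) ∈ gzIndex ℓ) (γ : gzRegular ℓ ħ) (k : ℤ)
    (hne : ¬ (m = n ∧ j = i)) :
    gzEntry lam (gzShift γ n i k).1 m j = gzEntry lam γ.1 m j := by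
  rw [gzEntry_gzShift lam h, if_neg hne, add_zero]

theorem gzShift_comm (γ : gzRegular ℓ ħ) (n i m j : ℕ) (k l : ℤ) :
    gzShift (gzShift γ n i k) m j l = gzShift (gzShift γ m j l) n i k := by
  apply Subtype.ext
  funext q
  simp only [gzShift]
  ring

theorem gzShift_gzShift (γ : gzRegular ℓ ħ) (n i : ℕ) (k l : ℤ) :
    gzShift (gzShift γ n i k) n i l = gzShift γ n i (k + l) := by
  apply Subtype.ext
  funext q
  simp only [gzShift]
  split_ifs
  · push_cast; ring
  · ring

theorem gzShift_zero (γ : gzRegular ℓ ħ) (n i : ℕ) : gzShift γ n i 0 = γ := by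
  apply Subtype.ext
  funext q
  simp [gzShift]

theorem gzEntry_sub_ne (γ : gzRegular ℓ ħ) {n i s : ℕ} (hi : (n, i) ∈ gzIndex ℓ)
    (hs : (n, s) ∈ gzIndex ℓ) (his : i ≠ s) (k : ℤ) :
    gzEntry lam γ.1 n i - gzEntry lam γ.1 n s ≠ k * ħ := by
  have := γ.2 ⟨(n, i), hi⟩ ⟨(n, s), hs⟩ rfl (by simpa [Subtype.ext_iff] using his) k
  simpa [gzEntry, hi, hs] using this

end Entries

/-! ### Sums over the nodes of an interpolation problem -/

open Polynomial in
/-- For a monic polynomial `∏ (X - b_j)` with as many roots as there are nodes `v_i`, the sum of its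
values divided by the derivatives of the nodal polynomial is `∑ v_i - ∑ b_j`. -/
theorem sum_prod_sub_div_prod_sub {ι κ : Type*} [DecidableEq ι] (s : Finset ι) (t : Finset κ)
    (v : ι → ℂ) (b : κ → ℂ) (hv : Set.InjOn v s) (hc : t.card = s.card) (hs : s.Nonempty) :
    ∑ i ∈ s, (∏ j ∈ t, (v i - b j)) / ∏ j ∈ s.erase i, (v i - v j) =
      ∑ i ∈ s, v i - ∑ j ∈ t, b j := by
  have hpos : 0 < s.card := Finset.card_pos.mpr hs
  set P : ℂ[X] := Lagrange.nodal t b - Lagrange.nodal s v with hP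
  have hdeg : P.degree < s.card := by
    have h1 : (Lagrange.nodal t b).degree = (Lagrange.nodal s v).degree := by
      rw [Lagrange.degree_nodal, Lagrange.degree_nodal, hc]
    have := degree_sub_lt_left h1 Lagrange.nodal_ne_zero
      (by rw [Lagrange.nodal_monic.leadingCoeff, Lagrange.nodal_monic.leadingCoeff])
    rwa [Lagrange.degree_nodal, hc] at this
  have key := Lagrange.coeff_eq_sum hv hdeg
  have hct : (Lagrange.nodal t b).coeff (s.card - 1) = - ∑ j ∈ t, b j := by
    rw [Lagrange.nodal_eq, ← hc]
    exact prod_X_sub_C_coeff_card_pred t b (by omega)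
  have hcs : (Lagrange.nodal s v).coeff (s.card - 1) = - ∑ j ∈ s, v j := by
    rw [Lagrange.nodal_eq]
    exact prod_X_sub_C_coeff_card_pred s v hpos
  rw [hP, coeff_sub, hct, hcs] at key
  rw [show ∑ i ∈ s, v i - ∑ j ∈ t, b j = -∑ j ∈ t, b j - -∑ i ∈ s, v i by ring, key]
  refine Finset.sum_congr rfl fun i hi => ?_
  rw [eval_sub, Lagrange.eval_nodal_at_node hi, sub_zero, Lagrange.eval_nodal]

open Polynomial in
/-- The same sum for a monic polynomial with one root less than there are nodes. -/
theorem sum_prod_sub_div_prod_sub_eq_one {ι κ : Type*} [DecidableEq ι] (s : Finset ι)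
    (t : Finset κ) (v : ι → ℂ) (b : κ → ℂ) (hv : Set.InjOn v s) (hc : t.card + 1 = s.card) :
    ∑ i ∈ s, (∏ j ∈ t, (v i - b j)) / ∏ j ∈ s.erase i, (v i - v j) = 1 := by
  have hdeg : (s.card : WithBot ℕ) = (Lagrange.nodal t b).degree + 1 := by
    rw [Lagrange.degree_nodal, ← hc]; norm_cast
  have key := Lagrange.leadingCoeff_eq_sum hv hdeg
  rw [Lagrange.nodal_monic.leadingCoeff] at key
  rw [key]
  exact Finset.sum_congr rfl fun i _ => by rw [Lagrange.eval_nodal]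

/-! ### Difference operators attached to a pair of rows -/

/-- `∏_{j ∈ J} (x_{n,i} - x_{m,j} - η/2) / ∏_{s ∈ S} (x_{n,i} - x_{n,s})`. -/
def rowQuot (x : ℕ → ℕ → ℂ) (η : ℂ) (n m i : ℕ) (J S : Finset ℕ) : ℂ :=
  (∏ j ∈ J, (x n i - x m j - η / 2)) / ∏ s ∈ S, (x n i - x n s)

theorem rowQuot_congr {x x' : ℕ → ℕ → ℂ} {η : ℂ} {n m i : ℕ} {J S : Finset ℕ}
    (h : x n i = x' n i) (hJ : ∀ j ∈ J, x m j = x' m j) (hS : ∀ s ∈ S, x n s = x' n s) :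
    rowQuot x η n m i J S = rowQuot x' η n m i J S := by
  unfold rowQuot
  rw [h]
  congr 1
  · exact Finset.prod_congr rfl fun j hj => by rw [hJ j hj]
  · exact Finset.prod_congr rfl fun j hj => by rw [hS j hj]

theorem rowQuot_eq_mul_erase {x : ℕ → ℕ → ℂ} {η : ℂ} {n m i k : ℕ} {J S : Finset ℕ}
    (hk : k ∈ J) :
    rowQuot x η n m i J S = (x n i - x m k - η / 2) * rowQuot x η n m i (J.erase k) S := by
  unfold rowQuot
  rw [← Finset.mul_prod_erase J (fun j => x n i - x m j - η / 2) hk, mul_div_assoc]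

theorem rowQuot_eq_erase_div {x : ℕ → ℕ → ℂ} {η : ℂ} {n m i k : ℕ} {J S : Finset ℕ}
    (hk : k ∈ S) :
    rowQuot x η n m i J S = rowQuot x η n m i J (S.erase k) / (x n i - x n k) := by
  unfold rowQuot
  rw [← Finset.mul_prod_erase S (fun s => x n i - x n s) hk, div_div, mul_comm (x n i - x n k)]

section RowOp

variable {ℓ : ℕ} (ħ : ℝ) (lam : Fin (ℓ + 1) → ℝ)

/-- The coefficient of the shift of `γ_{n,i}` in `rowOp`. -/
def rowCoeff (κ : ℂ) (σ : ℤ) (n m r i : ℕ) (γ : gzRegular ℓ ħ) : ℂ :=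
  κ * rowQuot (gzEntry lam γ.1) (σ * ħ) n m i (Finset.Icc 1 r) ((Finset.Icc 1 n).erase i)

/-- The common form of the operators `E_{n,n+1}` (`σ = 1`, `m = r = n + 1`) and `E_{n+1,n}`
(`σ = -1`, `m = r = n - 1`): the entries of row `n` are shifted by `-σħ`, with coefficients that
involve the rows `n` and `m`, the latter of length `r`. -/
def rowOp (κ : ℂ) (σ : ℤ) (n m r : ℕ) : Module.End ℂ (GZFun ℓ ħ) where
  toFun f := fun γ => ∑ i ∈ Finset.Icc 1 n,
    rowCoeff ħ lam κ σ n m r i γ * f (gzShift γ n i (-σ))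
  map_add' f g := by funext γ; simp [mul_add, Finset.sum_add_distrib]
  map_smul' c f := by
    funext γ
    simp only [Pi.smul_apply, smul_eq_mul, RingHom.id_apply, Finset.mul_sum]
    exact Finset.sum_congr rfl fun i _ => by ring

theorem rowOp_apply (κ : ℂ) (σ : ℤ) (n m r : ℕ) (f : GZFun ℓ ħ) (γ : gzRegular ℓ ħ) :
    rowOp ħ lam κ σ n m r f γ = ∑ i ∈ Finset.Icc 1 n,
      rowCoeff ħ lam κ σ n m r i γ * f (gzShift γ n i (-σ)) := rfl

theorem gzRaise_eq_rowOp (n : ℕ) :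
    gzRaise ħ lam n = rowOp ħ lam (-(1 / (ħ : ℂ))) 1 n (n + 1) (n + 1) := by
  ext f γ
  simp [gzRaise, rowOp, gzRaiseCoeff, rowCoeff, rowQuot]

theorem gzLower_eq_rowOp (n : ℕ) :
    gzLower ħ lam n = rowOp ħ lam (1 / (ħ : ℂ)) (-1) n (n - 1) (n - 1) := by
  ext f γ
  simp [gzLower, rowOp, gzLowerCoeff, rowCoeff, rowQuot, neg_div]

variable {ħ}

/-- The coefficients are not affected by a shift in a row that does not enter them. -/
theorem rowCoeff_gzShift_of_ne (κ : ℂ) (σ : ℤ) {n m r i p j : ℕ} (γ : gzRegular ℓ ħ) (k : ℤ)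
    (hj : (p, j) ∈ gzIndex ℓ) (hn : n ≠ p) (hm : m ≠ p) :
    rowCoeff ħ lam κ σ n m r i (gzShift γ p j k) = rowCoeff ħ lam κ σ n m r i γ := by
  unfold rowCoeff
  congr 1
  apply rowQuot_congr
  · rw [gzEntry_gzShift_of_ne lam hj]; tauto
  · intro s _; rw [gzEntry_gzShift_of_ne lam hj]; tauto
  · intro s _; rw [gzEntry_gzShift_of_ne lam hj]; tauto

variable (ħ)

/-- Two operators commute as soon as every term of one commutes with every term of the other. -/
theorem rowOp_comm {κ κ' : ℂ} {σ σ' : ℤ} {n m r n' m' r' : ℕ}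
    (h : ∀ i ∈ Finset.Icc 1 n, ∀ j ∈ Finset.Icc 1 n', ∀ γ : gzRegular ℓ ħ,
      rowCoeff ħ lam κ σ n m r i γ * rowCoeff ħ lam κ' σ' n' m' r' j (gzShift γ n i (-σ)) =
      rowCoeff ħ lam κ' σ' n' m' r' j γ * rowCoeff ħ lam κ σ n m r i (gzShift γ n' j (-σ'))) :
    ⁅rowOp ħ lam κ σ n m r, rowOp ħ lam κ' σ' n' m' r'⁆ = 0 := by
  rw [Ring.lie_def, sub_eq_zero]
  ext f γ
  simp only [Module.End.mul_apply, rowOp_apply, Finset.mul_sum]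
  rw [Finset.sum_comm]
  refine Finset.sum_congr rfl fun j hj => Finset.sum_congr rfl fun i hi => ?_
  rw [← mul_assoc, h i hi j hj, ← mul_assoc, gzShift_comm γ n i]

/-- Operators whose coefficients do not involve the row shifted by the other commute. -/
theorem rowOp_comm_of_ne (κ κ' : ℂ) (σ σ' : ℤ) {n m r n' m' r' : ℕ} (hn : n ≤ ℓ) (hn' : n' ≤ ℓ)
    (h : n ≠ n') (hm : m ≠ n') (hm' : m' ≠ n) :
    ⁅rowOp ħ lam κ σ n m r, rowOp ħ lam κ' σ' n' m' r'⁆ = 0 := by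
  refine rowOp_comm ħ lam fun i hi j hj γ => ?_
  rw [Finset.mem_Icc] at hi hj
  rw [rowCoeff_gzShift_of_ne lam _ _ _ _ (mem_gzIndex.2 ⟨hi.1, hi.2, hn⟩) h.symm hm',
    rowCoeff_gzShift_of_ne lam _ _ _ _ (mem_gzIndex.2 ⟨hj.1, hj.2, hn'⟩) h hm, mul_comm]

/-- A double commutator vanishes as soon as the coefficients of each product of shifts, symmetrized
in the two shifts of the repeated operator, cancel. -/
theorem rowOp_lie_lie_eq_zero {κ κ' : ℂ} {σ σ' : ℤ} {n m r n' m' r' : ℕ}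
    (h : ∀ i ∈ Finset.Icc 1 n, ∀ i' ∈ Finset.Icc 1 n, ∀ k ∈ Finset.Icc 1 n', ∀ γ : gzRegular ℓ ħ,
      ∀ W : ℕ → ℕ → ℂ, (∀ i i', W i i' =
        rowCoeff ħ lam κ σ n m r i γ * rowCoeff ħ lam κ σ n m r i' (gzShift γ n i (-σ)) *
          rowCoeff ħ lam κ' σ' n' m' r' k (gzShift (gzShift γ n i (-σ)) n i' (-σ)) -
        2 * (rowCoeff ħ lam κ σ n m r i γ *
          rowCoeff ħ lam κ' σ' n' m' r' k (gzShift γ n i (-σ)) *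
          rowCoeff ħ lam κ σ n m r i' (gzShift (gzShift γ n i (-σ)) n' k (-σ'))) +
        rowCoeff ħ lam κ' σ' n' m' r' k γ * rowCoeff ħ lam κ σ n m r i (gzShift γ n' k (-σ')) *
          rowCoeff ħ lam κ σ n m r i' (gzShift (gzShift γ n i (-σ)) n' k (-σ'))) →
      W i i' + W i' i = 0) :
    ⁅rowOp ħ lam κ σ n m r, ⁅rowOp ħ lam κ σ n m r, rowOp ħ lam κ' σ' n' m' r'⁆⁆ = 0 := by
  ext f γ
  simp only [Ring.lie_def, mul_sub, sub_mul, LinearMap.sub_apply, Module.End.mul_apply,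
    LinearMap.zero_apply, Pi.sub_apply, Pi.zero_apply, rowOp_apply, Finset.mul_sum]
  set W : ℕ → ℕ → ℕ → ℂ := fun k i i' =>
        rowCoeff ħ lam κ σ n m r i γ * rowCoeff ħ lam κ σ n m r i' (gzShift γ n i (-σ)) *
          rowCoeff ħ lam κ' σ' n' m' r' k (gzShift (gzShift γ n i (-σ)) n i' (-σ)) -
        2 * (rowCoeff ħ lam κ σ n m r i γ *
          rowCoeff ħ lam κ' σ' n' m' r' k (gzShift γ n i (-σ)) *
          rowCoeff ħ lam κ σ n m r i' (gzShift (gzShift γ n i (-σ)) n' k (-σ'))) +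
        rowCoeff ħ lam κ' σ' n' m' r' k γ * rowCoeff ħ lam κ σ n m r i (gzShift γ n' k (-σ')) *
          rowCoeff ħ lam κ σ n m r i' (gzShift (gzShift γ n i (-σ)) n' k (-σ')) with hW
  set g : ℕ → ℕ → ℕ → ℂ := fun k i i' =>
    f (gzShift (gzShift (gzShift γ n i (-σ)) n i' (-σ)) n' k (-σ')) with hg
  have hg' : ∀ k i i', g k i i' = g k i' i := fun k i i' => by
    simp only [hg]; rw [gzShift_comm γ n i n i']
  have hsum : ∑ k ∈ Finset.Icc 1 n', ∑ i ∈ Finset.Icc 1 n, ∑ i' ∈ Finset.Icc 1 n,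
      W k i i' * g k i i' = 0 := by
    refine Finset.sum_eq_zero fun k hk => ?_
    have h2 : ∑ i ∈ Finset.Icc 1 n, ∑ i' ∈ Finset.Icc 1 n, W k i i' * g k i i' =
        ∑ i ∈ Finset.Icc 1 n, ∑ i' ∈ Finset.Icc 1 n, W k i' i * g k i i' := by
      rw [Finset.sum_comm]
      exact Finset.sum_congr rfl fun i _ => Finset.sum_congr rfl fun i' _ => by rw [hg']
    have h3 : ∑ i ∈ Finset.Icc 1 n, ∑ i' ∈ Finset.Icc 1 n, W k i i' * g k i i' +
        ∑ i ∈ Finset.Icc 1 n, ∑ i' ∈ Finset.Icc 1 n, W k i' i * g k i i' = 0 := by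
      rw [← Finset.sum_add_distrib]
      refine Finset.sum_eq_zero fun i hi => ?_
      rw [← Finset.sum_add_distrib]
      refine Finset.sum_eq_zero fun i' hi' => ?_
      rw [← add_mul, h i hi i' hi' k hk γ (W k) (fun _ _ => rfl), zero_mul]
    rw [← h2] at h3
    exact add_self_eq_zero.mp h3
  rw [← hsum]
  have e1 : ∀ F : ℕ → ℕ → ℕ → ℂ, ∑ i ∈ Finset.Icc 1 n, ∑ i' ∈ Finset.Icc 1 n,
      ∑ k ∈ Finset.Icc 1 n', F i i' k = ∑ k ∈ Finset.Icc 1 n', ∑ i ∈ Finset.Icc 1 n,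
      ∑ i' ∈ Finset.Icc 1 n, F i i' k := by
    intro F
    rw [Finset.sum_comm' (t' := Finset.Icc 1 n') (s' := fun _ => Finset.Icc 1 n)
      (f := fun i k => ∑ i' ∈ Finset.Icc 1 n, F i i' k) (by tauto) |>.symm]
    exact Finset.sum_congr rfl fun i _ => Finset.sum_comm
  have e2 : ∀ F : ℕ → ℕ → ℕ → ℂ, ∑ i ∈ Finset.Icc 1 n, ∑ k ∈ Finset.Icc 1 n',
      ∑ i' ∈ Finset.Icc 1 n, F i k i' = ∑ k ∈ Finset.Icc 1 n', ∑ i ∈ Finset.Icc 1 n,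
      ∑ i' ∈ Finset.Icc 1 n, F i k i' := fun F => Finset.sum_comm
  rw [e1, e2]
  simp only [← Finset.sum_sub_distrib]
  refine Finset.sum_congr rfl fun k hk => Finset.sum_congr rfl fun i hi =>
    Finset.sum_congr rfl fun i' hi' => ?_
  simp only [hW, hg]
  rw [gzShift_comm (gzShift γ n i (-σ)) n' k n i', gzShift_comm γ n' k n i,
    gzShift_comm (gzShift γ n i (-σ)) n' k n i']
  ring

end RowOp

/-! ### The Serre relations -/

section Serre

variable {ℓ : ℕ} (ħ : ℝ) (lam : Fin (ℓ + 1) → ℝ)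

/-- Serre relation in which the repeated operator carries the factors coupling the two rows: its
coefficient contains `γ_{n,i} - γ_{m,k} - η/2`, `η = σħ`, and the other operator shifts row `m`. -/
theorem rowOp_serre_of_coupled {κ κ' : ℂ} {σ : ℤ} {n m r p q : ℕ}
    (hn : n ≤ ℓ) (hm : m ≤ ℓ) (hnm : n ≠ m) (hmr : m ≤ r) (hpn : p ≠ n) :
    ⁅rowOp ħ lam κ σ n m r, ⁅rowOp ħ lam κ σ n m r, rowOp ħ lam κ' σ m p q⁆⁆ = 0 := by
  refine rowOp_lie_lie_eq_zero ħ lam fun i hi i' hi' k hk γ W hW => ?_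
  rw [Finset.mem_Icc] at hi hi' hk
  have mi : (n, i) ∈ gzIndex ℓ := mem_gzIndex.2 ⟨hi.1, hi.2, hn⟩
  have mi' : (n, i') ∈ gzIndex ℓ := mem_gzIndex.2 ⟨hi'.1, hi'.2, hn⟩
  have mk : (m, k) ∈ gzIndex ℓ := mem_gzIndex.2 ⟨hk.1, hk.2, hm⟩
  have hkr : k ∈ Finset.Icc 1 r := Finset.mem_Icc.2 ⟨hk.1, hk.2.trans hmr⟩
  rw [hW, hW]
  simp only [rowCoeff_gzShift_of_ne lam κ' σ _ _ mi hnm.symm hpn,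
    rowCoeff_gzShift_of_ne lam κ' σ _ _ mi' hnm.symm hpn]
  generalize rowCoeff ħ lam κ' σ m p q k γ = c
  unfold rowCoeff
  simp only [rowQuot_eq_mul_erase hkr]
  -- the entries of the shifted arrays that occur outside the common factors
  have a1 : ∀ γ : gzRegular ℓ ħ, ∀ j, (n, j) ∈ gzIndex ℓ → ∀ z,
      gzEntry lam (gzShift γ n j z).1 m k = gzEntry lam γ.1 m k := fun γ j hj z =>
    gzEntry_gzShift_of_ne lam hj _ _ (by tauto)
  have a2 : ∀ γ : gzRegular ℓ ħ, ∀ j, ∀ z,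
      gzEntry lam (gzShift γ m k z).1 n j = gzEntry lam γ.1 n j := fun γ j z =>
    gzEntry_gzShift_of_ne lam mk _ _ (by tauto)
  have v1 : ∀ γ : gzRegular ℓ ħ, ∀ j S, ∀ z,
      rowQuot (gzEntry lam (gzShift γ m k z).1) (σ * ħ) n m j ((Finset.Icc 1 r).erase k) S =
      rowQuot (gzEntry lam γ.1) (σ * ħ) n m j ((Finset.Icc 1 r).erase k) S := by
    intro γ j S z
    apply rowQuot_congr
    · rw [a2]
    · intro s hs
      rw [gzEntry_gzShift_of_ne lam mk]
      rintro ⟨-, rfl⟩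
      simp at hs
    · intro s _; rw [a2]
  by_cases hii : i = i'
  -- two shifts of the same entry: a second difference of a linear function
  · subst hii
    simp only [v1, a1 _ _ mi, a2, gzEntry_gzShift_self lam mi, gzEntry_gzShift_self lam mk]
    push_cast
    ring
  have es : i' ∈ (Finset.Icc 1 n).erase i := by
    rw [Finset.mem_erase, Finset.mem_Icc]; exact ⟨fun h => hii h.symm, hi'⟩
  have es' : i ∈ (Finset.Icc 1 n).erase i' := by
    rw [Finset.mem_erase, Finset.mem_Icc]; exact ⟨hii, hi⟩
  simp only [rowQuot_eq_erase_div es, rowQuot_eq_erase_div es']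
  have v2 : ∀ γ : gzRegular ℓ ħ, ∀ z,
      rowQuot (gzEntry lam (gzShift γ n i z).1) (σ * ħ) n m i' ((Finset.Icc 1 r).erase k)
        (((Finset.Icc 1 n).erase i').erase i) =
      rowQuot (gzEntry lam γ.1) (σ * ħ) n m i' ((Finset.Icc 1 r).erase k)
        (((Finset.Icc 1 n).erase i').erase i) := by
    intro γ z
    apply rowQuot_congr
    · rw [gzEntry_gzShift_of_ne lam mi]; tauto
    · intro s hs; rw [gzEntry_gzShift_of_ne lam mi]; tauto
    · intro s hs; rw [gzEntry_gzShift_of_ne lam mi]; rintro ⟨-, rfl⟩; simp at hs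
  have v3 : ∀ γ : gzRegular ℓ ħ, ∀ z,
      rowQuot (gzEntry lam (gzShift γ n i' z).1) (σ * ħ) n m i ((Finset.Icc 1 r).erase k)
        (((Finset.Icc 1 n).erase i).erase i') =
      rowQuot (gzEntry lam γ.1) (σ * ħ) n m i ((Finset.Icc 1 r).erase k)
        (((Finset.Icc 1 n).erase i).erase i') := by
    intro γ z
    apply rowQuot_congr
    · rw [gzEntry_gzShift_of_ne lam mi']; tauto
    · intro s hs; rw [gzEntry_gzShift_of_ne lam mi']; tauto
    · intro s hs; rw [gzEntry_gzShift_of_ne lam mi']; rintro ⟨-, rfl⟩; simp at hs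
  have b1 : ∀ γ : gzRegular ℓ ħ, ∀ z,
      gzEntry lam (gzShift γ n i z).1 n i' = gzEntry lam γ.1 n i' := fun γ z =>
    gzEntry_gzShift_of_ne lam mi _ _ (by tauto)
  have b2 : ∀ γ : gzRegular ℓ ħ, ∀ z,
      gzEntry lam (gzShift γ n i' z).1 n i = gzEntry lam γ.1 n i := fun γ z =>
    gzEntry_gzShift_of_ne lam mi' _ _ (by tauto)
  simp only [v1, v2, v3, a1 _ _ mi, a1 _ _ mi', a2, b1, b2, gzEntry_gzShift_self lam mi,
    gzEntry_gzShift_self lam mi', gzEntry_gzShift_self lam mk]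
  have d0 := gzEntry_sub_ne lam γ mi mi' hii 0
  have d1 := gzEntry_sub_ne lam γ mi mi' hii σ
  have d2 := gzEntry_sub_ne lam γ mi mi' hii (-σ)
  generalize gzEntry lam γ.1 n i = x at *
  generalize gzEntry lam γ.1 n i' = x' at *
  generalize gzEntry lam γ.1 m k = y at *
  generalize rowQuot (gzEntry lam γ.1) (σ * ħ) n m i' ((Finset.Icc 1 r).erase k)
        (((Finset.Icc 1 n).erase i').erase i) = U' at *
  generalize rowQuot (gzEntry lam γ.1) (σ * ħ) n m i ((Finset.Icc 1 r).erase k)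
        (((Finset.Icc 1 n).erase i).erase i') = U at *
  push_cast at *
  have e0 : x - x' ≠ 0 := by simpa using d0
  have e0' : x' - x ≠ 0 := by rw [← neg_sub]; exact neg_ne_zero.2 e0
  have e1 : x' - (x + -(σ : ℂ) * ħ) ≠ 0 := by
    intro h; apply d1; linear_combination -h
  have e2 : x - (x' + -(σ : ℂ) * ħ) ≠ 0 := by
    intro h; apply d2; linear_combination h
  -- the rest is an identity between rational functions of the entries that are shifted
  generalize hA : x' - (x + -(σ : ℂ) * ħ) = A at *
  generalize hB : x - (x' + -(σ : ℂ) * ħ) = B at *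
  field_simp
  rw [← hA, ← hB]
  ring

/-- Serre relation in which the other operator carries the factors coupling the two rows. -/
theorem rowOp_serre_of_coupled' {κ κ' : ℂ} {σ : ℤ} {n m r p q : ℕ}
    (hn : n ≤ ℓ) (hm : m ≤ ℓ) (hnm : n ≠ m) (hnr : n ≤ r) (hpn : p ≠ n) (hpm : p ≠ m) :
    ⁅rowOp ħ lam κ σ n p q, ⁅rowOp ħ lam κ σ n p q, rowOp ħ lam κ' σ m n r⁆⁆ = 0 := by
  refine rowOp_lie_lie_eq_zero ħ lam fun i hi i' hi' k hk γ W hW => ?_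
  rw [Finset.mem_Icc] at hi hi' hk
  have mi : (n, i) ∈ gzIndex ℓ := mem_gzIndex.2 ⟨hi.1, hi.2, hn⟩
  have mi' : (n, i') ∈ gzIndex ℓ := mem_gzIndex.2 ⟨hi'.1, hi'.2, hn⟩
  have mk : (m, k) ∈ gzIndex ℓ := mem_gzIndex.2 ⟨hk.1, hk.2, hm⟩
  have hir : i ∈ Finset.Icc 1 r := Finset.mem_Icc.2 ⟨hi.1, hi.2.trans hnr⟩
  have hir' : i' ∈ Finset.Icc 1 r := Finset.mem_Icc.2 ⟨hi'.1, hi'.2.trans hnr⟩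
  rw [hW, hW]
  simp only [rowCoeff_gzShift_of_ne lam κ σ _ _ mk hnm hpm]
  have a2 : ∀ γ : gzRegular ℓ ħ, ∀ j, (n, j) ∈ gzIndex ℓ → ∀ z s,
      gzEntry lam (gzShift γ n j z).1 m s = gzEntry lam γ.1 m s := fun γ j hj z s =>
    gzEntry_gzShift_of_ne lam hj _ _ (by tauto)
  by_cases hii : i = i'
  -- two shifts of the same entry: a second difference of a linear function
  · subst hii
    generalize rowCoeff ħ lam κ σ n p q i (gzShift γ n i (-σ)) = c
    generalize rowCoeff ħ lam κ σ n p q i γ = c'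
    unfold rowCoeff
    have v1 : ∀ γ : gzRegular ℓ ħ, ∀ z,
      rowQuot (gzEntry lam (gzShift γ n i z).1) (σ * ħ) m n k ((Finset.Icc 1 r).erase i)
        ((Finset.Icc 1 m).erase k) =
      rowQuot (gzEntry lam γ.1) (σ * ħ) m n k ((Finset.Icc 1 r).erase i)
        ((Finset.Icc 1 m).erase k) := by
      intro γ z
      apply rowQuot_congr
      · rw [a2 _ _ mi]
      · intro s hs; rw [gzEntry_gzShift_of_ne lam mi]; rintro ⟨-, rfl⟩; simp at hs
      · intro s _; rw [a2 _ _ mi]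
    simp only [rowQuot_eq_mul_erase hir, v1, a2 _ _ mi, gzEntry_gzShift_self lam mi]
    push_cast
    ring
  have es : i' ∈ (Finset.Icc 1 n).erase i := by
    rw [Finset.mem_erase, Finset.mem_Icc]; exact ⟨fun h => hii h.symm, hi'⟩
  have es' : i ∈ (Finset.Icc 1 n).erase i' := by
    rw [Finset.mem_erase, Finset.mem_Icc]; exact ⟨hii, hi⟩
  have es'' : i' ∈ (Finset.Icc 1 r).erase i := by
    rw [Finset.mem_erase]; exact ⟨fun h => hii h.symm, hir'⟩
  have v1 : ∀ γ : gzRegular ℓ ħ, ∀ z, ∀ j, j = i ∨ j = i' →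
      rowQuot (gzEntry lam (gzShift γ n j z).1) (σ * ħ) m n k
        (((Finset.Icc 1 r).erase i).erase i') ((Finset.Icc 1 m).erase k) =
      rowQuot (gzEntry lam γ.1) (σ * ħ) m n k (((Finset.Icc 1 r).erase i).erase i')
        ((Finset.Icc 1 m).erase k) := by
    intro γ z j hj
    have mj : (n, j) ∈ gzIndex ℓ := by rcases hj with rfl | rfl <;> assumption
    apply rowQuot_congr
    · rw [a2 _ _ mj]
    · intro s hs
      rw [gzEntry_gzShift_of_ne lam mj]
      rintro ⟨-, rfl⟩
      simp only [Finset.mem_erase] at hs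
      tauto
    · intro s _; rw [a2 _ _ mj]
  have v2 : rowQuot (gzEntry lam (gzShift γ n i (-σ)).1) (σ * ħ) n p i' (Finset.Icc 1 q)
        (((Finset.Icc 1 n).erase i').erase i) =
      rowQuot (gzEntry lam γ.1) (σ * ħ) n p i' (Finset.Icc 1 q)
        (((Finset.Icc 1 n).erase i').erase i) := by
    apply rowQuot_congr
    · rw [gzEntry_gzShift_of_ne lam mi]; tauto
    · intro s hs; rw [gzEntry_gzShift_of_ne lam mi]; tauto
    · intro s hs; rw [gzEntry_gzShift_of_ne lam mi]; rintro ⟨-, rfl⟩; simp at hs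
  have v3 : rowQuot (gzEntry lam (gzShift γ n i' (-σ)).1) (σ * ħ) n p i (Finset.Icc 1 q)
        (((Finset.Icc 1 n).erase i).erase i') =
      rowQuot (gzEntry lam γ.1) (σ * ħ) n p i (Finset.Icc 1 q)
        (((Finset.Icc 1 n).erase i).erase i') := by
    apply rowQuot_congr
    · rw [gzEntry_gzShift_of_ne lam mi']; tauto
    · intro s hs; rw [gzEntry_gzShift_of_ne lam mi']; tauto
    · intro s hs; rw [gzEntry_gzShift_of_ne lam mi']; rintro ⟨-, rfl⟩; simp at hs
  have b1 : ∀ γ : gzRegular ℓ ħ, ∀ z,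
      gzEntry lam (gzShift γ n i z).1 n i' = gzEntry lam γ.1 n i' := fun γ z =>
    gzEntry_gzShift_of_ne lam mi _ _ (by tauto)
  have b2 : ∀ γ : gzRegular ℓ ħ, ∀ z,
      gzEntry lam (gzShift γ n i' z).1 n i = gzEntry lam γ.1 n i := fun γ z =>
    gzEntry_gzShift_of_ne lam mi' _ _ (by tauto)
  unfold rowCoeff
  simp only [rowQuot_eq_erase_div es, rowQuot_eq_erase_div es', rowQuot_eq_mul_erase hir,
    rowQuot_eq_mul_erase es'', v1 _ _ i (Or.inl rfl), v1 _ _ i' (Or.inr rfl), v2, v3,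
    a2 _ _ mi, a2 _ _ mi', b1, b2, gzEntry_gzShift_self lam mi, gzEntry_gzShift_self lam mi']
  have d0 := gzEntry_sub_ne lam γ mi mi' hii 0
  have d1 := gzEntry_sub_ne lam γ mi mi' hii σ
  have d2 := gzEntry_sub_ne lam γ mi mi' hii (-σ)
  push_cast at *
  have e0 : gzEntry lam γ.1 n i - gzEntry lam γ.1 n i' ≠ 0 := by simpa using d0
  have e0' : gzEntry lam γ.1 n i' - gzEntry lam γ.1 n i ≠ 0 := by
    rw [← neg_sub]; exact neg_ne_zero.2 e0
  have e1 : gzEntry lam γ.1 n i' - (gzEntry lam γ.1 n i + -(σ : ℂ) * ħ) ≠ 0 := by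
    intro h; apply d1; linear_combination -h
  have e2 : gzEntry lam γ.1 n i - (gzEntry lam γ.1 n i' + -(σ : ℂ) * ħ) ≠ 0 := by
    intro h; apply d2; linear_combination h
  generalize gzEntry lam γ.1 n i = x at *
  generalize gzEntry lam γ.1 n i' = x' at *
  -- the rest is an identity between rational functions of the entries that are shifted
  generalize hA : x' - (x + -(σ : ℂ) * ħ) = A at *
  generalize hB : x - (x' + -(σ : ℂ) * ħ) = B at *
  field_simp
  rw [← hA, ← hB]
  ring

end Serre

/-! ### Commutators of raising and lowering operators -/

/-- The sum over the `2n` nodes `x_s`, `x_s + h` of `∏ (u - y_j - h/2) ∏ (u - z_j - h/2)` divided by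
the derivatives of the nodal polynomial, with the terms of `x_i` and `x_i + h` put together. These
are the diagonal terms of `[E_{n,n+1}, E_{n+1,n}]`. -/
theorem sum_prod_sub_div_shifted_nodes {n : ℕ} (hn : 1 ≤ n) (x y z : ℕ → ℂ) {h : ℂ} (hh : h ≠ 0)
    (hx : ∀ i ∈ Finset.Icc 1 n, ∀ s ∈ Finset.Icc 1 n, i ≠ s →
      x i - x s ≠ 0 ∧ x i - x s ≠ h) :
    ∑ i ∈ Finset.Icc 1 n,
      ((∏ j ∈ Finset.Icc 1 (n + 1), (x i - y j - h / 2)) / (∏ s ∈ (Finset.Icc 1 n).erase i,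
          (x i - x s)) * ((∏ j ∈ Finset.Icc 1 (n - 1), (x i - h - z j + h / 2)) /
          ∏ s ∈ (Finset.Icc 1 n).erase i, (x i - h - x s)) -
        (∏ j ∈ Finset.Icc 1 (n - 1), (x i - z j + h / 2)) / (∏ s ∈ (Finset.Icc 1 n).erase i,
          (x i - x s)) * ((∏ j ∈ Finset.Icc 1 (n + 1), (x i + h - y j - h / 2)) /
          ∏ s ∈ (Finset.Icc 1 n).erase i, (x i + h - x s))) =
      h * (∑ j ∈ Finset.Icc 1 (n + 1), y j + ∑ j ∈ Finset.Icc 1 (n - 1), z j -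
        2 * ∑ i ∈ Finset.Icc 1 n, x i) := by
  classical
  set s := (Finset.Icc 1 n).disjSum (Finset.Icc 1 n) with hs
  set t := (Finset.Icc 1 (n + 1)).disjSum (Finset.Icc 1 (n - 1)) with ht
  set v : ℕ ⊕ ℕ → ℂ := Sum.elim x (fun i => x i + h) with hv
  set b : ℕ ⊕ ℕ → ℂ := Sum.elim (fun j => y j + h / 2) (fun j => z j + h / 2) with hb
  have hinj : Set.InjOn v s := by
    intro p hp q hq hpq
    rw [Finset.mem_coe] at hp hq
    rcases p with i | i <;> rcases q with j | j <;>
      simp only [hs, hv, Finset.inl_mem_disjSum, Finset.inr_mem_disjSum, Sum.elim_inl,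
        Sum.elim_inr] at hp hq hpq
    · by_contra hne
      exact (hx i hp j hq (fun e => hne (by rw [e]))).1 (sub_eq_zero.2 hpq)
    · exfalso
      by_cases e : i = j
      · subst e; exact hh (by linear_combination -hpq)
      · exact (hx i hp j hq e).2 (by linear_combination hpq)
    · exfalso
      by_cases e : i = j
      · subst e; exact hh (by linear_combination hpq)
      · exact (hx j hq i hp (Ne.symm e)).2 (by linear_combination -hpq)
    · by_contra hne
      exact (hx i hp j hq (fun e => hne (by rw [e]))).1 (by linear_combination hpq)
  have hcard : t.card = s.card := by
    simp only [hs, ht, Finset.card_disjSum, Nat.card_Icc]; omega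
  have hne : s.Nonempty := ⟨Sum.inl 1, by simp [hs]; omega⟩
  have key := sum_prod_sub_div_prod_sub s t v b hinj hcard hne
  have el : ∀ i, s.erase (Sum.inl i) =
      ((Finset.Icc 1 n).erase i).disjSum (Finset.Icc 1 n) := by
    intro i; ext p; rcases p with p | p <;> simp [hs]
  have er : ∀ i, s.erase (Sum.inr i) =
      (Finset.Icc 1 n).disjSum ((Finset.Icc 1 n).erase i) := by
    intro i; ext p; rcases p with p | p <;> simp [hs]
  have e0 : ∑ i ∈ s, v i - ∑ j ∈ t, b j = -(∑ j ∈ Finset.Icc 1 (n + 1), y j +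
      ∑ j ∈ Finset.Icc 1 (n - 1), z j - 2 * ∑ i ∈ Finset.Icc 1 n, x i) := by
    simp only [hs, ht, hv, hb, Finset.sum_disjSum, Sum.elim_inl, Sum.elim_inr,
      Finset.sum_add_distrib, Finset.sum_const, Nat.card_Icc, nsmul_eq_mul]
    obtain ⟨m, rfl⟩ : ∃ m, n = m + 1 := ⟨n - 1, by omega⟩
    simp only [Nat.add_sub_cancel]
    push_cast
    ring
  rw [e0] at key
  rw [show ∀ S : ℂ, h * S = -h * -S by intro S; ring, ← key, hs, Finset.sum_disjSum,
    ← Finset.sum_add_distrib, Finset.mul_sum]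
  refine Finset.sum_congr rfl fun i hi => ?_
  rw [← hs, el, er]
  simp only [ht, hv, hb, Finset.prod_disjSum, Sum.elim_inl, Sum.elim_inr]
  rw [← Finset.mul_prod_erase _ (fun s => x i - (x s + h)) hi,
    ← Finset.mul_prod_erase _ (fun s => x i + h - x s) hi]
  have c1 : ∀ (T : Finset ℕ), ∏ s ∈ T, (x i - (x s + h)) = ∏ s ∈ T, (x i - h - x s) :=
    fun T => Finset.prod_congr rfl fun s _ => by ring
  have c2 : ∀ (T : Finset ℕ), ∏ s ∈ T, (x i + h - (x s + h)) = ∏ s ∈ T, (x i - x s) :=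
    fun T => Finset.prod_congr rfl fun s _ => by ring
  have c3 : ∀ (T : Finset ℕ) (y : ℕ → ℂ), ∏ s ∈ T, (x i - (y s + h / 2)) =
    ∏ s ∈ T, (x i - y s - h / 2) := fun T y => Finset.prod_congr rfl fun s _ => by ring
  have c4 : ∀ (T : Finset ℕ) (y : ℕ → ℂ), ∏ s ∈ T, (x i + h - (y s + h / 2)) =
    ∏ s ∈ T, (x i + h - y s - h / 2) := fun T y => Finset.prod_congr rfl fun s _ => by ring
  have c5 : ∀ (T : Finset ℕ) (y : ℕ → ℂ), ∏ s ∈ T, (x i - h - y s + h / 2) =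
    ∏ s ∈ T, (x i - y s - h / 2) := fun T y => Finset.prod_congr rfl fun s _ => by ring
  have c6 : ∀ (T : Finset ℕ) (y : ℕ → ℂ), ∏ s ∈ T, (x i + h - y s - h / 2) =
    ∏ s ∈ T, (x i - y s + h / 2) := fun T y => Finset.prod_congr rfl fun s _ => by ring
  have p0 : ∏ s ∈ (Finset.Icc 1 n).erase i, (x i - x s) ≠ 0 :=
    Finset.prod_ne_zero_iff.2 fun s hs' => by
      rw [Finset.mem_erase] at hs'; exact (hx i hi s hs'.2 hs'.1.symm).1
  have p1 : ∏ s ∈ (Finset.Icc 1 n).erase i, (x i - h - x s) ≠ 0 :=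
    Finset.prod_ne_zero_iff.2 fun s hs' => by
      rw [Finset.mem_erase] at hs'
      exact fun e => (hx i hi s hs'.2 hs'.1.symm).2 (by linear_combination e)
  have p2 : ∏ s ∈ (Finset.Icc 1 n).erase i, (x i + h - x s) ≠ 0 :=
    Finset.prod_ne_zero_iff.2 fun s hs' => by
      rw [Finset.mem_erase] at hs'
      exact fun e => (hx s hs'.2 i hi hs'.1).2 (by linear_combination -e)
  simp only [c1, c2, c3, c4, c5]
  rw [c6 _ z]
  generalize ∏ s ∈ (Finset.Icc 1 n).erase i, (x i - x s) = D0 at *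
  generalize ∏ s ∈ (Finset.Icc 1 n).erase i, (x i - h - x s) = D1 at *
  generalize ∏ s ∈ (Finset.Icc 1 n).erase i, (x i + h - x s) = D2 at *
  generalize ∏ j ∈ Finset.Icc 1 (n + 1), (x i - y j - h / 2) = N0
  generalize ∏ j ∈ Finset.Icc 1 (n + 1), (x i + h - y j - h / 2) = N1
  generalize ∏ j ∈ Finset.Icc 1 (n - 1), (x i - z j - h / 2) = N2
  generalize ∏ j ∈ Finset.Icc 1 (n - 1), (x i - z j + h / 2) = N3
  rw [show x i - (x i + h) = -h by ring, show x i + h - x i = h by ring]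
  field_simp
  ring

section Relations

variable {ℓ : ℕ} (ħ : ℝ) (lam : Fin (ℓ + 1) → ℝ)

/-- `[E_{n,n+1}, E_{n+2,n+1}] = 0`: the factors coupling the rows `n` and `n+1` compensate. -/
theorem lie_gzRaise_gzLower_succ {n : ℕ} (hn : n + 1 ≤ ℓ) :
    ⁅gzRaise ħ lam n, gzLower ħ lam (n + 1)⁆ = 0 := by
  rw [gzRaise_eq_rowOp, gzLower_eq_rowOp]
  refine rowOp_comm ħ lam fun i hi j hj γ => ?_
  have hi' := Finset.mem_Icc.1 hi
  have hj' := Finset.mem_Icc.1 hj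
  have mi : (n, i) ∈ gzIndex ℓ := mem_gzIndex.2 ⟨hi'.1, hi'.2, by omega⟩
  have mj : (n + 1, j) ∈ gzIndex ℓ := mem_gzIndex.2 ⟨hj'.1, hj'.2, hn⟩
  unfold rowCoeff
  simp only [Nat.add_sub_cancel, rowQuot_eq_mul_erase hi, rowQuot_eq_mul_erase hj]
  have v1 : rowQuot (gzEntry lam (gzShift γ n i (-1)).1) (((-1 : ℤ) : ℂ) * ħ) (n + 1) n j
        ((Finset.Icc 1 n).erase i) ((Finset.Icc 1 (n + 1)).erase j) =
      rowQuot (gzEntry lam γ.1) (((-1 : ℤ) : ℂ) * ħ) (n + 1) n j ((Finset.Icc 1 n).erase i)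
        ((Finset.Icc 1 (n + 1)).erase j) := by
    apply rowQuot_congr
    · rw [gzEntry_gzShift_of_ne lam mi]; omega
    · intro s hs; rw [gzEntry_gzShift_of_ne lam mi]; rintro ⟨-, rfl⟩; simp at hs
    · intro s hs; rw [gzEntry_gzShift_of_ne lam mi]; omega
  have v2 : rowQuot (gzEntry lam (gzShift γ (n + 1) j (- -1)).1) (((1 : ℤ) : ℂ) * ħ) n (n + 1) i
        ((Finset.Icc 1 (n + 1)).erase j) ((Finset.Icc 1 n).erase i) =
      rowQuot (gzEntry lam γ.1) (((1 : ℤ) : ℂ) * ħ) n (n + 1) i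
        ((Finset.Icc 1 (n + 1)).erase j) ((Finset.Icc 1 n).erase i) := by
    apply rowQuot_congr
    · rw [gzEntry_gzShift_of_ne lam mj]; omega
    · intro s hs; rw [gzEntry_gzShift_of_ne lam mj]; rintro ⟨-, rfl⟩; simp at hs
    · intro s hs; rw [gzEntry_gzShift_of_ne lam mj]; omega
  rw [v1, v2, gzEntry_gzShift_self lam mi, gzEntry_gzShift_self lam mj,
    gzEntry_gzShift_of_ne lam mi _ _ (by omega), gzEntry_gzShift_of_ne lam mj _ _ (by omega)]
  push_cast
  ring

/-- `[E_{n,n+1}, E_{n+1,n}] = E_{nn} - E_{n+1,n+1}`. -/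
theorem lie_gzRaise_gzLower_self (hħ : ħ ≠ 0) {n : ℕ} (hn : 1 ≤ n) (hnℓ : n ≤ ℓ) :
    ⁅gzRaise ħ lam n, gzLower ħ lam n⁆ = gzCartan ħ lam n - gzCartan ħ lam (n + 1) := by
  have hc : (ħ : ℂ) ≠ 0 := by exact_mod_cast hħ
  have mem : ∀ i ∈ Finset.Icc 1 n, (n, i) ∈ gzIndex ℓ := fun i hi => by
    rw [Finset.mem_Icc] at hi; exact mem_gzIndex.2 ⟨hi.1, hi.2, hnℓ⟩
  rw [gzRaise_eq_rowOp, gzLower_eq_rowOp, Ring.lie_def]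
  ext f γ
  simp only [LinearMap.sub_apply, Module.End.mul_apply, Pi.sub_apply, rowOp_apply, Finset.mul_sum]
  rw [Finset.sum_comm (s := Finset.Icc 1 n) (t := Finset.Icc 1 n) (f := fun i j =>
    rowCoeff ħ lam (1 / (ħ : ℂ)) (-1) n (n - 1) (n - 1) i γ * _), ← Finset.sum_sub_distrib]
  set a := rowCoeff ħ lam (-(1 / (ħ : ℂ))) 1 n (n + 1) (n + 1) with ha
  set b := rowCoeff ħ lam (1 / (ħ : ℂ)) (-1) n (n - 1) (n - 1) with hb
  -- products of shifts of different entries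
  have off : ∀ i ∈ Finset.Icc 1 n, ∀ j ∈ Finset.Icc 1 n, i ≠ j →
      a i γ * b j (gzShift γ n i (-1)) = b j γ * a i (gzShift γ n j (- -1)) := by
    intro i hi j hj hij
    have mi := mem i hi
    have mj := mem j hj
    have es : j ∈ (Finset.Icc 1 n).erase i := Finset.mem_erase.2 ⟨hij.symm, hj⟩
    have es' : i ∈ (Finset.Icc 1 n).erase j := Finset.mem_erase.2 ⟨hij, hi⟩
    simp only [ha, hb, rowCoeff, rowQuot_eq_erase_div es, rowQuot_eq_erase_div es']
    have v1 : rowQuot (gzEntry lam (gzShift γ n i (-1)).1) (((-1 : ℤ) : ℂ) * ħ) n (n - 1) j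
        (Finset.Icc 1 (n - 1)) (((Finset.Icc 1 n).erase j).erase i) =
        rowQuot (gzEntry lam γ.1) (((-1 : ℤ) : ℂ) * ħ) n (n - 1) j
        (Finset.Icc 1 (n - 1)) (((Finset.Icc 1 n).erase j).erase i) := by
      apply rowQuot_congr
      · rw [gzEntry_gzShift_of_ne lam mi]; tauto
      · intro s hs; rw [gzEntry_gzShift_of_ne lam mi]; omega
      · intro s hs; rw [gzEntry_gzShift_of_ne lam mi]; rintro ⟨-, rfl⟩; simp at hs
    have v2 : rowQuot (gzEntry lam (gzShift γ n j (- -1)).1) (((1 : ℤ) : ℂ) * ħ) n (n + 1) i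
        (Finset.Icc 1 (n + 1)) (((Finset.Icc 1 n).erase i).erase j) =
        rowQuot (gzEntry lam γ.1) (((1 : ℤ) : ℂ) * ħ) n (n + 1) i
        (Finset.Icc 1 (n + 1)) (((Finset.Icc 1 n).erase i).erase j) := by
      apply rowQuot_congr
      · rw [gzEntry_gzShift_of_ne lam mj]; tauto
      · intro s hs; rw [gzEntry_gzShift_of_ne lam mj]; omega
      · intro s hs; rw [gzEntry_gzShift_of_ne lam mj]; rintro ⟨-, rfl⟩; simp at hs
    rw [v1, v2, gzEntry_gzShift_self lam mi, gzEntry_gzShift_self lam mj,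
      gzEntry_gzShift_of_ne lam mi _ _ (by tauto), gzEntry_gzShift_of_ne lam mj _ _ (by tauto)]
    have d0 := gzEntry_sub_ne lam γ mi mj hij 0
    have d1 := gzEntry_sub_ne lam γ mi mj hij 1
    push_cast at *
    generalize gzEntry lam γ.1 n i = x at *
    generalize gzEntry lam γ.1 n j = y at *
    have e0 : x - y ≠ 0 := by simpa using d0
    have e1 : x - y - ħ ≠ 0 := by intro h; apply d1; linear_combination h
    rw [show y - x = -(x - y) by ring, show y - (x + -1 * (ħ : ℂ)) = -(x - y - ħ) by ring,
      show x - (y + 1 * (ħ : ℂ)) = x - y - ħ by ring]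
    generalize x - y - (ħ : ℂ) = A at *
    generalize x - y = B at *
    field_simp
  -- products of opposite shifts of the same entry
  have diag : ∑ i ∈ Finset.Icc 1 n, (a i γ * b i (gzShift γ n i (-1)) -
      b i γ * a i (gzShift γ n i (- -1))) =
      gzWeight ħ lam n γ - gzWeight ħ lam (n + 1) γ := by
    have key := sum_prod_sub_div_shifted_nodes hn (gzEntry lam γ.1 n) (gzEntry lam γ.1 (n + 1))
      (gzEntry lam γ.1 (n - 1)) hc (fun i hi s hs his =>
        ⟨by simpa using gzEntry_sub_ne lam γ (mem i hi) (mem s hs) his 0,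
          by simpa using gzEntry_sub_ne lam γ (mem i hi) (mem s hs) his 1⟩)
    have e : gzWeight ħ lam n γ - gzWeight ħ lam (n + 1) γ = -(1 / (ħ : ℂ)) * (1 / ħ) *
        (ħ * (∑ j ∈ Finset.Icc 1 (n + 1), gzEntry lam γ.1 (n + 1) j +
          ∑ j ∈ Finset.Icc 1 (n - 1), gzEntry lam γ.1 (n - 1) j -
          2 * ∑ i ∈ Finset.Icc 1 n, gzEntry lam γ.1 n i)) := by
      simp only [gzWeight, Nat.add_sub_cancel]
      field_simp
      ring
    rw [e, ← key, Finset.mul_sum]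
    refine Finset.sum_congr rfl fun i hi => ?_
    have mi := mem i hi
    have q1 : rowQuot (gzEntry lam (gzShift γ n i (-1)).1) (((-1 : ℤ) : ℂ) * ħ) n (n - 1) i
        (Finset.Icc 1 (n - 1)) ((Finset.Icc 1 n).erase i) =
        (∏ j ∈ Finset.Icc 1 (n - 1),
            (gzEntry lam γ.1 n i - ħ - gzEntry lam γ.1 (n - 1) j + ħ / 2)) /
          ∏ s ∈ (Finset.Icc 1 n).erase i, (gzEntry lam γ.1 n i - ħ - gzEntry lam γ.1 n s) := by
      unfold rowQuot
      rw [gzEntry_gzShift_self lam mi]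
      congr 1
      · refine Finset.prod_congr rfl fun j _ => ?_
        rw [gzEntry_gzShift_of_ne lam mi _ _ (by omega)]; push_cast; ring
      · refine Finset.prod_congr rfl fun j hj => ?_
        rw [gzEntry_gzShift_of_ne lam mi _ _ (by rintro ⟨-, rfl⟩; simp at hj)]; push_cast; ring
    have q2 : rowQuot (gzEntry lam (gzShift γ n i (- -1)).1) (((1 : ℤ) : ℂ) * ħ) n (n + 1) i
        (Finset.Icc 1 (n + 1)) ((Finset.Icc 1 n).erase i) =
        (∏ j ∈ Finset.Icc 1 (n + 1),
            (gzEntry lam γ.1 n i + ħ - gzEntry lam γ.1 (n + 1) j - ħ / 2)) /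
          ∏ s ∈ (Finset.Icc 1 n).erase i, (gzEntry lam γ.1 n i + ħ - gzEntry lam γ.1 n s) := by
      unfold rowQuot
      rw [gzEntry_gzShift_self lam mi]
      congr 1
      · refine Finset.prod_congr rfl fun j _ => ?_
        rw [gzEntry_gzShift_of_ne lam mi _ _ (by omega)]; push_cast; ring
      · refine Finset.prod_congr rfl fun j hj => ?_
        rw [gzEntry_gzShift_of_ne lam mi _ _ (by rintro ⟨-, rfl⟩; simp at hj)]; push_cast; ring
    have q3 : rowQuot (gzEntry lam γ.1) (((-1 : ℤ) : ℂ) * ħ) n (n - 1) i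
        (Finset.Icc 1 (n - 1)) ((Finset.Icc 1 n).erase i) =
        (∏ j ∈ Finset.Icc 1 (n - 1), (gzEntry lam γ.1 n i - gzEntry lam γ.1 (n - 1) j + ħ / 2)) /
          ∏ s ∈ (Finset.Icc 1 n).erase i, (gzEntry lam γ.1 n i - gzEntry lam γ.1 n s) := by
      unfold rowQuot
      congr 1
      refine Finset.prod_congr rfl fun j _ => ?_
      push_cast; ring
    have q4 : rowQuot (gzEntry lam γ.1) (((1 : ℤ) : ℂ) * ħ) n (n + 1) i
        (Finset.Icc 1 (n + 1)) ((Finset.Icc 1 n).erase i) =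
        (∏ j ∈ Finset.Icc 1 (n + 1), (gzEntry lam γ.1 n i - gzEntry lam γ.1 (n + 1) j - ħ / 2)) /
          ∏ s ∈ (Finset.Icc 1 n).erase i, (gzEntry lam γ.1 n i - gzEntry lam γ.1 n s) := by
      unfold rowQuot
      congr 1
      refine Finset.prod_congr rfl fun j _ => ?_
      push_cast; ring
    simp only [ha, hb, rowCoeff, q1, q2, q3, q4]
    ring
  have hfin : gzCartan ħ lam n f γ - gzCartan ħ lam (n + 1) f γ =
      (gzWeight ħ lam n γ - gzWeight ħ lam (n + 1) γ) * f γ := by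
    simp only [gzCartan, LinearMap.coe_mk, AddHom.coe_mk]; ring
  rw [hfin, ← diag, Finset.sum_mul]
  refine Finset.sum_congr rfl fun i hi => ?_
  rw [← Finset.sum_sub_distrib, Finset.sum_eq_single i]
  · rw [gzShift_gzShift, gzShift_gzShift]
    simp only [neg_neg, neg_add_cancel, add_neg_cancel, gzShift_zero]
    ring
  · intro j hj hji
    rw [← mul_assoc, ← mul_assoc, off i hi j hj hji.symm, gzShift_comm γ n i, sub_self]
  · exact fun h => absurd hi h

theorem gzWeight_gzShift (hħ : ħ ≠ 0) {n i k : ℕ} (hk : 1 ≤ k) (h : (n, i) ∈ gzIndex ℓ)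
    (γ : gzRegular ℓ ħ) (c : ℤ) :
    gzWeight ħ lam k (gzShift γ n i c) = gzWeight ħ lam k γ +
      ((if k = n then 1 else 0) - (if k = n + 1 then 1 else 0)) * c := by
  have hc : (ħ : ℂ) ≠ 0 := by exact_mod_cast hħ
  have hni := mem_gzIndex.1 h
  have e : ∀ m, ∑ j ∈ Finset.Icc 1 m, gzEntry lam (gzShift γ n i c).1 m j =
      ∑ j ∈ Finset.Icc 1 m, gzEntry lam γ.1 m j + if m = n then (c : ℂ) * ħ else 0 := by
    intro m
    simp only [gzEntry_gzShift lam h, Finset.sum_add_distrib]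
    congr 1
    by_cases hm : m = n
    · subst hm
      simp [hni.1, hni.2.1]
    · simp [hm]
  unfold gzWeight
  rw [e, e]
  have : k - 1 = n ↔ k = n + 1 := by omega
  simp only [this]
  split_ifs <;> field_simp <;> ring

theorem lie_gzCartan_rowOp (hħ : ħ ≠ 0) (κ : ℂ) (σ : ℤ) {k n m r : ℕ} (hk : 1 ≤ k)
    (hn : n ≤ ℓ) : ⁅gzCartan ħ lam k, rowOp ħ lam κ σ n m r⁆ =
      (((if k = n then 1 else 0) - (if k = n + 1 then 1 else 0)) * σ : ℂ) •
        rowOp ħ lam κ σ n m r := by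
  rw [Ring.lie_def]
  ext f γ
  simp only [LinearMap.sub_apply, Module.End.mul_apply, Pi.sub_apply, rowOp_apply,
    LinearMap.smul_apply, Pi.smul_apply, smul_eq_mul, gzCartan, LinearMap.coe_mk, AddHom.coe_mk,
    Finset.mul_sum]
  rw [← Finset.sum_sub_distrib]
  refine Finset.sum_congr rfl fun i hi => ?_
  rw [Finset.mem_Icc] at hi
  rw [gzWeight_gzShift ħ lam hħ hk (mem_gzIndex.2 ⟨hi.1, hi.2, hn⟩)]
  push_cast
  ring

theorem isGlRepresentation_gz (hħ : ħ ≠ 0) :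
    IsGlRepresentation (ℓ + 1) (gzCartan ħ lam) (gzRaise ħ lam) (gzLower ħ lam) where
  cartan_cartan k _ j _ := by
    rw [Ring.lie_def, sub_eq_zero]
    ext f γ
    simp only [Module.End.mul_apply, gzCartan, LinearMap.coe_mk, AddHom.coe_mk]
    ring
  cartan_raise k hk n hn := by
    simp only [Finset.mem_Icc] at hk hn
    rw [gzRaise_eq_rowOp, lie_gzCartan_rowOp ħ lam hħ _ _ hk.1 (by omega)]
    simp
  cartan_lower k hk n hn := by
    simp only [Finset.mem_Icc] at hk hn
    rw [gzLower_eq_rowOp, lie_gzCartan_rowOp ħ lam hħ _ _ hk.1 (by omega)]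
    simp
  raise_lower n hn m hm := by
    simp only [Finset.mem_Icc] at hn hm
    split_ifs with hnm
    · subst hnm
      exact lie_gzRaise_gzLower_self ħ lam hħ hn.1 (by omega)
    · by_cases h : m = n + 1
      · subst h
        exact lie_gzRaise_gzLower_succ ħ lam (by omega)
      · rw [gzRaise_eq_rowOp, gzLower_eq_rowOp]
        exact rowOp_comm_of_ne ħ lam _ _ _ _ (by omega) (by omega) hnm (by omega) (by omega)
  raise_raise n hn m hm hnm := by
    simp only [Finset.mem_Icc] at hn hm
    rw [gzRaise_eq_rowOp, gzRaise_eq_rowOp]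
    exact rowOp_comm_of_ne ħ lam _ _ _ _ (by omega) (by omega) (by omega) (by omega) (by omega)
  lower_lower n hn m hm hnm := by
    simp only [Finset.mem_Icc] at hn hm
    rw [gzLower_eq_rowOp, gzLower_eq_rowOp]
    exact rowOp_comm_of_ne ħ lam _ _ _ _ (by omega) (by omega) (by omega) (by omega) (by omega)
  serre_raise n hn m hm hnm := by
    simp only [Finset.mem_Icc] at hn hm
    rw [gzRaise_eq_rowOp, gzRaise_eq_rowOp]
    rcases hnm with rfl | rfl
    · exact rowOp_serre_of_coupled ħ lam (by omega) (by omega) (by omega) (by omega) (by omega)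
    · exact rowOp_serre_of_coupled' ħ lam (by omega) (by omega) (by omega) (by omega) (by omega)
        (by omega)
  serre_lower n hn m hm hnm := by
    simp only [Finset.mem_Icc] at hn hm
    rw [gzLower_eq_rowOp, gzLower_eq_rowOp]
    rcases hnm with rfl | rfl
    · exact rowOp_serre_of_coupled' ħ lam (by omega) (by omega) (by omega) (by omega) (by omega)
        (by omega)
    · exact rowOp_serre_of_coupled ħ lam (by omega) (by omega) (by omega) (by omega) (by omega)

end Relations

/-! ### The measure and the transposed operators -/

/-- Divided by `z`, the function `1/(Γ(z)Γ(-z)) = -z sin(πz)/π` changes sign under `z ↦ z + 1`. -/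
theorem Complex.inv_Gamma_add_one_mul_inv_Gamma_neg {z : ℂ} (h0 : z ≠ 0) (h1 : z + 1 ≠ 0) :
    (Complex.Gamma (z + 1))⁻¹ * (Complex.Gamma (-(z + 1)))⁻¹ =
      -((z + 1) / z) * ((Complex.Gamma z)⁻¹ * (Complex.Gamma (-z))⁻¹) := by
  have e1 := Complex.Gamma_add_one z h0
  have e2 := Complex.Gamma_add_one (-(z + 1)) (neg_ne_zero.2 h1)
  rw [show -(z + 1) + 1 = -z by ring] at e2
  rw [e1, e2, mul_inv, mul_inv, inv_neg]
  field_simp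

theorem inv_Gamma_mul_inv_Gamma_neg_add {x y h : ℂ} (hc : h ≠ 0) {k : ℤ} (hk : k = 1 ∨ k = -1)
    (d0 : x - y ≠ 0) (d1 : x - y ≠ -(k * h)) :
    (Complex.Gamma ((x + k * h - y) / h))⁻¹ * (Complex.Gamma ((y - (x + k * h)) / h))⁻¹ =
      -((x - y + k * h) / (x - y)) *
        ((Complex.Gamma ((x - y) / h))⁻¹ * (Complex.Gamma ((y - x) / h))⁻¹) := by
  have e0 : (x - y) / h ≠ 0 := div_ne_zero d0 hc
  have e1 : (x - y) / h + k ≠ 0 := by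
    intro e
    apply d1
    field_simp at e
    linear_combination e
  rw [show (x + k * h - y) / h = (x - y) / h + k by field_simp; ring,
    show (y - (x + k * h)) / h = -((x - y) / h + k) by field_simp; ring,
    show (y - x) / h = -((x - y) / h) by ring,
    show (x - y + k * h) / (x - y) = ((x - y) / h + k) / ((x - y) / h) by field_simp]
  generalize (x - y) / h = z at *
  rcases hk with rfl | rfl
  · simpa using Complex.inv_Gamma_add_one_mul_inv_Gamma_neg e0 (by simpa using e1)
  · have := Complex.inv_Gamma_add_one_mul_inv_Gamma_neg (z := -z) (neg_ne_zero.2 e0) (by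
      intro e; apply e1; push_cast; linear_combination -e)
    push_cast
    rw [show -(-z + 1) = z + -1 by ring, show -z + 1 = -(z + -1) by ring, neg_neg, neg_div_neg_eq]
      at this
    linear_combination this

/-- A product over ordered pairs, with the factors of one element singled out. -/
theorem prod_prod_erase_eq {ι : Type*} [DecidableEq ι] {T : Finset ι} {i : ι} (hi : i ∈ T)
    (g : ι → ι → ℂ) :
    ∏ j ∈ T, ∏ s ∈ T.erase j, g j s =
      (∏ s ∈ T.erase i, (g i s * g s i)) *
        ∏ j ∈ T.erase i, ∏ s ∈ (T.erase j).erase i, g j s := by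
  have h : ∏ j ∈ T.erase i, ∏ s ∈ T.erase j, g j s =
      ∏ j ∈ T.erase i, (g j i * ∏ s ∈ (T.erase j).erase i, g j s) := by
    refine Finset.prod_congr rfl fun j hj => ?_
    rw [Finset.mem_erase] at hj
    rw [Finset.mul_prod_erase (T.erase j) (g j) (Finset.mem_erase.2 ⟨hj.1.symm, hi⟩)]
  rw [← Finset.mul_prod_erase T (fun j => ∏ s ∈ T.erase j, g j s) hi, h,
    Finset.prod_mul_distrib, Finset.prod_mul_distrib, mul_assoc]

/-- A product over ordered pairs when only the factors of one element change. -/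
theorem prod_prod_erase_update {ι : Type*} [DecidableEq ι] {T : Finset ι} {i : ι} (hi : i ∈ T)
    {g g' : ι → ι → ℂ} {c : ι → ℂ}
    (h : ∀ j ∈ T, ∀ s ∈ T, j ≠ i → s ≠ i → g' j s = g j s)
    (hc : ∀ s ∈ T, s ≠ i → g' i s * g' s i = c s * (g i s * g s i)) :
    ∏ j ∈ T, ∏ s ∈ T.erase j, g' j s =
      (∏ s ∈ T.erase i, c s) * ∏ j ∈ T, ∏ s ∈ T.erase j, g j s := by
  have h1 : ∏ s ∈ T.erase i, (g' i s * g' s i) =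
      (∏ s ∈ T.erase i, c s) * ∏ s ∈ T.erase i, (g i s * g s i) := by
    rw [← Finset.prod_mul_distrib]
    refine Finset.prod_congr rfl fun s hs => ?_
    rw [Finset.mem_erase] at hs
    exact hc s hs.2 hs.1
  have h2 : ∏ j ∈ T.erase i, ∏ s ∈ (T.erase j).erase i, g' j s =
      ∏ j ∈ T.erase i, ∏ s ∈ (T.erase j).erase i, g j s := by
    refine Finset.prod_congr rfl fun j hj => Finset.prod_congr rfl fun s hs => ?_
    simp only [Finset.mem_erase] at hj hs
    exact h j hj.2 s hs.2.2 hj.1 hs.1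
  rw [prod_prod_erase_eq hi g', prod_prod_erase_eq hi g, h1, h2, mul_assoc]

section Measure

variable {ℓ : ℕ} (ħ : ℝ) (lam : Fin (ℓ + 1) → ℝ)

theorem gzMeasure_ne_zero (hħ : ħ ≠ 0) (γ : gzRegular ℓ ħ) : gzMeasure ħ lam γ ≠ 0 := by
  have hc : (ħ : ℂ) ≠ 0 := by exact_mod_cast hħ
  refine Finset.prod_ne_zero_iff.2 fun n hn => Finset.prod_ne_zero_iff.2 fun j hj =>
    Finset.prod_ne_zero_iff.2 fun s hs => inv_ne_zero (Complex.Gamma_ne_zero fun m h => ?_)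
  simp only [Finset.mem_Icc, Finset.mem_erase] at hn hj hs
  refine gzEntry_sub_ne lam γ (mem_gzIndex.2 ⟨hj.1, hj.2, hn.2⟩)
    (mem_gzIndex.2 ⟨hs.2.1, hs.2.2, hn.2⟩) (Ne.symm hs.1) (-m) ?_
  rw [div_eq_iff hc] at h
  rw [h]
  push_cast
  ring

/-- The effect of a shift by `±ħ` on `μ`: no Gamma function is left in the quotient. -/
theorem gzMeasure_gzShift (hħ : ħ ≠ 0) {n i : ℕ} (h : (n, i) ∈ gzIndex ℓ) (γ : gzRegular ℓ ħ)
    {k : ℤ} (hk : k = 1 ∨ k = -1) :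
    gzMeasure ħ lam (gzShift γ n i k) = (∏ s ∈ (Finset.Icc 1 n).erase i,
      -((gzEntry lam γ.1 n i - gzEntry lam γ.1 n s + k * ħ) /
        (gzEntry lam γ.1 n i - gzEntry lam γ.1 n s))) * gzMeasure ħ lam γ := by
  have hc : (ħ : ℂ) ≠ 0 := by exact_mod_cast hħ
  have hni := mem_gzIndex.1 h
  unfold gzMeasure
  by_cases hn : n = 1
  -- the first row does not enter the density
  · have : (Finset.Icc 1 n).erase i = ∅ := by
      ext s; simp only [Finset.mem_erase, Finset.mem_Icc, Finset.notMem_empty, iff_false]; omega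
    rw [this, Finset.prod_empty, one_mul]
    refine Finset.prod_congr rfl fun m hm => Finset.prod_congr rfl fun j _ =>
      Finset.prod_congr rfl fun s _ => ?_
    rw [Finset.mem_Icc] at hm
    rw [gzEntry_gzShift_of_ne lam h _ _ (by omega), gzEntry_gzShift_of_ne lam h _ _ (by omega)]
  have hnm : n ∈ Finset.Icc 2 ℓ := Finset.mem_Icc.2 (by omega)
  have hiT : i ∈ Finset.Icc 1 n := Finset.mem_Icc.2 (by omega)
  have hrow := prod_prod_erase_update hiT
    (g := fun j s => (Complex.Gamma ((gzEntry lam γ.1 n j - gzEntry lam γ.1 n s) / (ħ : ℂ)))⁻¹)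
    (g' := fun j s => (Complex.Gamma ((gzEntry lam (gzShift γ n i k).1 n j -
      gzEntry lam (gzShift γ n i k).1 n s) / (ħ : ℂ)))⁻¹)
    (c := fun s => -((gzEntry lam γ.1 n i - gzEntry lam γ.1 n s + k * ħ) /
        (gzEntry lam γ.1 n i - gzEntry lam γ.1 n s)))
    (fun j _ s _ hj hs => by
      rw [gzEntry_gzShift_of_ne lam h _ _ (by tauto), gzEntry_gzShift_of_ne lam h _ _ (by tauto)])
    (fun s hs hsi => by
      have ms : (n, s) ∈ gzIndex ℓ := mem_gzIndex.2 (by rw [Finset.mem_Icc] at hs; omega)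
      rw [gzEntry_gzShift_self lam h, gzEntry_gzShift_of_ne lam h _ _ (by tauto)]
      exact inv_Gamma_mul_inv_Gamma_neg_add hc hk
        (by simpa using gzEntry_sub_ne lam γ h ms (Ne.symm hsi) 0)
        (by simpa using gzEntry_sub_ne lam γ h ms (Ne.symm hsi) (-k)))
  have hrest : ∀ m ∈ (Finset.Icc 2 ℓ).erase n, ∏ j ∈ Finset.Icc 1 m,
      ∏ s ∈ (Finset.Icc 1 m).erase j, (Complex.Gamma ((gzEntry lam (gzShift γ n i k).1 m j -
        gzEntry lam (gzShift γ n i k).1 m s) / (ħ : ℂ)))⁻¹ =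
      ∏ j ∈ Finset.Icc 1 m, ∏ s ∈ (Finset.Icc 1 m).erase j,
        (Complex.Gamma ((gzEntry lam γ.1 m j - gzEntry lam γ.1 m s) / (ħ : ℂ)))⁻¹ := by
    intro m hm
    rw [Finset.mem_erase] at hm
    refine Finset.prod_congr rfl fun j _ => Finset.prod_congr rfl fun s _ => ?_
    rw [gzEntry_gzShift_of_ne lam h _ _ (by tauto), gzEntry_gzShift_of_ne lam h _ _ (by tauto)]
  rw [← Finset.mul_prod_erase (Finset.Icc 2 ℓ) (fun m => ∏ j ∈ Finset.Icc 1 m,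
      ∏ s ∈ (Finset.Icc 1 m).erase j, (Complex.Gamma ((gzEntry lam (gzShift γ n i k).1 m j -
        gzEntry lam (gzShift γ n i k).1 m s) / (ħ : ℂ)))⁻¹) hnm,
    ← Finset.mul_prod_erase (Finset.Icc 2 ℓ) (fun m => ∏ j ∈ Finset.Icc 1 m,
      ∏ s ∈ (Finset.Icc 1 m).erase j,
        (Complex.Gamma ((gzEntry lam γ.1 m j - gzEntry lam γ.1 m s) / (ħ : ℂ)))⁻¹) hnm,
    Finset.prod_congr rfl hrest, ← mul_assoc]
  exact congrArg (· * _) hrow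

/-- The transpose of a term of `rowOp` with respect to the density `μ`. -/
theorem gzMeasure_mul_rowQuot_gzShift (hħ : ħ ≠ 0) {n m r i : ℕ} (hmn : m ≠ n)
    (h : (n, i) ∈ gzIndex ℓ) (γ : gzRegular ℓ ħ) {k : ℤ} (hk : k = 1 ∨ k = -1) :
    (gzMeasure ħ lam γ)⁻¹ * (gzMeasure ħ lam (gzShift γ n i k) *
      rowQuot (gzEntry lam (gzShift γ n i k).1) (k * ħ) n m i (Finset.Icc 1 r)
        ((Finset.Icc 1 n).erase i)) =
      (-1) ^ (n - 1) * rowQuot (gzEntry lam γ.1) ((-k : ℤ) * ħ) n m i (Finset.Icc 1 r)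
        ((Finset.Icc 1 n).erase i) := by
  have hni := mem_gzIndex.1 h
  rw [gzMeasure_gzShift ħ lam hħ h γ hk]
  have hq : rowQuot (gzEntry lam (gzShift γ n i k).1) (k * ħ) n m i (Finset.Icc 1 r)
        ((Finset.Icc 1 n).erase i) =
      (∏ j ∈ Finset.Icc 1 r, (gzEntry lam γ.1 n i - gzEntry lam γ.1 m j - ((-k : ℤ) * ħ) / 2)) /
        ∏ s ∈ (Finset.Icc 1 n).erase i,
          (gzEntry lam γ.1 n i - gzEntry lam γ.1 n s + k * ħ) := by
    unfold rowQuot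
    rw [gzEntry_gzShift_self lam h]
    congr 1
    · refine Finset.prod_congr rfl fun j _ => ?_
      rw [gzEntry_gzShift_of_ne lam h _ _ (by tauto)]; push_cast; ring
    · refine Finset.prod_congr rfl fun s hs => ?_
      rw [Finset.mem_erase] at hs
      rw [gzEntry_gzShift_of_ne lam h _ _ (by tauto)]; ring
  have hP : ∏ s ∈ (Finset.Icc 1 n).erase i,
      (gzEntry lam γ.1 n i - gzEntry lam γ.1 n s + k * ħ) ≠ 0 := by
    refine Finset.prod_ne_zero_iff.2 fun s hs => ?_
    simp only [Finset.mem_erase, Finset.mem_Icc] at hs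
    intro e
    refine gzEntry_sub_ne lam γ h (mem_gzIndex.2 (by omega)) (Ne.symm hs.1) (-k) ?_
    push_cast
    linear_combination e
  have hcard : ((Finset.Icc 1 n).erase i).card = n - 1 := by
    rw [Finset.card_erase_of_mem (Finset.mem_Icc.2 (by omega)), Nat.card_Icc]; omega
  rw [hq, Finset.prod_neg, hcard, Finset.prod_div_distrib]
  unfold rowQuot
  have hμ := gzMeasure_ne_zero ħ lam hħ γ
  generalize ∏ s ∈ (Finset.Icc 1 n).erase i,
      (gzEntry lam γ.1 n i - gzEntry lam γ.1 n s + k * ħ) = A at *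
  generalize ∏ s ∈ (Finset.Icc 1 n).erase i,
      (gzEntry lam γ.1 n i - gzEntry lam γ.1 n s) = B at *
  generalize ∏ j ∈ Finset.Icc 1 r, (gzEntry lam γ.1 n i - gzEntry lam γ.1 m j -
    ((-k : ℤ) * ħ) / 2) = N
  field_simp

theorem gzRaiseAdj_eq_rowOp (hħ : ħ ≠ 0) {n : ℕ} (hn : n ≤ ℓ) :
    gzRaiseAdj ħ lam n = rowOp ħ lam (-((-1) ^ (n - 1) / (ħ : ℂ))) (-1) n (n + 1) (n + 1) := by
  ext f γ
  rw [rowOp_apply]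
  simp only [gzRaiseAdj, LinearMap.coe_mk, AddHom.coe_mk, Finset.mul_sum]
  refine Finset.sum_congr rfl fun i hi => ?_
  rw [Finset.mem_Icc] at hi
  have key := gzMeasure_mul_rowQuot_gzShift ħ lam hħ (m := n + 1) (r := n + 1) (by omega)
    (mem_gzIndex.2 ⟨hi.1, hi.2, hn⟩) γ (k := 1) (Or.inl rfl)
  have hc : gzRaiseCoeff ħ lam n i (gzShift γ n i 1) = -(1 / (ħ : ℂ)) *
      rowQuot (gzEntry lam (gzShift γ n i 1).1) ((1 : ℤ) * ħ) n (n + 1) i (Finset.Icc 1 (n + 1))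
        ((Finset.Icc 1 n).erase i) := by
    simp [gzRaiseCoeff, rowQuot]
  unfold rowCoeff
  rw [hc, neg_neg]
  linear_combination -(1 / (ħ : ℂ)) * f (gzShift γ n i 1) * key

theorem gzLowerAdj_eq_rowOp (hħ : ħ ≠ 0) {n : ℕ} (hn : n ≤ ℓ) :
    gzLowerAdj ħ lam n = rowOp ħ lam ((-1) ^ (n - 1) / (ħ : ℂ)) 1 n (n - 1) (n - 1) := by
  ext f γ
  rw [rowOp_apply]
  simp only [gzLowerAdj, LinearMap.coe_mk, AddHom.coe_mk, Finset.mul_sum]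
  refine Finset.sum_congr rfl fun i hi => ?_
  rw [Finset.mem_Icc] at hi
  have key := gzMeasure_mul_rowQuot_gzShift ħ lam hħ (m := n - 1) (r := n - 1) (by omega)
    (mem_gzIndex.2 ⟨hi.1, hi.2, hn⟩) γ (k := -1) (Or.inr rfl)
  have hc : gzLowerCoeff ħ lam n i (gzShift γ n i (-1)) = (1 / (ħ : ℂ)) *
      rowQuot (gzEntry lam (gzShift γ n i (-1)).1) ((-1 : ℤ) * ħ) n (n - 1) i
        (Finset.Icc 1 (n - 1)) ((Finset.Icc 1 n).erase i) := by
    simp [gzLowerCoeff, rowQuot, neg_div]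
  unfold rowCoeff
  rw [neg_neg] at key
  rw [hc]
  linear_combination (1 / (ħ : ℂ)) * f (gzShift γ n i (-1)) * key

/-- A constant is a left Whittaker vector: the coefficients of the transpose of `E_{n+1,n}` form a
Lagrange sum for a monic polynomial of degree `n - 1` with `n` nodes. -/
theorem isLeftWhittakerVector_gzLeftVector (hħ : ħ ≠ 0) :
    IsLeftWhittakerVector ħ lam (gzLeftVector (ℓ := ℓ) ħ) := by
  intro n hn
  rw [Finset.mem_Icc] at hn
  rw [gzLowerAdj_eq_rowOp ħ lam hħ hn.2]
  funext γ
  rw [rowOp_apply]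
  simp only [gzLeftVector, Pi.smul_apply, smul_eq_mul, rowCoeff, ← Finset.sum_mul,
    ← Finset.mul_sum]
  have mem : ∀ i ∈ Finset.Icc 1 n, (n, i) ∈ gzIndex ℓ := fun i hi => by
    rw [Finset.mem_Icc] at hi; exact mem_gzIndex.2 ⟨hi.1, hi.2, hn.2⟩
  have key := sum_prod_sub_div_prod_sub_eq_one (Finset.Icc 1 n) (Finset.Icc 1 (n - 1))
    (gzEntry lam γ.1 n) (fun j => gzEntry lam γ.1 (n - 1) j + ħ / 2) (by
      intro i hi j hj hij
      rw [Finset.mem_coe] at hi hj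
      by_contra hne
      exact gzEntry_sub_ne lam γ (mem i hi) (mem j hj) hne 0 (by simpa [sub_eq_zero] using hij))
    (by simp only [Nat.card_Icc]; omega)
  have e : ∑ i ∈ Finset.Icc 1 n, rowQuot (gzEntry lam γ.1) ((1 : ℤ) * ħ) n (n - 1) i
      (Finset.Icc 1 (n - 1)) ((Finset.Icc 1 n).erase i) = 1 := by
    rw [← key]
    refine Finset.sum_congr rfl fun i _ => ?_
    unfold rowQuot
    congr 1
    refine Finset.prod_congr rfl fun j _ => ?_
    push_cast; ring
  rw [e, mul_one]

end Measure

/-! ### The root vector as a sum over paths -/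

section Paths

variable {ℓ : ℕ} (ħ : ℝ) (lam : Fin (ℓ + 1) → ℝ)

theorem rowQuot_eq_mul (x : ℕ → ℕ → ℂ) (η : ℂ) (n m i : ℕ) (J S : Finset ℕ) :
    rowQuot x η n m i J S = rowQuot x η n m i J ∅ * rowQuot x η n m i ∅ S := by
  simp [rowQuot, div_eq_mul_inv]

/-- The operator `r(γ) e^{cħ∂_{n,i}}`. -/
def weightedShift (r : gzRegular ℓ ħ → ℂ) (n i : ℕ) (c : ℤ) : Module.End ℂ (GZFun ℓ ħ) where
  toFun f := fun γ => r γ * f (gzShift γ n i c)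
  map_add' f g := by funext γ; simp [mul_add]
  map_smul' c f := by funext γ; simp; ring

variable {ħ} in
theorem weightedShift_apply (r : gzRegular ℓ ħ → ℂ) (n i : ℕ) (c : ℤ) (f : GZFun ℓ ħ)
    (γ : gzRegular ℓ ħ) : weightedShift ħ r n i c f γ = r γ * f (gzShift γ n i c) := rfl

variable {ħ} in
theorem commute_weightedShift {r r' : gzRegular ℓ ħ → ℂ} {n i n' i' : ℕ} {c c' : ℤ}
    (h : ∀ γ, r (gzShift γ n' i' c') = r γ) (h' : ∀ γ, r' (gzShift γ n i c) = r' γ) :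
    Commute (weightedShift ħ r n i c) (weightedShift ħ r' n' i' c') := by
  refine LinearMap.ext fun f => funext fun γ => ?_
  simp only [Module.End.mul_apply, weightedShift_apply]
  rw [h, h', gzShift_comm γ n i]
  ring

theorem rowOp_eq_sum_weightedShift (κ : ℂ) (σ : ℤ) (n m r : ℕ) :
    rowOp ħ lam κ σ n m r = ∑ i ∈ Finset.Icc 1 n,
      weightedShift ħ (rowCoeff ħ lam κ σ n m r i) n i (-σ) := by
  refine LinearMap.ext fun f => funext fun γ => ?_
  simp [rowOp_apply, weightedShift_apply, LinearMap.sum_apply, Finset.sum_apply]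

/-- The part of the right action of `E_{1,k+2}` that belongs to the paths
`(1,i_1), (2,i_2), …, (k+1,i_{k+1})` with `i_{k+1} = i`, without the factors
`γ_{k+1,i} - γ_{k+2,j} + ħ/2`. Commutation with `E_{k+2,k+3}` removes one factor from the preceding
product, and this leaves the recursion. -/
def gzPath : ℕ → ℕ → Module.End ℂ (GZFun ℓ ħ)
  | 0, i => weightedShift ħ (fun γ => -((-1) ^ 0 / (ħ : ℂ)) *
      rowQuot (gzEntry lam γ.1) ((-1 : ℤ) * ħ) 1 2 i ∅ ((Finset.Icc 1 1).erase i)) 1 i 1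
  | k + 1, i => ∑ i' ∈ Finset.Icc 1 (k + 1), weightedShift ħ (fun γ =>
      -((-1) ^ (k + 1) / (ħ : ℂ)) * (-ħ) *
      rowQuot (gzEntry lam γ.1) ((-1 : ℤ) * ħ) (k + 2) (k + 3) i ∅
        ((Finset.Icc 1 (k + 2)).erase i) *
      rowQuot (gzEntry lam γ.1) ((-1 : ℤ) * ħ) (k + 1) (k + 2) i'
        ((Finset.Icc 1 (k + 2)).erase i) ∅) (k + 2) i 1 * gzPath k i'

variable {ħ} in
theorem rowQuot_gzShift_of_lt (η : ℂ) {n m i p j : ℕ} {J S : Finset ℕ} (γ : gzRegular ℓ ħ) (c : ℤ)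
    (hj : (p, j) ∈ gzIndex ℓ) (hn : n ≠ p) (hm : m ≠ p ∨ j ∉ J) :
    rowQuot (gzEntry lam (gzShift γ p j c).1) η n m i J S =
      rowQuot (gzEntry lam γ.1) η n m i J S := by
  apply rowQuot_congr
  · rw [gzEntry_gzShift_of_ne lam hj]; tauto
  · intro s hs; rw [gzEntry_gzShift_of_ne lam hj]; rintro ⟨h, rfl⟩; tauto
  · intro s _; rw [gzEntry_gzShift_of_ne lam hj]; tauto

/-- The path operators only involve the rows up to `k + 1`. -/
theorem commute_gzPath {r : gzRegular ℓ ħ → ℂ} {n j : ℕ} {c : ℤ} (hj : (n, j) ∈ gzIndex ℓ) :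
    ∀ (k : ℕ) (_ : k + 2 ≤ n) (_ : ∀ γ p i, p ≤ k + 1 → (p, i) ∈ gzIndex ℓ →
      r (gzShift γ p i 1) = r γ) (i : ℕ) (_ : i ∈ Finset.Icc 1 (k + 1)),
      Commute (weightedShift ħ r n j c) (gzPath ħ lam k i) := by
  have hjn := mem_gzIndex.1 hj
  intro k
  induction k with
  | zero =>
    intro hn hr i hi
    rw [Finset.mem_Icc] at hi
    refine commute_weightedShift (fun γ => hr γ 1 i (by omega) (mem_gzIndex.2 (by omega)))
      fun γ => ?_
    rw [rowQuot_gzShift_of_lt lam _ _ _ hj (by omega) (Or.inr (by simp))]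
  | succ k ih =>
    intro hn hr i hi
    rw [Finset.mem_Icc] at hi
    refine Commute.sum_right _ _ _ fun i' hi' => Commute.mul_right ?_
      (ih (by omega) (fun γ p i hp => hr γ p i (by omega)) i' hi')
    refine commute_weightedShift (fun γ => hr γ (k + 2) i (by omega) (mem_gzIndex.2 (by omega)))
      fun γ => ?_
    rw [rowQuot_gzShift_of_lt lam _ _ _ hj (by omega) (Or.inr (by simp)),
      rowQuot_gzShift_of_lt lam _ _ _ hj (by omega) (Or.inl (by omega))]

/-- The right action of `E_{1,k+2}` as a sum over paths. -/
theorem gzRootAdj_apply (hħ : ħ ≠ 0) : ∀ (k : ℕ) (_ : k + 1 ≤ ℓ) (φ : GZFun ℓ ħ)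
    (γ : gzRegular ℓ ħ), gzRootAdj ħ lam k φ γ = ∑ i ∈ Finset.Icc 1 (k + 1),
      rowQuot (gzEntry lam γ.1) ((-1 : ℤ) * ħ) (k + 1) (k + 2) i (Finset.Icc 1 (k + 2)) ∅ *
        gzPath ħ lam k i φ γ := by
  intro k
  induction k with
  | zero =>
    intro hk φ γ
    rw [gzRootAdj, gzRaiseAdj_eq_rowOp ħ lam hħ hk, rowOp_apply]
    refine Finset.sum_congr rfl fun i _ => ?_
    rw [gzPath, weightedShift_apply, rowCoeff, rowQuot_eq_mul, neg_neg]
    ring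
  | succ k ih =>
    intro hk φ γ
    have hP : ∀ i' ∈ Finset.Icc 1 (k + 1), Commute (gzRaiseAdj ħ lam (k + 2))
        (gzPath ħ lam k i') := by
      intro i' hi'
      rw [gzRaiseAdj_eq_rowOp ħ lam hħ hk, rowOp_eq_sum_weightedShift]
      refine Commute.sum_left _ _ _ fun i hi => ?_
      rw [Finset.mem_Icc] at hi
      exact commute_gzPath ħ lam (mem_gzIndex.2 ⟨hi.1, hi.2, hk⟩) k le_rfl
        (fun γ p i hp hi => rowCoeff_gzShift_of_ne lam _ _ _ _ hi (by omega) (by omega)) i' hi'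
    have hP' : ∀ i' ∈ Finset.Icc 1 (k + 1), gzPath ħ lam k i' (gzRaiseAdj ħ lam (k + 2) φ) =
        gzRaiseAdj ħ lam (k + 2) (gzPath ħ lam k i' φ) := fun i' hi' => by
      have := LinearMap.congr_fun (hP i' hi') φ
      exact this.symm
    simp only [gzRootAdj, LinearMap.sub_apply, Module.End.mul_apply, Pi.sub_apply]
    rw [ih (by omega) (gzRaiseAdj ħ lam (k + 2) φ) γ]
    rw [Finset.sum_congr rfl (fun i' hi' => by rw [hP' i' hi'])]
    rw [gzRaiseAdj_eq_rowOp ħ lam hħ hk, rowOp_apply]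
    simp only [rowOp_apply, ih (show k + 1 ≤ ℓ by omega), Finset.mul_sum]
    rw [Finset.sum_comm (s := Finset.Icc 1 (k + 1)), ← Finset.sum_sub_distrib]
    -- the two orders of the product differ in the factor `γ_{k+1,i'} - γ_{k+2,i} + ħ/2` only, in
    -- which one of them has `γ_{k+2,i}` shifted by `ħ`
    refine Finset.sum_congr rfl fun i hi => ?_
    rw [← Finset.sum_sub_distrib, gzPath]
    simp only [LinearMap.sum_apply, Finset.sum_apply, Finset.mul_sum]
    refine Finset.sum_congr rfl fun i' hi' => ?_
    have hi2 := Finset.mem_Icc.1 hi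
    have mi : (k + 2, i) ∈ gzIndex ℓ := mem_gzIndex.2 (by omega)
    rw [Module.End.mul_apply, weightedShift_apply, rowCoeff, rowQuot_eq_mul,
      rowQuot_eq_mul_erase hi, rowQuot_eq_mul_erase hi, neg_neg,
      rowQuot_gzShift_of_lt lam _ _ _ mi (by omega) (Or.inr (by simp)),
      gzEntry_gzShift_self lam mi, gzEntry_gzShift_of_ne lam mi _ _ (by omega)]
    rw [show k + 1 + 1 = k + 2 from rfl, show k + 1 + 2 = k + 3 from rfl,
      show k + 2 + 1 = k + 3 from rfl, show k + 2 - 1 = k + 1 from rfl]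
    push_cast
    ring

end Paths

/-! ### Approach to the support of the delta-functions -/

section Limits

variable {ℓ : ℕ} {ħ : ℝ} (lam : Fin (ℓ + 1) → ℝ)

/-- The regular arrays are dense, so that limits along them are unique. -/
theorem mem_closure_gzRegular (ħ : ℝ) (γ : GZArray ℓ) : γ ∈ closure (gzRegular ℓ ħ) := by
  -- on the line `γ + t v` with `v_{n,j} = j` only countably many points are not regular
  set B : Set ℂ := ⋃ (p : gzIndex ℓ) (q : gzIndex ℓ) (k : ℤ),
    {((k : ℂ) * ħ - (γ p - γ q)) / ((p.1.2 : ℂ) - (q.1.2 : ℂ))} with hB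
  have hBc : B.Countable := Set.countable_iUnion fun p => Set.countable_iUnion fun q =>
    Set.countable_iUnion fun k => Set.countable_singleton _
  have hd : Dense Bᶜ := hBc.dense_compl ℂ
  have hcont : Continuous (fun (t : ℂ) (p : gzIndex ℓ) => γ p + t * (p.1.2 : ℂ)) := by fun_prop
  have hmap : Set.MapsTo (fun (t : ℂ) (p : gzIndex ℓ) => γ p + t * (p.1.2 : ℂ)) Bᶜ
      (gzRegular ℓ ħ) := by
    intro t ht p q hpq hne k hk
    apply ht
    have hne2 : (p.1.2 : ℂ) - (q.1.2 : ℂ) ≠ 0 := by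
      rw [sub_ne_zero, Ne, Nat.cast_inj]
      exact fun h => hne (Subtype.ext (Prod.ext hpq h))
    simp only [hB, Set.mem_iUnion, Set.mem_singleton_iff]
    refine ⟨p, q, k, ?_⟩
    rw [eq_div_iff hne2]
    linear_combination hk
  have := map_mem_closure hcont (hd (0 : ℂ)) hmap
  simpa using this

instance neBot_comap_gzRegular (γ : GZArray ℓ) :
    NeBot (comap (Subtype.val : gzRegular ℓ ħ → GZArray ℓ) (𝓝 γ)) :=
  mem_closure_iff_comap_neBot.1 (mem_closure_gzRegular ħ γ)

theorem continuous_gzEntry (n j : ℕ) : Continuous fun γ : GZArray ℓ => gzEntry lam γ n j := by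
  unfold gzEntry
  split_ifs <;> fun_prop

theorem tendsto_comap_gzRegular {X : Type*} [TopologicalSpace X] {F : GZArray ℓ → X}
    (hF : Continuous F) (γ₀ : GZArray ℓ) :
    Tendsto (fun γ : gzRegular ℓ ħ => F γ.1) (comap Subtype.val (𝓝 γ₀)) (𝓝 (F γ₀)) :=
  hF.continuousAt.tendsto.comp tendsto_comap

theorem tendsto_rowQuot (η : ℂ) {n m i : ℕ} {J S : Finset ℕ} {γ₀ : GZArray ℓ}
    (h : ∀ s ∈ S, gzEntry lam γ₀ n i ≠ gzEntry lam γ₀ n s) :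
    Tendsto (fun γ : gzRegular ℓ ħ => rowQuot (gzEntry lam γ.1) η n m i J S)
      (comap Subtype.val (𝓝 γ₀)) (𝓝 (rowQuot (gzEntry lam γ₀) η n m i J S)) := by
  have hc := continuous_gzEntry lam
  unfold rowQuot
  refine Tendsto.div ?_ ?_ (Finset.prod_ne_zero_iff.2 fun s hs => sub_ne_zero.2 (h s hs))
  · exact tendsto_comap_gzRegular (F := fun γ =>
      ∏ j ∈ J, (gzEntry lam γ n i - gzEntry lam γ m j - η / 2))
      (continuous_finsetProd _ fun j _ => ((hc n i).sub (hc m j)).sub continuous_const) γ₀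
  · exact tendsto_comap_gzRegular (F := fun γ =>
      ∏ s ∈ S, (gzEntry lam γ n i - gzEntry lam γ n s))
      (continuous_finsetProd _ fun j _ => (hc n i).sub (hc n j)) γ₀

theorem gzEntry_gzSupport (ħ : ℝ) (s : ℂ) {k i : ℕ} (h : (k, i) ∈ gzIndex ℓ) :
    gzEntry lam (gzSupport ℓ ħ s) k i = if i = 1 then s - ((ℓ : ℂ) - (k : ℂ)) * (ħ : ℂ) / 2
      else ((k : ℂ) - 2 * (i : ℂ) + 1) * (ħ : ℂ) / 2 := by
  simp [gzEntry, h, gzSupport]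

/-- Off the real axis the points of the line have distinct entries in each row. -/
theorem gzEntry_gzSupport_ne (hħ : ħ ≠ 0) {s : ℂ} (hs : s.im ≠ 0) {n i j : ℕ}
    (hi : (n, i) ∈ gzIndex ℓ) (hj : (n, j) ∈ gzIndex ℓ) (hij : i ≠ j) :
    gzEntry lam (gzSupport ℓ ħ s) n i ≠ gzEntry lam (gzSupport ℓ ħ s) n j := by
  rw [gzEntry_gzSupport lam ħ s hi, gzEntry_gzSupport lam ħ s hj]
  have hc : (ħ : ℂ) ≠ 0 := by exact_mod_cast hħ
  have im1 : ∀ k : ℕ, (s - ((ℓ : ℂ) - (k : ℂ)) * (ħ : ℂ) / 2).im = s.im := by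
    intro k
    have : ((ℓ : ℂ) - (k : ℂ)) * (ħ : ℂ) / 2 = ((((ℓ : ℝ) - k) * ħ / 2 : ℝ) : ℂ) := by
      push_cast; ring
    rw [this, Complex.sub_im, Complex.ofReal_im, sub_zero]
  have im2 : ∀ k i : ℕ, (((k : ℂ) - 2 * (i : ℂ) + 1) * (ħ : ℂ) / 2).im = 0 := by
    intro k i
    have : ((k : ℂ) - 2 * (i : ℂ) + 1) * (ħ : ℂ) / 2 =
        ((((k : ℝ) - 2 * i + 1) * ħ / 2 : ℝ) : ℂ) := by
      push_cast; ring
    rw [this, Complex.ofReal_im]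
  split_ifs with h1 h2 h2
  · omega
  · intro h
    apply hs
    rw [← im1 n, h, im2]
  · intro h
    apply hs
    rw [← im1 n, ← h, im2]
  · intro h
    apply hij
    have h3 : (2 * ((j : ℂ) - i)) * ħ = 0 := by linear_combination 2 * h
    have h4 : (j : ℂ) - i = 0 := by simpa [hc] using h3
    exact_mod_cast (sub_eq_zero.1 h4).symm

/-- The delta-functions tie the neighbours in a column together. -/
theorem gzEntry_gzSupport_succ {s : ℂ} {k i : ℕ} (hi : (k, i) ∈ gzIndex ℓ) (hk : k + 1 ≤ ℓ) :
    gzEntry lam (gzSupport ℓ ħ s) (k + 1) i = gzEntry lam (gzSupport ℓ ħ s) k i + ħ / 2 := by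
  have hi' := mem_gzIndex.1 hi
  rw [gzEntry_gzSupport lam ħ s hi, gzEntry_gzSupport lam ħ s (mem_gzIndex.2 (by omega))]
  split_ifs <;> push_cast <;> ring

/-- On the support the factor coupling `γ_{k,i}` with `γ_{k+1,i}` vanishes. -/
theorem rowQuot_gzSupport_eq_zero {s : ℂ} {k i : ℕ} {J S : Finset ℕ} (hi : (k, i) ∈ gzIndex ℓ)
    (hk : k + 1 ≤ ℓ) (hJ : i ∈ J) :
    rowQuot (gzEntry lam (gzSupport ℓ ħ s)) ((-1 : ℤ) * ħ) k (k + 1) i J S = 0 := by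
  rw [rowQuot_eq_mul_erase hJ, gzEntry_gzSupport_succ lam hi hk]
  push_cast
  ring

/-- In the limit only the path `(1,1), (2,1), …, (k+1,1)` survives, and its coefficients
telescope. -/
theorem tendsto_gzPath (hħ : ħ ≠ 0) {s : ℂ} (hs : s.im ≠ 0) : ∀ (k : ℕ) (_ : k + 1 ≤ ℓ)
    (F : GZArray ℓ → ℂ) (_ : Continuous F) (i : ℕ) (_ : i ∈ Finset.Icc 1 (k + 1)),
    Tendsto (gzPath ħ lam k i (fun γ => F γ.1)) (comap Subtype.val (𝓝 (gzSupport ℓ ħ s)))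
      (𝓝 (if i = 1 then (∏ m ∈ Finset.range (k + 1), (-1) ^ m) * (-1 / ħ) *
        F (fun q => gzSupport ℓ ħ s q + if q.1.2 = 1 ∧ q.1.1 ≤ k + 1 then (ħ : ℂ) else 0)
        else 0)) := by
  have hc : (ħ : ℂ) ≠ 0 := by exact_mod_cast hħ
  have hshift : ∀ (F : GZArray ℓ → ℂ) (n i : ℕ), Continuous F →
      Continuous (fun γ : GZArray ℓ => F (fun q => γ q + if q.1 = (n, i) then ((1 : ℤ) : ℂ) * ħ
        else 0)) := by
    intro F n i hF
    exact hF.comp (by fun_prop)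
  intro k
  induction k with
  | zero =>
    intro hk F hF i hi
    obtain rfl : i = 1 := by rw [Finset.mem_Icc] at hi; omega
    rw [if_pos rfl, gzPath]
    have e1 := tendsto_comap_gzRegular (ħ := ħ) (hshift F 1 1 hF) (gzSupport ℓ ħ s)
    have : (fun γ : gzRegular ℓ ħ => -((-1 : ℂ) ^ 0 / (ħ : ℂ)) *
        rowQuot (gzEntry lam γ.1) ((-1 : ℤ) * ħ) 1 2 1 ∅ ((Finset.Icc 1 1).erase 1) *
        F (gzShift γ 1 1 1).1) = fun γ => (-1 / (ħ : ℂ)) * F (gzShift γ 1 1 1).1 := by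
      funext γ
      simp [rowQuot, neg_div]
    change Tendsto (fun γ : gzRegular ℓ ħ => -((-1 : ℂ) ^ 0 / (ħ : ℂ)) *
        rowQuot (gzEntry lam γ.1) ((-1 : ℤ) * ħ) 1 2 1 ∅ ((Finset.Icc 1 1).erase 1) *
        F (gzShift γ 1 1 1).1) _ _
    rw [this]
    have hF' : (fun q : gzIndex ℓ => gzSupport ℓ ħ s q +
        if q.1.2 = 1 ∧ q.1.1 ≤ 0 + 1 then (ħ : ℂ) else 0) =
        fun q : gzIndex ℓ => gzSupport ℓ ħ s q +
          if q.1 = (1, 1) then ((1 : ℤ) : ℂ) * ħ else 0 := by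
      funext q
      have hq := mem_gzIndex.1 (show (q.1.1, q.1.2) ∈ gzIndex ℓ from q.2)
      have : q.1 = (1, 1) ↔ q.1.1 = 1 ∧ q.1.2 = 1 := Prod.ext_iff
      simp only [this, Int.cast_one, one_mul]
      congr 1
      exact if_congr (by omega) rfl rfl
    rw [hF', zero_add, Finset.prod_range_one, pow_zero, one_mul]
    exact e1.const_mul (-1 / (ħ : ℂ))
  | succ k ih =>
    intro hk F hF i hi
    have hi2 := Finset.mem_Icc.1 hi
    have mi : (k + 2, i) ∈ gzIndex ℓ := mem_gzIndex.2 (by omega)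
    rw [gzPath]
    -- the new shift commutes with the shorter paths and can be moved to the test function
    have hcomm : ∀ i' ∈ Finset.Icc 1 (k + 1), ∀ γ : gzRegular ℓ ħ,
        gzPath ħ lam k i' (fun γ => F γ.1) (gzShift γ (k + 2) i 1) =
        gzPath ħ lam k i' (fun γ => F (fun q => γ.1 q +
          if q.1 = (k + 2, i) then ((1 : ℤ) : ℂ) * ħ else 0)) γ := by
      intro i' hi' γ
      have h1 := commute_gzPath ħ lam (r := fun _ => 1) (c := 1) mi k le_rfl
        (fun _ _ _ _ _ => rfl) i' hi'
      have h2 := congrFun (LinearMap.congr_fun h1 (fun γ => F γ.1)) γ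
      simp only [Module.End.mul_apply, weightedShift_apply, one_mul] at h2
      have h3 : weightedShift ħ (fun _ => 1) (k + 2) i 1 (fun γ => F γ.1) = fun γ =>
          F (fun q => γ.1 q + if q.1 = (k + 2, i) then ((1 : ℤ) : ℂ) * ħ else 0) := by
        funext γ
        rw [weightedShift_apply, one_mul]
        rfl
      rw [h2, h3]
    have hfun : (∑ i' ∈ Finset.Icc 1 (k + 1), weightedShift ħ (fun γ =>
      -((-1) ^ (k + 1) / (ħ : ℂ)) * (-ħ) *
      rowQuot (gzEntry lam γ.1) ((-1 : ℤ) * ħ) (k + 2) (k + 3) i ∅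
        ((Finset.Icc 1 (k + 2)).erase i) *
      rowQuot (gzEntry lam γ.1) ((-1 : ℤ) * ħ) (k + 1) (k + 2) i'
        ((Finset.Icc 1 (k + 2)).erase i) ∅) (k + 2) i 1 * gzPath ħ lam k i') (fun γ => F γ.1) =
      fun γ => ∑ i' ∈ Finset.Icc 1 (k + 1), -((-1) ^ (k + 1) / (ħ : ℂ)) * (-ħ) *
      rowQuot (gzEntry lam γ.1) ((-1 : ℤ) * ħ) (k + 2) (k + 3) i ∅
        ((Finset.Icc 1 (k + 2)).erase i) *
      rowQuot (gzEntry lam γ.1) ((-1 : ℤ) * ħ) (k + 1) (k + 2) i'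
        ((Finset.Icc 1 (k + 2)).erase i) ∅ * gzPath ħ lam k i' (fun γ => F (fun q => γ.1 q +
          if q.1 = (k + 2, i) then ((1 : ℤ) : ℂ) * ħ else 0)) γ := by
      funext γ
      simp only [LinearMap.sum_apply, Finset.sum_apply, Module.End.mul_apply, weightedShift_apply]
      exact Finset.sum_congr rfl fun i' hi' => by rw [hcomm i' hi']
    rw [hfun]
    have hlim := tendsto_finsetSum (f := fun i' (γ : gzRegular ℓ ħ) =>
      -((-1) ^ (k + 1) / (ħ : ℂ)) * (-ħ) *
      rowQuot (gzEntry lam γ.1) ((-1 : ℤ) * ħ) (k + 2) (k + 3) i ∅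
        ((Finset.Icc 1 (k + 2)).erase i) *
      rowQuot (gzEntry lam γ.1) ((-1 : ℤ) * ħ) (k + 1) (k + 2) i'
        ((Finset.Icc 1 (k + 2)).erase i) ∅ * gzPath ħ lam k i' (fun γ => F (fun q => γ.1 q +
          if q.1 = (k + 2, i) then ((1 : ℤ) : ℂ) * ħ else 0)) γ) (Finset.Icc 1 (k + 1))
      (fun i' hi' => ((tendsto_rowQuot lam ((-1 : ℤ) * ħ) (m := k + 3) (J := ∅)
        (fun t ht => by
          simp only [Finset.mem_erase, Finset.mem_Icc] at ht
          exact gzEntry_gzSupport_ne lam hħ hs mi (mem_gzIndex.2 (by omega))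
            (Ne.symm ht.1))).const_mul (-((-1) ^ (k + 1) / (ħ : ℂ)) * (-ħ))).mul
        (tendsto_rowQuot lam ((-1 : ℤ) * ħ) (n := k + 1) (m := k + 2) (i := i')
          (J := (Finset.Icc 1 (k + 2)).erase i) (S := ∅) (fun t ht => by simp at ht)) |>.mul
        (ih (by omega) _ (hshift F (k + 2) i hF) i' hi'))
    convert hlim using 2
    rw [Finset.sum_eq_single 1]
    · rw [if_pos rfl]
      split_ifs with h1
      · subst h1
        -- the numerator of row `k + 1` cancels the denominator of row `k + 2`
        have m1 : (k + 1, 1) ∈ gzIndex ℓ := mem_gzIndex.2 (by omega)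
        have hq : rowQuot (gzEntry lam (gzSupport ℓ ħ s)) ((-1 : ℤ) * ħ) (k + 2) (k + 3) 1 ∅
            ((Finset.Icc 1 (k + 2)).erase 1) *
          rowQuot (gzEntry lam (gzSupport ℓ ħ s)) ((-1 : ℤ) * ħ) (k + 1) (k + 2) 1
            ((Finset.Icc 1 (k + 2)).erase 1) ∅ = 1 := by
          have hne : ∏ t ∈ (Finset.Icc 1 (k + 2)).erase 1,
              (gzEntry lam (gzSupport ℓ ħ s) (k + 2) 1 -
                gzEntry lam (gzSupport ℓ ħ s) (k + 2) t) ≠ 0 := by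
            refine Finset.prod_ne_zero_iff.2 fun t ht => sub_ne_zero.2 ?_
            simp only [Finset.mem_erase, Finset.mem_Icc] at ht
            exact gzEntry_gzSupport_ne lam hħ hs mi (mem_gzIndex.2 (by omega)) (Ne.symm ht.1)
          have he : ∏ t ∈ (Finset.Icc 1 (k + 2)).erase 1,
              (gzEntry lam (gzSupport ℓ ħ s) (k + 1) 1 -
                gzEntry lam (gzSupport ℓ ħ s) (k + 2) t - ((-1 : ℤ) * ħ) / 2) =
              ∏ t ∈ (Finset.Icc 1 (k + 2)).erase 1,
              (gzEntry lam (gzSupport ℓ ħ s) (k + 2) 1 -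
                gzEntry lam (gzSupport ℓ ħ s) (k + 2) t) := by
            refine Finset.prod_congr rfl fun t _ => ?_
            rw [gzEntry_gzSupport_succ lam m1 (by omega)]
            push_cast
            ring
          unfold rowQuot
          rw [he, Finset.prod_empty, Finset.prod_empty, div_one, one_div, inv_mul_cancel₀ hne]
        rw [mul_assoc (-((-1 : ℂ) ^ (k + 1) / (ħ : ℂ)) * (-ħ)), hq,
          Finset.prod_range_succ _ (k + 1)]
        have hF' : (fun q : gzIndex ℓ => gzSupport ℓ ħ s q +
            if q.1.2 = 1 ∧ q.1.1 ≤ k + 1 + 1 then (ħ : ℂ) else 0) =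
            fun q : gzIndex ℓ => (gzSupport ℓ ħ s q +
              if q.1.2 = 1 ∧ q.1.1 ≤ k + 1 then (ħ : ℂ) else 0) +
              if q.1 = (k + 2, 1) then ((1 : ℤ) : ℂ) * ħ else 0 := by
          funext q
          have : q.1 = (k + 2, 1) ↔ q.1.1 = k + 2 ∧ q.1.2 = 1 := Prod.ext_iff
          simp only [this, Int.cast_one, one_mul]
          split_ifs <;> first | omega | ring
        rw [hF']
        field_simp
      · have m1 : (k + 1, 1) ∈ gzIndex ℓ := mem_gzIndex.2 (by omega)
        rw [rowQuot_gzSupport_eq_zero lam m1 (by omega) (by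
          rw [Finset.mem_erase, Finset.mem_Icc]; omega)]
        ring
    · intro i' _ h
      rw [if_neg h, mul_zero]
    · intro h
      exact absurd (Finset.mem_Icc.2 (by omega)) h

end Limits

/-! ### Rapid decay in vertical strips -/

/-- `f` decays faster than any power of `|Im z|` in the strip `a ≤ Re z ≤ b`, uniformly in
`Re z`. -/
def RapidDecayOnStrip (f : ℂ → ℂ) (a b : ℝ) : Prop :=
  ∀ N : ℕ, ∃ C : ℝ, ∀ z : ℂ, a ≤ z.re → z.re ≤ b → ‖f z‖ * (1 + |z.im|) ^ N ≤ C

theorem RapidDecayOnStrip.mul_of_le {f g : ℂ → ℂ} {a b : ℝ} (hf : RapidDecayOnStrip f a b)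
    {C : ℝ} {M : ℕ} (hg : ∀ z : ℂ, a ≤ z.re → z.re ≤ b → ‖g z‖ ≤ C * (1 + |z.im|) ^ M) :
    RapidDecayOnStrip (fun z => f z * g z) a b := by
  intro N
  obtain ⟨D, hD⟩ := hf (M + N)
  refine ⟨|C| * D, fun z h1 h2 => ?_⟩
  have hp : 0 ≤ 1 + |z.im| := by positivity
  have h3 : ‖g z‖ ≤ |C| * (1 + |z.im|) ^ M :=
    (hg z h1 h2).trans (mul_le_mul_of_nonneg_right (le_abs_self C) (by positivity))
  calc ‖f z * g z‖ * (1 + |z.im|) ^ N = ‖g z‖ * (‖f z‖ * (1 + |z.im|) ^ N) := by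
        rw [norm_mul]; ring
    _ ≤ |C| * (1 + |z.im|) ^ M * (‖f z‖ * (1 + |z.im|) ^ N) :=
        mul_le_mul_of_nonneg_right h3 (by positivity)
    _ = |C| * (‖f z‖ * (1 + |z.im|) ^ (M + N)) := by rw [pow_add]; ring
    _ ≤ |C| * D := mul_le_mul_of_nonneg_left (hD z h1 h2) (abs_nonneg C)

theorem RapidDecayOnStrip.comp_add {f : ℂ → ℂ} {a b h : ℝ}
    (hf : RapidDecayOnStrip f (a + h) (b + h)) :
    RapidDecayOnStrip (fun z => f (z + (h : ℂ))) a b := by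
  intro N
  obtain ⟨D, hD⟩ := hf N
  refine ⟨D, fun z h1 h2 => ?_⟩
  have := hD (z + (h : ℂ)) (by simpa using h1) (by simpa using h2)
  simpa using this

theorem RapidDecayOnStrip.integrable {f : ℂ → ℂ} {a b c : ℝ} (hf : RapidDecayOnStrip f a b)
    (ha : a ≤ c) (hb : c ≤ b)
    (hc : Continuous fun y : ℝ => f ((c : ℂ) + (y : ℂ) * Complex.I)) :
    Integrable fun y : ℝ => f ((c : ℂ) + (y : ℂ) * Complex.I) := by
  obtain ⟨C, hC⟩ := hf 2
  have h2 : Integrable (fun y : ℝ => C * (1 + ‖y‖) ^ (-(2 : ℝ))) :=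
    (integrable_one_add_norm (by simp)).const_mul C
  refine h2.mono' hc.aestronglyMeasurable (Eventually.of_forall fun y => ?_)
  have h3 := hC ((c : ℂ) + (y : ℂ) * Complex.I) (by simpa using ha) (by simpa using hb)
  have h4 : ((c : ℂ) + (y : ℂ) * Complex.I).im = y := by simp
  rw [h4] at h3
  have h5 : (0 : ℝ) < 1 + ‖y‖ := by positivity
  rw [Real.rpow_neg h5.le, Real.norm_eq_abs]
  rw [Real.norm_eq_abs] at h5
  rw [← div_eq_mul_inv, le_div_iff₀ (by positivity)]
  exact_mod_cast h3

/-- Cauchy's theorem in a strip in which the function decays. -/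
theorem RapidDecayOnStrip.integral_eq {f : ℂ → ℂ} {a b : ℝ} (hf : RapidDecayOnStrip f a b)
    (hab : a ≤ b) (hd : ∀ z : ℂ, a ≤ z.re → z.re ≤ b → DifferentiableAt ℂ f z) :
    ∫ y : ℝ, f ((b : ℂ) + (y : ℂ) * Complex.I) = ∫ y : ℝ, f ((a : ℂ) + (y : ℂ) * Complex.I) := by
  have hcont : ∀ c : ℝ, a ≤ c → c ≤ b →
      Continuous fun y : ℝ => f ((c : ℂ) + (y : ℂ) * Complex.I) := by
    intro c h1 h2
    rw [continuous_iff_continuousAt]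
    intro y
    have h3 := (hd ((c : ℂ) + (y : ℂ) * Complex.I) (by simpa using h1)
      (by simpa using h2)).continuousAt
    exact ContinuousAt.comp (f := fun y : ℝ => (c : ℂ) + (y : ℂ) * Complex.I) h3
      (by fun_prop)
  have ia := hf.integrable le_rfl hab (hcont a le_rfl hab)
  have ib := hf.integrable hab le_rfl (hcont b hab le_rfl)
  have hrect : ∀ T : ℝ, (∫ y in (-T)..T, f ((b : ℂ) + (y : ℂ) * Complex.I)) -
      (∫ y in (-T)..T, f ((a : ℂ) + (y : ℂ) * Complex.I)) =
      Complex.I * ((∫ x in a..b, f ((x : ℂ) + ((-T : ℝ) : ℂ) * Complex.I)) -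
        ∫ x in a..b, f ((x : ℂ) + ((T : ℝ) : ℂ) * Complex.I)) := by
    intro T
    have key := Complex.integral_boundary_rect_eq_zero_of_differentiableOn f
      ((a : ℂ) + ((-T : ℝ) : ℂ) * Complex.I) ((b : ℂ) + (T : ℂ) * Complex.I) (by
        intro z hz
        have hz' := hz.1
        simp only [Complex.add_re, Complex.ofReal_re, Complex.mul_re, Complex.I_re, mul_zero,
          Complex.ofReal_im, Complex.I_im, mul_one, sub_self, add_zero, Set.mem_preimage,
          Set.uIcc_of_le hab, Set.mem_Icc] at hz'
        exact (hd z hz'.1 hz'.2).differentiableWithinAt)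
    simp only [Complex.add_re, Complex.ofReal_re, Complex.mul_re, Complex.I_re, mul_zero,
      Complex.ofReal_im, Complex.I_im, mul_one, sub_self, add_zero, Complex.add_im,
      Complex.mul_im, zero_add, smul_eq_mul] at key
    have hI := Complex.I_mul_I
    linear_combination (-Complex.I) * key + ((∫ y in (-T)..T, f ((b : ℂ) + (y : ℂ) * Complex.I)) -
      (∫ y in (-T)..T, f ((a : ℂ) + (y : ℂ) * Complex.I))) * hI
  obtain ⟨C, hC⟩ := hf 1
  -- the horizontal sides of the rectangle are `O(1/T)`
  have hedge : ∀ T : ℝ, ‖∫ x in a..b, f ((x : ℂ) + ((T : ℝ) : ℂ) * Complex.I)‖ ≤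
      C / (1 + |T|) * |b - a| := by
    intro T
    refine intervalIntegral.norm_integral_le_of_norm_le_const fun x hx => ?_
    rw [Set.uIoc_of_le hab] at hx
    have h3 := hC ((x : ℂ) + (T : ℂ) * Complex.I) (by simpa using hx.1.le) (by simpa using hx.2)
    have h4 : ((x : ℂ) + (T : ℂ) * Complex.I).im = T := by simp
    rw [h4, pow_one] at h3
    rwa [le_div_iff₀ (by positivity)]
  have hedge0 : ∀ σ : ℝ, |σ| = 1 →
      Tendsto (fun T : ℝ => ∫ x in a..b, f ((x : ℂ) + ((σ * T : ℝ) : ℂ) * Complex.I)) atTop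
        (𝓝 0) := by
    intro σ hσ
    refine squeeze_zero_norm (fun T => hedge (σ * T)) ?_
    have h1 : Tendsto (fun T : ℝ => 1 + |σ * T|) atTop atTop := by
      simp only [abs_mul, hσ, one_mul]
      exact tendsto_atTop_add_const_left _ _ tendsto_abs_atTop_atTop
    have h2 := (h1.const_div_atTop C).mul_const |b - a|
    simpa using h2
  have lim1 : Tendsto (fun T : ℝ => (∫ y in (-T)..T, f ((b : ℂ) + (y : ℂ) * Complex.I)) -
      (∫ y in (-T)..T, f ((a : ℂ) + (y : ℂ) * Complex.I))) atTop (𝓝 0) := by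
    simp only [hrect]
    have h1 := hedge0 (-1) (by simp)
    have h2 := hedge0 1 (by simp)
    simp only [neg_one_mul, one_mul] at h1 h2
    simpa using (h1.sub h2).const_mul Complex.I
  have lim2 := (intervalIntegral_tendsto_integral ib tendsto_neg_atTop_atBot tendsto_id).sub
    (intervalIntegral_tendsto_integral ia tendsto_neg_atTop_atBot tendsto_id)
  exact sub_eq_zero.1 (tendsto_nhds_unique lim2 lim1)

/-! ### The Gamma function in vertical strips -/

theorem Complex.norm_Gamma_le {s : ℂ} (hs : 0 < s.re) : ‖Complex.Gamma s‖ ≤ Real.Gamma s.re := by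
  rw [Complex.Gamma_eq_integral hs, Real.Gamma_eq_integral hs, Complex.GammaIntegral]
  refine (norm_integral_le_integral_norm _).trans (le_of_eq ?_)
  refine setIntegral_congr_fun measurableSet_Ioi fun x hx => ?_
  rw [norm_mul, Complex.norm_of_nonneg (Real.exp_pos _).le,
    Complex.norm_cpow_eq_rpow_re_of_pos hx]
  simp

/-- The functional equation turns the boundedness of `Γ` in vertical strips into rapid decay. -/
theorem rapidDecayOnStrip_Gamma {a : ℝ} (ha : 0 < a) (b : ℝ) :
    RapidDecayOnStrip Complex.Gamma a b := by
  intro N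
  induction N generalizing a b with
  | zero =>
    have hc : ContinuousOn Real.Gamma (Set.Icc a b) := fun x hx =>
      (Real.differentiableAt_Gamma fun m h => by
        have h0 : (0 : ℝ) < x := ha.trans_le hx.1
        have h1 : (0 : ℝ) ≤ m := Nat.cast_nonneg m
        linarith).continuousAt.continuousWithinAt
    obtain ⟨C, hC⟩ := isCompact_Icc.exists_bound_of_continuousOn hc
    refine ⟨C, fun z h1 h2 => ?_⟩
    rw [pow_zero, mul_one]
    exact (Complex.norm_Gamma_le (ha.trans_le h1)).trans
      ((le_abs_self _).trans (hC z.re ⟨h1, h2⟩))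
  | succ N ih =>
    obtain ⟨C, hC⟩ := ih (a := a + 1) (by linarith) (b + 1)
    refine ⟨C * (1 + 1 / a), fun z h1 h2 => ?_⟩
    have hz0 : z ≠ 0 := by
      rintro rfl
      simp at h1
      linarith
    have h3 := hC (z + 1) (by simpa using h1) (by simpa using h2)
    rw [Complex.Gamma_add_one z hz0, norm_mul] at h3
    have h4 : (z + 1).im = z.im := by simp
    rw [h4] at h3
    have h5 : 1 + |z.im| ≤ ‖z‖ * (1 + 1 / a) := by
      have e1 : |z.im| ≤ ‖z‖ := Complex.abs_im_le_norm z
      have e2 : a ≤ ‖z‖ := h1.trans (Complex.re_le_norm z)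
      have e3 : 1 ≤ ‖z‖ * (1 / a) := by rw [mul_one_div, le_div_iff₀ ha]; linarith
      linarith
    calc ‖Complex.Gamma z‖ * (1 + |z.im|) ^ (N + 1)
        = ‖Complex.Gamma z‖ * (1 + |z.im|) ^ N * (1 + |z.im|) := by ring
      _ ≤ ‖Complex.Gamma z‖ * (1 + |z.im|) ^ N * (‖z‖ * (1 + 1 / a)) :=
        mul_le_mul_of_nonneg_left h5 (by positivity)
      _ = ‖z‖ * ‖Complex.Gamma z‖ * (1 + |z.im|) ^ N * (1 + 1 / a) := by ring
      _ ≤ C * (1 + 1 / a) := mul_le_mul_of_nonneg_right h3 (by positivity)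

theorem rapidDecayOnStrip_modGamma {ħ : ℝ} (hħ : 0 < ħ) {a : ℝ} (ha : 0 < a) (b : ℝ) :
    RapidDecayOnStrip (fun z => modGamma z ħ) a b := by
  intro N
  obtain ⟨C, hC⟩ := rapidDecayOnStrip_Gamma (div_pos ha hħ) (b / ħ) N
  have hc : ContinuousOn (fun x : ℝ => ħ ^ (x / ħ)) (Set.Icc a b) :=
    (Continuous.rpow continuous_const (by fun_prop) fun _ => Or.inl hħ.ne').continuousOn
  obtain ⟨D, hD⟩ := isCompact_Icc.exists_bound_of_continuousOn hc
  refine ⟨D * C * (1 + ħ) ^ N, fun z h1 h2 => ?_⟩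
  have hre : (z / (ħ : ℂ)).re = z.re / ħ := Complex.div_ofReal_re z ħ
  have him : (z / (ħ : ℂ)).im = z.im / ħ := Complex.div_ofReal_im z ħ
  have h3 := hC (z / ħ) (by rw [hre]; gcongr) (by rw [hre]; gcongr)
  rw [him] at h3
  have h4 := (le_abs_self _).trans (hD z.re ⟨h1, h2⟩)
  have h5 : 1 + |z.im| ≤ (1 + |z.im / ħ|) * (1 + ħ) := by
    rw [abs_div, abs_of_pos hħ]
    have : |z.im| / ħ * ħ = |z.im| := div_mul_cancel₀ _ hħ.ne'
    have : 0 ≤ |z.im| / ħ := by positivity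
    nlinarith
  have h6 : 0 ≤ ħ ^ (z.re / ħ) := Real.rpow_nonneg hħ.le _
  simp only [modGamma, norm_mul]
  rw [Complex.norm_cpow_eq_rpow_re_of_pos hħ, hre]
  calc ħ ^ (z.re / ħ) * ‖Complex.Gamma (z / ħ)‖ * (1 + |z.im|) ^ N
      ≤ ħ ^ (z.re / ħ) * ‖Complex.Gamma (z / ħ)‖ * ((1 + |z.im / ħ|) * (1 + ħ)) ^ N := by
        gcongr
    _ = ħ ^ (z.re / ħ) * (‖Complex.Gamma (z / ħ)‖ * (1 + |z.im / ħ|) ^ N) * (1 + ħ) ^ N := by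
        rw [mul_pow]; ring
    _ ≤ D * C * (1 + ħ) ^ N := by
        have hC0 : 0 ≤ ‖Complex.Gamma (z / ħ)‖ * (1 + |z.im / ħ|) ^ N := by positivity
        gcongr
        exact h6.trans h4

theorem differentiableAt_modGamma {ħ : ℝ} (hħ : 0 < ħ) {z : ℂ} (hz : 0 < z.re) :
    DifferentiableAt ℂ (fun z => modGamma z ħ) z := by
  have hc : (ħ : ℂ) ≠ 0 := by exact_mod_cast hħ.ne'
  have h1 : DifferentiableAt ℂ (fun z : ℂ => z / (ħ : ℂ)) z := by fun_prop
  have h2 : DifferentiableAt ℂ Complex.Gamma (z / (ħ : ℂ)) := by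
    refine Complex.differentiableAt_Gamma _ fun m h => ?_
    have h3 := congrArg Complex.re h
    rw [Complex.div_ofReal_re] at h3
    have h4 : 0 < z.re / ħ := div_pos hz hħ
    have h5 : (0 : ℝ) ≤ m := Nat.cast_nonneg m
    simp at h3
    linarith
  exact (h1.const_cpow (Or.inl hc)).mul (h2.comp z h1)

theorem modGamma_add {ħ : ℝ} (hħ : 0 < ħ) {z : ℂ} (hz : z ≠ 0) :
    modGamma (z + ħ) ħ = z * modGamma z ħ := by
  have hc : (ħ : ℂ) ≠ 0 := by exact_mod_cast hħ.ne'
  unfold modGamma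
  rw [show (z + ħ) / (ħ : ℂ) = z / ħ + 1 by field_simp,
    Complex.Gamma_add_one _ (div_ne_zero hz hc), Complex.cpow_add _ _ hc, Complex.cpow_one]
  field_simp

section GammaProd

variable {ℓ : ℕ} {ħ : ℝ} (lam : Fin (ℓ + 1) → ℝ)

/-- `∏_{j=1}^{ℓ+1} Γ₁(z - λ_j|ħ)`. -/
def gammaProd (ħ : ℝ) (lam : Fin (ℓ + 1) → ℝ) (z : ℂ) : ℂ :=
  ∏ j : Fin (ℓ + 1), modGamma (z - (lam j : ℂ)) ħ

theorem rapidDecayOnStrip_gammaProd (hħ : 0 < ħ) {a : ℝ} (ha : ∀ j, lam j < a) (b : ℝ) :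
    RapidDecayOnStrip (gammaProd ħ lam) a b := by
  intro N
  have h1 : ∀ j, ∃ C : ℝ, ∀ z : ℂ, a ≤ z.re → z.re ≤ b →
      ‖modGamma (z - (lam j : ℂ)) ħ‖ * (1 + |z.im|) ^ N ≤ C := by
    intro j
    obtain ⟨C, hC⟩ := rapidDecayOnStrip_modGamma hħ (sub_pos.2 (ha j)) (b - lam j) N
    refine ⟨C, fun z h1 h2 => ?_⟩
    have := hC (z - (lam j : ℂ)) (by simpa using h1) (by simpa using h2)
    simpa using this
  choose C hC using h1
  refine ⟨∏ j, C j, fun z h1 h2 => ?_⟩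
  have h3 : (1 + |z.im|) ^ N ≤ ∏ _j : Fin (ℓ + 1), (1 + |z.im|) ^ N := by
    rw [Finset.prod_const, Finset.card_univ, Fintype.card_fin]
    exact le_self_pow₀ (one_le_pow₀ (by linarith [abs_nonneg z.im])) (by omega)
  calc ‖gammaProd ħ lam z‖ * (1 + |z.im|) ^ N
      ≤ (∏ j, ‖modGamma (z - (lam j : ℂ)) ħ‖) * ∏ _j : Fin (ℓ + 1), (1 + |z.im|) ^ N := by
        rw [gammaProd, norm_prod]
        exact mul_le_mul_of_nonneg_left h3 (Finset.prod_nonneg fun _ _ => norm_nonneg _)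
    _ = ∏ j, (‖modGamma (z - (lam j : ℂ)) ħ‖ * (1 + |z.im|) ^ N) := by
        rw [Finset.prod_mul_distrib]
    _ ≤ ∏ j, C j := Finset.prod_le_prod (fun _ _ => by positivity) fun j _ => hC j z h1 h2

theorem differentiableAt_gammaProd (hħ : 0 < ħ) {z : ℂ} (hz : ∀ j, lam j < z.re) :
    DifferentiableAt ℂ (gammaProd ħ lam) z := by
  unfold gammaProd
  refine DifferentiableAt.fun_finsetProd fun j _ => ?_
  have h1 := differentiableAt_modGamma hħ (z := z - (lam j : ℂ)) (by simpa using hz j)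
  exact h1.comp (f := fun z : ℂ => z - (lam j : ℂ)) z (by fun_prop)

theorem gammaProd_add (hħ : 0 < ħ) {z : ℂ} (hz : ∀ j, z ≠ lam j) :
    gammaProd ħ lam (z + ħ) = (∏ j, (z - (lam j : ℂ))) * gammaProd ħ lam z := by
  unfold gammaProd
  rw [← Finset.prod_mul_distrib]
  refine Finset.prod_congr rfl fun j _ => ?_
  rw [← modGamma_add hħ (sub_ne_zero.2 (hz j))]
  congr 1
  ring

end GammaProd

/-! ### The right Whittaker vector -/

section RightVector

variable {ℓ : ℕ} {ħ : ℝ} (lam : Fin (ℓ + 1) → ℝ)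

/-- The zeros of `μ` cancel the poles of `ψ_R`. -/
theorem gzMeasure_mul_gzRightVector (hħ : ħ ≠ 0) (γ : gzRegular ℓ ħ) :
    gzMeasure ħ lam γ * gzRightVector ħ lam γ =
      gammaProd ħ lam (gzEntry lam γ.1 ℓ 1 + ħ / 2) := by
  have hc : (ħ : ℂ) ≠ 0 := by exact_mod_cast hħ
  have h1 : gzMeasure ħ lam γ = (∏ n ∈ Finset.Icc 2 ℓ, ∏ i ∈ Finset.Icc 1 n,
      ∏ j ∈ (Finset.Icc 1 n).erase i,
        Complex.Gamma ((gzEntry lam γ.1 n i - gzEntry lam γ.1 n j) / (ħ : ℂ)))⁻¹ := by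
    simp only [gzMeasure, Finset.prod_inv_distrib]
  have h2 := gzMeasure_ne_zero ħ lam hħ γ
  rw [h1] at h2 ⊢
  rw [gzRightVector, ← mul_assoc, inv_mul_cancel₀ (fun h => h2 (by rw [h, inv_zero])), one_mul,
    gammaProd]
  refine Finset.prod_congr rfl fun j _ => ?_
  rw [modGamma, show (gzEntry lam γ.1 ℓ 1 + ħ / 2 - (lam j : ℂ)) / (ħ : ℂ) =
    (gzEntry lam γ.1 ℓ 1 - (lam j : ℂ)) / (ħ : ℂ) + 1 / 2 by field_simp; ring]

theorem tendsto_gzMeasure_mul_gzRightVector (hℓ : 1 ≤ ℓ) (hħ : 0 < ħ) {s v : ℂ}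
    (hs : ∀ j, lam j < s.re + ħ / 2) {φ : GZFun ℓ ħ}
    (hφ : Tendsto φ (comap Subtype.val (𝓝 (gzSupport ℓ ħ s))) (𝓝 v)) :
    Tendsto (fun γ => gzMeasure ħ lam γ * φ γ * gzRightVector ħ lam γ)
      (comap Subtype.val (𝓝 (gzSupport ℓ ħ s))) (𝓝 (v * gammaProd ħ lam (s + ħ / 2))) := by
  have h1 : gzEntry lam (gzSupport ℓ ħ s) ℓ 1 = s := by
    rw [gzEntry_gzSupport lam ħ s (mem_gzIndex.2 ⟨le_rfl, hℓ, le_rfl⟩)]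
    simp
  have h2 : Tendsto (fun γ : gzRegular ℓ ħ => gzEntry lam γ.1 ℓ 1 + (ħ : ℂ) / 2)
      (comap Subtype.val (𝓝 (gzSupport ℓ ħ s))) (𝓝 (s + ħ / 2)) := by
    have := (tendsto_comap_gzRegular (ħ := ħ) (continuous_gzEntry lam ℓ 1)
      (gzSupport ℓ ħ s)).add_const ((ħ : ℂ) / 2)
    rwa [h1] at this
  have hre : (s + (ħ : ℂ) / 2).re = s.re + ħ / 2 := by simp
  have h3 := (differentiableAt_gammaProd lam hħ (z := s + ħ / 2) (by
    intro j; rw [hre]; exact hs j)).continuousAt.tendsto.comp h2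
  refine (hφ.mul h3).congr fun γ => ?_
  rw [Function.comp_apply, ← gzMeasure_mul_gzRightVector lam hħ.ne']
  ring

/-- To compute a pairing it is enough to know the limits of the density off the real axis, where the
entries of each row are distinct: on the contour this leaves out a single point. -/
theorem gzPairing_of_tendsto {c : ℝ} {φ ψ : GZFun ℓ ħ} {D : ℂ → ℂ}
    (h : ∀ y : ℝ, y ≠ 0 → Tendsto (fun γ => gzMeasure ħ lam γ * φ γ * ψ γ)
      (comap Subtype.val (𝓝 (gzSupport ℓ ħ ((c : ℂ) + (y : ℂ) * Complex.I))))
      (𝓝 (D ((c : ℂ) + (y : ℂ) * Complex.I))))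
    (hi : Integrable fun y : ℝ => D ((c : ℂ) + (y : ℂ) * Complex.I)) :
    GZPairable ħ lam c φ ψ ∧ gzPairing ħ lam c φ ψ =
      ∫ y : ℝ, Complex.I * D ((c : ℂ) + (y : ℂ) * Complex.I) := by
  have hae : ∀ᵐ y : ℝ, y ≠ 0 := by
    rw [ae_iff]
    simp
  have heq : ∀ᵐ y : ℝ, gzDensity ħ lam φ ψ ((c : ℂ) + (y : ℂ) * Complex.I) =
      D ((c : ℂ) + (y : ℂ) * Complex.I) := hae.mono fun y hy => (h y hy).limUnder_eq
  refine ⟨⟨hae.mono fun y hy => ⟨_, h y hy⟩, hi.congr (heq.mono fun y hy => hy.symm)⟩, ?_⟩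
  exact integral_congr_ae (heq.mono fun y hy => by simp only [hy])

theorem differentiable_gzSupport (ħ : ℝ) : Differentiable ℂ (gzSupport ℓ ħ) := by
  rw [differentiable_pi]
  intro p
  unfold gzSupport
  split_ifs <;> fun_prop

/-- A translation of the line by `ħ` shifts the first entry of every row by `ħ`. -/
theorem gzSupport_add (s : ℂ) : gzSupport ℓ ħ (s + ħ) = fun q : gzIndex ℓ => gzSupport ℓ ħ s q +
    if q.1.2 = 1 ∧ q.1.1 ≤ ℓ then (ħ : ℂ) else 0 := by
  funext q
  have hq := mem_gzIndex.1 (show (q.1.1, q.1.2) ∈ gzIndex ℓ from q.2)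
  simp only [gzSupport, hq.2.2, and_true]
  split_ifs <;> ring

/-- On the line the integrand of the pairing with a test function decays rapidly, so that the
contour can be moved. -/
theorem rapidDecayOnStrip_gammaProd_mul (hħ : 0 < ħ) {a : ℝ} (ha : ∀ j, lam j < a + ħ / 2) (b : ℝ)
    {F : GZArray ℓ → ℂ} (hF : ∀ R : ℝ, ∃ (C : ℝ) (N : ℕ), ∀ γ : GZArray ℓ,
      (∀ p, |(γ p).re| ≤ R) → ‖F γ‖ ≤ C * (1 + ‖γ‖) ^ N) :
    RapidDecayOnStrip (fun s => gammaProd ħ lam (s + ((ħ / 2 : ℝ) : ℂ)) * F (gzSupport ℓ ħ s))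
      a b := by
  have h1 := (rapidDecayOnStrip_gammaProd lam hħ ha (b + ħ / 2)).comp_add
  -- `A` bounds the real constants in the entries of the points of the line
  obtain ⟨A, hA0, hA⟩ : ∃ A : ℝ, 0 ≤ A ∧ ∀ s : ℂ, ∀ p : gzIndex ℓ,
      (|(gzSupport ℓ ħ s p).re| ≤ |s.re| + A ∧ |(gzSupport ℓ ħ s p).im| ≤ |s.im|) := by
    refine ⟨ħ * (2 * ℓ + 1), by positivity, fun s p => ?_⟩
    have hp := mem_gzIndex.1 (show (p.1.1, p.1.2) ∈ gzIndex ℓ from p.2)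
    have q1 : (1 : ℝ) ≤ (p.1.2 : ℝ) := by exact_mod_cast hp.1
    have q2 : (p.1.2 : ℝ) ≤ (p.1.1 : ℝ) := by exact_mod_cast hp.2.1
    have q3 : (p.1.1 : ℝ) ≤ (ℓ : ℝ) := by exact_mod_cast hp.2.2
    unfold gzSupport
    split_ifs with h
    · have e : s - ((ℓ : ℂ) - (p.1.1 : ℂ)) * (ħ : ℂ) / 2 =
          s - ((((ℓ : ℝ) - (p.1.1 : ℝ)) * ħ / 2 : ℝ) : ℂ) := by push_cast; ring
      rw [e, Complex.sub_re, Complex.sub_im, Complex.ofReal_re, Complex.ofReal_im, sub_zero]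
      refine ⟨(abs_sub _ _).trans ?_, le_rfl⟩
      gcongr
      rw [abs_le]
      constructor <;> nlinarith
    · have e : ((p.1.1 : ℂ) - 2 * (p.1.2 : ℂ) + 1) * (ħ : ℂ) / 2 =
          ((((p.1.1 : ℝ) - 2 * (p.1.2 : ℝ) + 1) * ħ / 2 : ℝ) : ℂ) := by push_cast; ring
      rw [e, Complex.ofReal_re, Complex.ofReal_im, abs_zero]
      refine ⟨?_, abs_nonneg _⟩
      have : |((p.1.1 : ℝ) - 2 * (p.1.2 : ℝ) + 1) * ħ / 2| ≤ ħ * (2 * ℓ + 1) := by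
        rw [abs_le]
        constructor <;> nlinarith
      linarith [abs_nonneg s.re]
  obtain ⟨C, N, hC⟩ := hF (max |a| |b| + A)
  have hre : ∀ s : ℂ, a ≤ s.re → s.re ≤ b → |s.re| ≤ max |a| |b| := fun s h2 h3 =>
    abs_le_max_abs_abs h2 h3
  refine h1.mul_of_le (C := |C| * (1 + max |a| |b| + A) ^ N) (M := N) fun s h2 h3 => ?_
  have hB : 0 ≤ max |a| |b| := (abs_nonneg a).trans (le_max_left _ _)
  have hn : ‖gzSupport ℓ ħ s‖ ≤ max |a| |b| + A + |s.im| := by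
    refine (pi_norm_le_iff_of_nonneg (by positivity)).2 fun p => ?_
    have := hA s p
    linarith [Complex.norm_le_abs_re_add_abs_im (gzSupport ℓ ħ s p), hre s h2 h3]
  calc ‖F (gzSupport ℓ ħ s)‖ ≤ C * (1 + ‖gzSupport ℓ ħ s‖) ^ N :=
        hC _ fun p => by linarith [(hA s p).1, hre s h2 h3]
    _ ≤ |C| * (1 + ‖gzSupport ℓ ħ s‖) ^ N :=
        mul_le_mul_of_nonneg_right (le_abs_self C) (by positivity)
    _ ≤ |C| * ((1 + max |a| |b| + A) * (1 + |s.im|)) ^ N := by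
        gcongr
        nlinarith [abs_nonneg s.im, mul_nonneg (add_nonneg hB hA0) (abs_nonneg s.im)]
    _ = |C| * (1 + max |a| |b| + A) ^ N * (1 + |s.im|) ^ N := by rw [mul_pow]; ring

/-- The row `ℓ + 1` consists of the `λ_j`. -/
theorem prod_gzEntry_top (γ : GZArray ℓ) (f : ℂ → ℂ) :
    ∏ j ∈ Finset.Icc 1 (ℓ + 1), f (gzEntry lam γ (ℓ + 1) j) = ∏ j : Fin (ℓ + 1), f (lam j) := by
  rw [show Finset.Icc 1 (ℓ + 1) = (Finset.range (ℓ + 1)).map (addRightEmbedding 1) by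
    ext j; simp only [Finset.mem_Icc, Finset.mem_map, Finset.mem_range, addRightEmbedding_apply]
    exact ⟨fun h => ⟨j - 1, by omega, by omega⟩, by rintro ⟨a, h, rfl⟩; omega⟩,
    Finset.prod_map, Finset.prod_range]
  refine Finset.prod_congr rfl fun j _ => ?_
  have h1 : ((ℓ + 1, (j : ℕ) + 1) : ℕ × ℕ) ∉ gzIndex ℓ := fun h => by
    have := mem_gzIndex.1 h; omega
  have hj : (j : ℕ) < ℓ + 1 := j.2
  rw [addRightEmbedding_apply, gzEntry, dif_neg h1, dif_pos (by omega)]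
  simp

/-- The right Whittaker vector equations. For the last one the transposed root vector turns the
integrand `H(s)` into a multiple of `H(s + ħ)`, and the contour is moved back by `ħ`. -/
theorem isRightWhittakerVector_gzRightVector (hℓ : 1 ≤ ℓ) (hħ : 0 < ħ) {ε : ℝ}
    (hε : ∀ j, lam j < ε) :
    IsRightWhittakerVector ħ lam (ε - ħ / 2) (ℓ * (ℓ - 1) / 2 + 1) (gzRightVector ħ lam) := by
  set c : ℝ := ε - ħ / 2 with hcdef
  have hcε : ∀ j, lam j < c + ħ / 2 := fun j => by rw [hcdef]; linarith [hε j]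
  have hre : ∀ y : ℝ, ((c : ℂ) + (y : ℂ) * Complex.I).re = c := fun y => by simp
  have him : ∀ y : ℝ, ((c : ℂ) + (y : ℂ) * Complex.I).im = y := fun y => by simp
  have zero_case : ∀ φ : GZFun ℓ ħ, (∀ y : ℝ, y ≠ 0 → Tendsto φ (comap Subtype.val
      (𝓝 (gzSupport ℓ ħ ((c : ℂ) + (y : ℂ) * Complex.I)))) (𝓝 0)) →
      GZPairable ħ lam c φ (gzRightVector ħ lam) ∧
        gzPairing ħ lam c φ (gzRightVector ħ lam) = 0 := by
    intro φ hφ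
    have := gzPairing_of_tendsto lam (c := c) (φ := φ) (ψ := gzRightVector ħ lam)
      (D := fun _ => 0) (fun y hy => by
        have := tendsto_gzMeasure_mul_gzRightVector lam hℓ hħ (by
          intro j; rw [hre]; exact hcε j) (hφ y hy)
        rwa [zero_mul] at this) (integrable_zero _ _ _)
    simpa using this
  have main : ∀ F : GZArray ℓ → ℂ, Differentiable ℂ F → (∀ R : ℝ, ∃ (C : ℝ) (N : ℕ),
      ∀ γ : GZArray ℓ, (∀ p, |(γ p).re| ≤ R) → ‖F γ‖ ≤ C * (1 + ‖γ‖) ^ N) →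
      GZPairable ħ lam c (fun γ => F γ.1) (gzRightVector ħ lam) ∧
      GZPairable ħ lam c (gzRootAdj ħ lam (ℓ - 1) (fun γ => F γ.1)) (gzRightVector ħ lam) ∧
      gzPairing ħ lam c (gzRootAdj ħ lam (ℓ - 1) (fun γ => F γ.1)) (gzRightVector ħ lam) =
        ((-1 : ℂ) ^ (ℓ * (ℓ - 1) / 2 + 1) / (ħ : ℂ)) *
          gzPairing ħ lam c (fun γ => F γ.1) (gzRightVector ħ lam) := by
    intro F hFd hFg
    set H : ℂ → ℂ := fun s => gammaProd ħ lam (s + ((ħ / 2 : ℝ) : ℂ)) * F (gzSupport ℓ ħ s)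
      with hH
    have hdec : RapidDecayOnStrip H c (c + ħ) :=
      rapidDecayOnStrip_gammaProd_mul lam hħ hcε (c + ħ) hFg
    have hdiff : ∀ z : ℂ, c ≤ z.re → z.re ≤ c + ħ → DifferentiableAt ℂ H z := by
      intro z h1 _
      have h3 := differentiableAt_gammaProd lam hħ (z := z + ((ħ / 2 : ℝ) : ℂ)) (by
        intro j
        rw [Complex.add_re, Complex.ofReal_re]
        linarith [hcε j])
      exact (h3.comp (f := fun s : ℂ => s + ((ħ / 2 : ℝ) : ℂ)) z (by fun_prop)).mul
        ((hFd _).comp z (differentiable_gzSupport ħ z))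
    have hcont : ∀ d : ℝ, c ≤ d → d ≤ c + ħ →
        Continuous fun y : ℝ => H ((d : ℂ) + (y : ℂ) * Complex.I) := by
      intro d h1 h2
      rw [continuous_iff_continuousAt]
      intro y
      have h3 := (hdiff ((d : ℂ) + (y : ℂ) * Complex.I) (by simpa using h1)
        (by simpa using h2)).continuousAt
      exact ContinuousAt.comp (f := fun y : ℝ => (d : ℂ) + (y : ℂ) * Complex.I) h3 (by fun_prop)
    have i1 := hdec.integrable le_rfl (by linarith) (hcont c le_rfl (by linarith))
    have i2 := hdec.integrable (by linarith) le_rfl (hcont (c + ħ) (by linarith) le_rfl)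
    have hshift := hdec.integral_eq (by linarith) hdiff
    have p1 := gzPairing_of_tendsto lam (c := c) (φ := fun γ => F γ.1) (ψ := gzRightVector ħ lam)
      (D := H) (fun y _ => by
        have := tendsto_gzMeasure_mul_gzRightVector lam hℓ hħ (by
          intro j; rw [hre]; exact hcε j) (tendsto_comap_gzRegular (ħ := ħ) hFd.continuous
            (gzSupport ℓ ħ ((c : ℂ) + (y : ℂ) * Complex.I)))
        rw [show (ħ : ℂ) / 2 = ((ħ / 2 : ℝ) : ℂ) by push_cast; ring, mul_comm (F _)] at this
        exact this) i1
    set K : ℂ := (-1 : ℂ) ^ (ℓ * (ℓ - 1) / 2 + 1) / (ħ : ℂ) with hK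
    -- the signs of the transposes in the rows `1, …, ℓ` add up to the exponent `∑_{m<ℓ} m`
    have hKval : (∏ m ∈ Finset.range ℓ, (-1 : ℂ) ^ m) * (-1 / (ħ : ℂ)) = K := by
      rw [Finset.prod_pow_eq_pow_sum, Finset.sum_range_id, hK, pow_succ]
      ring
    have p2 := gzPairing_of_tendsto lam (c := c)
      (φ := gzRootAdj ħ lam (ℓ - 1) (fun γ => F γ.1)) (ψ := gzRightVector ħ lam)
      (D := fun s => K * H (s + ħ)) (fun y hy => by
        obtain ⟨k, rfl⟩ : ∃ k, ℓ = k + 1 := ⟨ℓ - 1, by omega⟩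
        set s : ℂ := (c : ℂ) + (y : ℂ) * Complex.I with hs
        have hsim : s.im ≠ 0 := by rw [him]; exact hy
        have mem1 : (k + 1, 1) ∈ gzIndex (k + 1) := mem_gzIndex.2 (by omega)
        have hlim := tendsto_finsetSum (f := fun i (γ : gzRegular (k + 1) ħ) =>
          rowQuot (gzEntry lam γ.1) ((-1 : ℤ) * ħ) (k + 1) (k + 2) i (Finset.Icc 1 (k + 2)) ∅ *
          gzPath ħ lam k i (fun γ => F γ.1) γ) (Finset.Icc 1 (k + 1)) (fun i hi =>
            (tendsto_rowQuot lam ((-1 : ℤ) * ħ) (γ₀ := gzSupport (k + 1) ħ s) (n := k + 1)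
              (m := k + 2) (i := i) (J := Finset.Icc 1 (k + 2)) (S := ∅)
              (fun t ht => by simp at ht)).mul
            (tendsto_gzPath lam hħ.ne' hsim k le_rfl F hFd.continuous i hi))
        have hroot : gzRootAdj ħ lam (k + 1 - 1) (fun γ => F γ.1) = fun γ =>
            ∑ i ∈ Finset.Icc 1 (k + 1), rowQuot (gzEntry lam γ.1) ((-1 : ℤ) * ħ) (k + 1) (k + 2) i
              (Finset.Icc 1 (k + 2)) ∅ * gzPath ħ lam k i (fun γ => F γ.1) γ := by
          funext γ
          exact gzRootAdj_apply ħ lam hħ.ne' k le_rfl _ γ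
        rw [← hroot, Finset.sum_eq_single 1 (fun i _ hi => by rw [if_neg hi, mul_zero])
          (fun h => absurd (Finset.mem_Icc.2 (by omega)) h), if_pos rfl, hKval,
          ← gzSupport_add] at hlim
        have hfin := tendsto_gzMeasure_mul_gzRightVector lam hℓ hħ (by
          intro j; rw [hre]; exact hcε j) hlim
        have hq : rowQuot (gzEntry lam (gzSupport (k + 1) ħ s)) ((-1 : ℤ) * ħ) (k + 1) (k + 2) 1
            (Finset.Icc 1 (k + 2)) ∅ = ∏ j, (s + ħ / 2 - (lam j : ℂ)) := by
          rw [rowQuot, Finset.prod_empty, div_one, prod_gzEntry_top lam _ (fun z =>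
            gzEntry lam (gzSupport (k + 1) ħ s) (k + 1) 1 - z - ((-1 : ℤ) * ħ) / 2)]
          refine Finset.prod_congr rfl fun j _ => ?_
          rw [gzEntry_gzSupport lam ħ s mem1, if_pos rfl]
          push_cast
          ring
        have hadd := gammaProd_add lam hħ (z := s + ħ / 2) (by
          intro j h
          have h1 := congrArg Complex.re h
          rw [Complex.ofReal_re, Complex.add_re, hre] at h1
          have h2 : ((ħ : ℂ) / 2).re = ħ / 2 := by simp
          rw [h2] at h1
          linarith [hcε j])
        -- the factors of row `ℓ` are those of the functional equation
        have hv : rowQuot (gzEntry lam (gzSupport (k + 1) ħ s)) ((-1 : ℤ) * ħ) (k + 1) (k + 2) 1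
            (Finset.Icc 1 (k + 2)) ∅ * (K * F (gzSupport (k + 1) ħ (s + ħ))) *
            gammaProd ħ lam (s + ħ / 2) = K * H (s + ħ) := by
          rw [hq, hH]
          simp only
          rw [show s + (ħ : ℂ) + ((ħ / 2 : ℝ) : ℂ) = s + ħ / 2 + ħ by push_cast; ring, hadd]
          ring
        rw [hv] at hfin
        exact hfin) (by
          have : (fun y : ℝ => K * H ((c : ℂ) + (y : ℂ) * Complex.I + ħ)) =
              fun y : ℝ => K * H (((c + ħ : ℝ) : ℂ) + (y : ℂ) * Complex.I) := by
            funext y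
            congr 2
            push_cast
            ring
          rw [this]
          exact i2.const_mul K)
    refine ⟨p1.1, p2.1, ?_⟩
    rw [p1.2, p2.2, integral_const_mul, integral_const_mul, integral_const_mul, ← hshift]
    have : (fun y : ℝ => H ((c : ℂ) + (y : ℂ) * Complex.I + ħ)) =
        fun y : ℝ => H (((c + ħ : ℝ) : ℂ) + (y : ℂ) * Complex.I) := by
      funext y
      congr 1
      push_cast
      ring
    rw [this]
    ring
  have test : ∀ φ : GZFun ℓ ħ, IsGZTest ħ φ → ∃ F : GZArray ℓ → ℂ, Differentiable ℂ F ∧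
      (∀ R : ℝ, ∃ (C : ℝ) (N : ℕ), ∀ γ : GZArray ℓ, (∀ p, |(γ p).re| ≤ R) →
        ‖F γ‖ ≤ C * (1 + ‖γ‖) ^ N) ∧ φ = fun γ => F γ.1 := by
    rintro φ ⟨F, h1, h2, h3⟩
    exact ⟨F, h1, h2, funext h3⟩
  refine ⟨?_, ?_, ?_, ?_⟩
  · intro φ hφ
    obtain ⟨F, h1, h2, rfl⟩ := test φ hφ
    exact (main F h1 h2).1
  · intro k hk φ hφ
    obtain ⟨F, h1, h2, rfl⟩ := test φ hφ
    refine zero_case _ fun y _ => ?_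
    have hw : Continuous fun γ : GZArray ℓ => (1 / (ħ : ℂ)) * (∑ j ∈ Finset.Icc 1 k,
        gzEntry lam γ k j - ∑ i ∈ Finset.Icc 1 (k - 1), gzEntry lam γ (k - 1) i) :=
      continuous_const.mul ((continuous_finsetSum _ fun j _ => continuous_gzEntry lam k j).sub
        (continuous_finsetSum _ fun j _ => continuous_gzEntry lam (k - 1) j))
    have hlim := (tendsto_comap_gzRegular (ħ := ħ) hw
      (gzSupport ℓ ħ ((c : ℂ) + (y : ℂ) * Complex.I))).mul
      (tendsto_comap_gzRegular (ħ := ħ) h1.continuous _)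
    rw [((gzSupport_iff hℓ ħ lam _ _).2 rfl).1 k hk, mul_zero, zero_mul] at hlim
    exact hlim
  · intro k hk φ hφ
    obtain ⟨F, h1, h2, rfl⟩ := test φ hφ
    rw [Finset.mem_Icc] at hk
    refine zero_case _ fun y hy => ?_
    rw [gzRaiseAdj_eq_rowOp ħ lam hħ.ne' (by omega)]
    have hlim := tendsto_finsetSum (f := fun i (γ : gzRegular ℓ ħ) =>
      rowCoeff ħ lam (-((-1) ^ (k - 1) / (ħ : ℂ))) (-1) k (k + 1) (k + 1) i γ *
        F (gzShift γ k i (- -1)).1) (Finset.Icc 1 k) (fun i hi => by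
      rw [Finset.mem_Icc] at hi
      have mi : (k, i) ∈ gzIndex ℓ := mem_gzIndex.2 (by omega)
      have hsh : Continuous (fun γ : GZArray ℓ => F (fun q => γ q + if q.1 = (k, i) then
          ((- -1 : ℤ) : ℂ) * ħ else 0)) := h1.continuous.comp (by fun_prop)
      exact ((tendsto_rowQuot lam (((-1 : ℤ) : ℂ) * ħ) (γ₀ := gzSupport ℓ ħ
        ((c : ℂ) + (y : ℂ) * Complex.I)) (fun t ht => by
          simp only [Finset.mem_erase, Finset.mem_Icc] at ht
          exact gzEntry_gzSupport_ne lam hħ.ne' (by rw [him]; exact hy) mi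
            (mem_gzIndex.2 (by omega)) (Ne.symm ht.1))).const_mul _).mul
        (tendsto_comap_gzRegular (ħ := ħ) hsh _))
    rw [Finset.sum_eq_zero (fun i hi => by
      rw [Finset.mem_Icc] at hi
      rw [rowQuot_gzSupport_eq_zero lam (mem_gzIndex.2 (by omega)) (by omega)
        (Finset.mem_Icc.2 (by omega)), mul_zero, zero_mul])] at hlim
    exact hlim
  · intro φ hφ
    obtain ⟨F, h1, h2, rfl⟩ := test φ hφ
    exact (main F h1 h2).2

end RightVector

/-! ### Euler's integral and its Fourier inverse -/

section Euler

variable {ħ : ℝ}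

open FourierTransform

/-- Euler's integral in the variable `t = log (ħ u)`. -/
theorem integral_cexp_sub_exp (hħ : 0 < ħ) {z : ℂ} (hz : 0 < z.re) :
    ∫ t : ℝ, Complex.exp ((z * t - (Real.exp t : ℂ)) / ħ) = modGamma z ħ := by
  have hc : (ħ : ℂ) ≠ 0 := by exact_mod_cast hħ.ne'
  have hre : 0 < (z / (ħ : ℂ)).re := by rw [Complex.div_ofReal_re]; exact div_pos hz hħ
  have key := Complex.integral_cpow_mul_exp_neg_mul_Ioi hre (one_div_pos.2 hħ)
  have himg : Real.exp '' Set.univ = Set.Ioi 0 := by rw [Set.image_univ, Real.range_exp]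
  rw [← himg, integral_image_eq_integral_abs_deriv_smul MeasurableSet.univ
    (fun x _ => (Real.hasDerivAt_exp x).hasDerivWithinAt) Real.exp_injective.injOn,
    Measure.restrict_univ] at key
  have hr : (1 / ((1 / ħ : ℝ) : ℂ)) = ħ := by push_cast; field_simp
  rw [hr] at key
  rw [modGamma, ← key]
  refine integral_congr_ae (Eventually.of_forall fun t => ?_)
  have h1 : ((Real.exp t : ℝ) : ℂ) ^ (z / (ħ : ℂ) - 1) = Complex.exp (t * (z / ħ - 1)) := by
    rw [Complex.cpow_def_of_ne_zero (by exact_mod_cast (Real.exp_pos t).ne'),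
      ← Complex.ofReal_log (Real.exp_pos t).le, Real.log_exp]
  simp only
  rw [h1, abs_of_pos (Real.exp_pos t), Complex.real_smul, ← mul_assoc]
  nth_rw 2 [Complex.ofReal_exp]
  rw [← Complex.exp_add, ← Complex.exp_add]
  congr 1
  push_cast
  field_simp
  ring

theorem modGamma_ne_zero (hħ : 0 < ħ) {z : ℂ} (hz : 0 < z.re) : modGamma z ħ ≠ 0 := by
  have hc : (ħ : ℂ) ≠ 0 := by exact_mod_cast hħ.ne'
  refine mul_ne_zero ?_ (Complex.Gamma_ne_zero_of_re_pos ?_)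
  · rw [Ne, Complex.cpow_eq_zero_iff]; tauto
  · rw [Complex.div_ofReal_re]; exact div_pos hz hħ

theorem integrable_cexp_sub_exp (hħ : 0 < ħ) {z : ℂ} (hz : 0 < z.re) :
    Integrable fun t : ℝ => Complex.exp ((z * t - (Real.exp t : ℂ)) / ħ) := by
  -- the integral of a function that is not integrable would be zero
  by_contra h
  exact modGamma_ne_zero hħ hz ((integral_cexp_sub_exp hħ hz).symm.trans (integral_undef h))

theorem integrable_modGamma (hħ : 0 < ħ) {d : ℝ} (hd : 0 < d) :
    Integrable fun y : ℝ => modGamma ((d : ℂ) + (y : ℂ) * Complex.I) ħ := by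
  refine (rapidDecayOnStrip_modGamma hħ hd d).integrable le_rfl le_rfl ?_
  rw [continuous_iff_continuousAt]
  intro y
  have h1 := (differentiableAt_modGamma hħ (z := (d : ℂ) + (y : ℂ) * Complex.I)
    (by simpa using hd)).continuousAt
  exact ContinuousAt.comp (f := fun y : ℝ => (d : ℂ) + (y : ℂ) * Complex.I) h1 (by fun_prop)

/-- Fourier inversion of Euler's integral on the line `Re z = d`. -/
theorem cexp_sub_exp_eq_integral_modGamma (hħ : 0 < ħ) {d : ℝ} (hd : 0 < d) (u : ℝ) :
    Complex.exp (((d : ℂ) * u - (Real.exp u : ℂ)) / ħ) = 1 / (2 * (Real.pi : ℂ) * (ħ : ℂ)) *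
      ∫ y : ℝ, modGamma ((d : ℂ) + (y : ℂ) * Complex.I) ħ *
        Complex.exp (-((y : ℂ) * u / ħ * Complex.I)) := by
  have hc : (ħ : ℂ) ≠ 0 := by exact_mod_cast hħ.ne'
  have ha : -(2 * Real.pi * ħ) ≠ 0 := neg_ne_zero.2 (by positivity)
  set G : ℝ → ℂ := fun u => Complex.exp (((d : ℂ) * u - (Real.exp u : ℂ)) / ħ) with hG
  have hGc : Continuous G := by
    have : Continuous fun u : ℝ => ((Real.exp u : ℝ) : ℂ) :=
      Complex.continuous_ofReal.comp Real.continuous_exp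
    fun_prop
  have hGi : Integrable G := integrable_cexp_sub_exp hħ (z := (d : ℂ)) (by simpa using hd)
  have hF : ∀ w : ℝ, 𝓕 G w =
      modGamma ((d : ℂ) + ((-(2 * Real.pi * ħ) * w : ℝ) : ℂ) * Complex.I) ħ := by
    intro w
    rw [Real.fourier_real_eq_integral_exp_smul, ← integral_cexp_sub_exp hħ (by simpa using hd)]
    refine integral_congr_ae (Eventually.of_forall fun t => ?_)
    simp only [hG, smul_eq_mul]
    rw [← Complex.exp_add]
    congr 1
    push_cast
    field_simp
    ring
  have hFi : Integrable (𝓕 G) := by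
    rw [funext hF]
    exact (integrable_modGamma hħ hd).comp_mul_left' ha
  have hinv := congrFun (hGc.fourierInv_fourier_eq hGi hFi) u
  change G u = _
  rw [← hinv, Real.fourierInv_eq']
  have hcv := Measure.integral_comp_mul_left (fun y : ℝ =>
    modGamma ((d : ℂ) + (y : ℂ) * Complex.I) ħ * Complex.exp (-((y : ℂ) * u / ħ * Complex.I)))
    (-(2 * Real.pi * ħ))
  have habs : |(-(2 * Real.pi * ħ))⁻¹| = 1 / (2 * Real.pi * ħ) := by
    rw [inv_neg, abs_neg, abs_of_pos (by positivity), one_div]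
  rw [habs, Complex.real_smul] at hcv
  have hcast : ((1 / (2 * Real.pi * ħ) : ℝ) : ℂ) = 1 / (2 * (Real.pi : ℂ) * (ħ : ℂ)) := by
    push_cast; ring
  rw [hcast] at hcv
  rw [← hcv]
  refine integral_congr_ae (Eventually.of_forall fun w => ?_)
  simp only [smul_eq_mul]
  rw [hF, mul_comm]
  congr 2
  simp only [RCLike.inner_apply, conj_trivial]
  push_cast
  field_simp

end Euler

/-! ### Givental's integral -/

section Givental

variable {ℓ : ℕ} {ħ : ℝ} (lam : Fin (ℓ + 1) → ℝ)

theorem mellinBarnesIntegrand_eq (ε x y : ℝ) :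
    mellinBarnesIntegrand ħ lam x ((y : ℂ) - Complex.I * (ε : ℂ)) =
      gammaProd ħ lam ((ε : ℂ) + (y : ℂ) * Complex.I) *
        Complex.exp (-((x : ℂ) * ((ε : ℂ) + (y : ℂ) * Complex.I) / ħ)) := by
  have h : Complex.I * ((y : ℂ) - Complex.I * (ε : ℂ)) = (ε : ℂ) + (y : ℂ) * Complex.I := by
    linear_combination (-(ε : ℂ)) * Complex.I_mul_I
  rw [mellinBarnesIntegrand, h, mul_comm, gammaProd]
  congr 2
  linear_combination (-(x : ℂ) / ħ) * h

theorem integrable_mellinBarnesIntegrand (hħ : 0 < ħ) {ε : ℝ} (hε : ∀ j, lam j < ε) (x : ℝ) :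
    Integrable fun y : ℝ =>
      mellinBarnesIntegrand ħ lam x ((y : ℂ) - Complex.I * (ε : ℂ)) := by
  simp only [mellinBarnesIntegrand_eq]
  have hd := (rapidDecayOnStrip_gammaProd lam hħ hε ε).mul_of_le
    (g := fun z => Complex.exp (-((x : ℂ) * z / ħ))) (C := Real.exp (-(x * ε / ħ))) (M := 0) (by
      intro z h1 h2
      rw [Complex.norm_exp, pow_zero, mul_one, Complex.neg_re, Complex.div_ofReal_re,
        Complex.re_ofReal_mul, le_antisymm h2 h1])
  refine hd.integrable le_rfl le_rfl ?_
  rw [continuous_iff_continuousAt]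
  intro y
  have h1 := (differentiableAt_gammaProd lam hħ (z := (ε : ℂ) + (y : ℂ) * Complex.I)
    (by simpa using hε)).continuousAt
  have h2 := ContinuousAt.comp (f := fun y : ℝ => (ε : ℂ) + (y : ℂ) * Complex.I) h1 (by fun_prop)
  exact h2.mul (by fun_prop)

/-- Givental's integrand is a convolution integrand: a product of functions of `t_j` and of a
function of `x - ∑ t_j`. A factor `e^{εx/ħ}` makes all of them integrable. -/
theorem giventalIntegrand_eq (ε x : ℝ) (t : Fin ℓ → ℝ) :
    (giventalIntegrand ħ lam x t : ℂ) = Complex.exp (-((ε : ℂ) * x / ħ)) *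
      ((∏ j : Fin ℓ, Complex.exp ((((ε - lam j.castSucc : ℝ) : ℂ) * t j -
        (Real.exp (t j) : ℂ)) / ħ)) *
      Complex.exp ((((ε - lam (Fin.last ℓ) : ℝ) : ℂ) * ((x - ∑ j, t j : ℝ) : ℂ) -
        (Real.exp (x - ∑ j, t j) : ℂ)) / ħ)) := by
  rw [giventalIntegrand, Complex.ofReal_exp, ← Complex.exp_sum, ← Complex.exp_add,
    ← Complex.exp_add]
  congr 1
  rw [← Finset.sum_div, Finset.sum_sub_distrib]
  push_cast
  simp only [sub_mul, Finset.sum_sub_distrib, ← Finset.mul_sum]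
  ring

/-- Givental's integral is a Mellin–Barnes integral: write the last factor of the convolution as a
Fourier integral and exchange the integrations. -/
theorem integral_giventalIntegrand (hħ : 0 < ħ) {ε : ℝ} (hε : ∀ j, lam j < ε) (x : ℝ) :
    Integrable (giventalIntegrand ħ lam x) ∧
      ((∫ t : Fin ℓ → ℝ, giventalIntegrand ħ lam x t : ℝ) : ℂ) =
        1 / (2 * (Real.pi : ℂ) * (ħ : ℂ)) *
          ∫ y : ℝ, mellinBarnesIntegrand ħ lam x ((y : ℂ) - Complex.I * (ε : ℂ)) := by
  have hc : (ħ : ℂ) ≠ 0 := by exact_mod_cast hħ.ne'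
  set d : Fin (ℓ + 1) → ℝ := fun j => ε - lam j with hd
  have hdpos : ∀ j, 0 < d j := fun j => sub_pos.2 (hε j)
  set g : Fin ℓ → ℝ → ℂ := fun j t =>
    Complex.exp (((d j.castSucc : ℂ) * t - (Real.exp t : ℂ)) / ħ) with hg
  have hgi : ∀ j, Integrable (g j) := fun j =>
    integrable_cexp_sub_exp hħ (z := (d j.castSucc : ℂ)) (by simpa using hdpos j.castSucc)
  set m : ℝ → ℂ := fun y => modGamma ((d (Fin.last ℓ) : ℂ) + (y : ℂ) * Complex.I) ħ with hm
  have hmi : Integrable m := integrable_modGamma hħ (hdpos (Fin.last ℓ))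
  set Φ : (Fin ℓ → ℝ) → ℝ → ℂ := fun t y => (∏ j, g j (t j)) * m y *
    Complex.exp (-((y : ℂ) * ((x - ∑ j, t j : ℝ) : ℂ) / ħ * Complex.I)) with hΦ
  have hΦi : Integrable (Function.uncurry Φ)
      ((volume : Measure (Fin ℓ → ℝ)).prod (volume : Measure ℝ)) := by
    have h1 : Integrable (fun t : Fin ℓ → ℝ => ∏ j, g j (t j)) :=
      Integrable.fintype_prod hgi
    refine (h1.mul_prod hmi).mul_bdd (c := 1) (g := fun p : (Fin ℓ → ℝ) × ℝ =>
      Complex.exp (-((p.2 : ℂ) * ((x - ∑ j, p.1 j : ℝ) : ℂ) / ħ * Complex.I)))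
      (Continuous.aestronglyMeasurable (by fun_prop)) (Eventually.of_forall fun p => ?_)
    have : -((p.2 : ℂ) * ((x - ∑ j, p.1 j : ℝ) : ℂ) / ħ * Complex.I) =
        ((-(p.2 * (x - ∑ j, p.1 j) / ħ) : ℝ) : ℂ) * Complex.I := by push_cast; ring
    rw [this, Complex.norm_exp_ofReal_mul_I]
  have hinner : ∀ t : Fin ℓ → ℝ, (giventalIntegrand ħ lam x t : ℂ) =
      Complex.exp (-((ε : ℂ) * x / ħ)) * (1 / (2 * (Real.pi : ℂ) * (ħ : ℂ)) * ∫ y, Φ t y) := by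
    intro t
    rw [giventalIntegrand_eq lam ε, cexp_sub_exp_eq_integral_modGamma hħ (hdpos (Fin.last ℓ))]
    simp only [hΦ, mul_assoc, integral_const_mul]
    rw [mul_left_comm (∏ j, g j (t j))]
  have houter : ∀ y : ℝ, ∫ t, Φ t y = m y * Complex.exp (-((y : ℂ) * x / ħ * Complex.I)) *
      ∏ j : Fin ℓ, modGamma ((d j.castSucc : ℂ) + (y : ℂ) * Complex.I) ħ := by
    intro y
    have h1 : ∀ t, Φ t y = m y * Complex.exp (-((y : ℂ) * x / ħ * Complex.I)) *
        ∏ j : Fin ℓ, Complex.exp ((((d j.castSucc : ℂ) + (y : ℂ) * Complex.I) * t j -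
          (Real.exp (t j) : ℂ)) / ħ) := by
      intro t
      simp only [hΦ, hg, ← Complex.exp_sum]
      rw [mul_comm (Complex.exp _) (m y), mul_assoc, mul_assoc, ← Complex.exp_add,
        ← Complex.exp_add]
      congr 2
      simp only [← Finset.sum_div, add_mul, Finset.sum_sub_distrib, Finset.sum_add_distrib,
        ← Finset.mul_sum]
      push_cast
      ring
    simp only [h1]
    rw [integral_const_mul, integral_fintype_prod_volume_eq_prod (f := fun (j : Fin ℓ) (v : ℝ) =>
      Complex.exp ((((d j.castSucc : ℂ) + (y : ℂ) * Complex.I) * v - (Real.exp v : ℂ)) / ħ))]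
    congr 1
    exact Finset.prod_congr rfl fun j _ =>
      integral_cexp_sub_exp hħ (by simpa using hdpos j.castSucc)
  -- the same factorization shows that Givental's integral converges absolutely
  have hGi : Integrable fun t => (giventalIntegrand ħ lam x t : ℂ) := by
    simp only [hinner]
    exact (hΦi.integral_prod_left.const_mul _).const_mul _
  refine ⟨by simpa using hGi.re, ?_⟩
  have hcoe : ((∫ t : Fin ℓ → ℝ, giventalIntegrand ħ lam x t : ℝ) : ℂ) =
      ∫ t : Fin ℓ → ℝ, (giventalIntegrand ħ lam x t : ℂ) :=
    integral_complex_ofReal.symm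
  rw [hcoe]
  simp only [hinner]
  rw [integral_const_mul, integral_const_mul, integral_integral_swap hΦi]
  simp only [houter, mellinBarnesIntegrand_eq]
  rw [mul_left_comm, ← integral_const_mul]
  congr 2
  funext y
  have h2 : gammaProd ħ lam ((ε : ℂ) + (y : ℂ) * Complex.I) =
      (∏ j : Fin ℓ, modGamma ((d j.castSucc : ℂ) + (y : ℂ) * Complex.I) ħ) * m y := by
    rw [gammaProd, Fin.prod_univ_castSucc]
    congr 1
    · refine Finset.prod_congr rfl fun j _ => ?_
      congr 1
      simp only [hd]
      push_cast
      ring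
    · simp only [hm, hd]
      congr 1
      push_cast
      ring
  have h3 : Complex.exp (-((x : ℂ) * ((ε : ℂ) + (y : ℂ) * Complex.I) / ħ)) =
      Complex.exp (-((ε : ℂ) * x / ħ)) * Complex.exp (-((y : ℂ) * x / ħ * Complex.I)) := by
    rw [← Complex.exp_add]
    congr 1
    ring
  rw [h2, h3]
  ring

end Givental

/-! ### The parabolic Whittaker function -/

section Whittaker

variable {ℓ : ℕ} {ħ : ℝ} (lam : Fin (ℓ + 1) → ℝ)

/-- On the line `γ_{1,1} = γ_{ℓ,1} - (ℓ - 1)ħ/2`; with `γ_{ℓ,1} + ħ/2 = iH` the constant left over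
in the exponent of `e^{-xE_{11}}` cancels the factor `e^{-ℓx/2}`. -/
theorem parabolicWhittaker_eq_mellinBarnes (hℓ : 1 ≤ ℓ) (hħ : 0 < ħ) {ε : ℝ}
    (hε : ∀ j, lam j < ε) (x : ℝ) :
    GZPairable ħ lam (ε - ħ / 2) (gzLeftVector ħ) (gzTorus ħ lam x (gzRightVector ħ lam)) ∧
      parabolicWhittaker ħ lam ε x = 1 / (2 * (Real.pi : ℂ) * (ħ : ℂ)) *
        ∫ y : ℝ, mellinBarnesIntegrand ħ lam x ((y : ℂ) - Complex.I * (ε : ℂ)) := by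
  have hc : (ħ : ℂ) ≠ 0 := by exact_mod_cast hħ.ne'
  set K : ℂ := 1 / (2 * (Real.pi : ℂ) * Complex.I * (ħ : ℂ)) with hK
  set D : ℂ → ℂ := fun s => K * Complex.exp (-(x : ℂ) *
    (1 / (ħ : ℂ) * (s - ((ℓ : ℂ) - 1) * ħ / 2))) * gammaProd ħ lam (s + ħ / 2) with hD
  have m11 : (1, 1) ∈ gzIndex ℓ := mem_gzIndex.2 ⟨le_rfl, le_rfl, hℓ⟩
  have hDval : ∀ y : ℝ, D (((ε - ħ / 2 : ℝ) : ℂ) + (y : ℂ) * Complex.I) =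
      (K * Complex.exp ((ℓ : ℂ) / 2 * x)) *
        mellinBarnesIntegrand ħ lam x ((y : ℂ) - Complex.I * (ε : ℂ)) := by
    intro y
    rw [mellinBarnesIntegrand_eq, hD]
    simp only
    rw [show ((ε - ħ / 2 : ℝ) : ℂ) + (y : ℂ) * Complex.I + ħ / 2 =
      (ε : ℂ) + (y : ℂ) * Complex.I by push_cast; ring, mul_assoc K, mul_assoc K,
      mul_comm (gammaProd _ _ _), ← mul_assoc (Complex.exp ((ℓ : ℂ) / 2 * x)), ← Complex.exp_add]
    congr 3
    push_cast
    field_simp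
    ring
  have hlim : ∀ s : ℂ, Tendsto (fun γ : gzRegular ℓ ħ =>
      gzLeftVector ħ γ * Complex.exp (-(x : ℂ) * gzWeight ħ lam 1 γ))
      (comap Subtype.val (𝓝 (gzSupport ℓ ħ s)))
      (𝓝 (K * Complex.exp (-(x : ℂ) * (1 / (ħ : ℂ) * (s - ((ℓ : ℂ) - 1) * ħ / 2))))) := by
    intro s
    have hcont : Continuous fun γ : GZArray ℓ => K * Complex.exp (-(x : ℂ) *
        (1 / (ħ : ℂ) * gzEntry lam γ 1 1)) := by
      have := continuous_gzEntry lam 1 1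
      fun_prop
    have h1 := tendsto_comap_gzRegular (ħ := ħ) hcont (gzSupport ℓ ħ s)
    rw [gzEntry_gzSupport lam ħ s m11, if_pos rfl, Nat.cast_one] at h1
    refine h1.congr fun γ => ?_
    simp [gzLeftVector, gzWeight, hK]
  obtain ⟨h1, h2⟩ := gzPairing_of_tendsto lam (c := ε - ħ / 2) (φ := gzLeftVector ħ)
    (ψ := gzTorus ħ lam x (gzRightVector ħ lam)) (D := D) (fun y _ => by
      have := tendsto_gzMeasure_mul_gzRightVector lam hℓ hħ
        (s := ((ε - ħ / 2 : ℝ) : ℂ) + (y : ℂ) * Complex.I) (by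
          intro j
          have : (((ε - ħ / 2 : ℝ) : ℂ) + (y : ℂ) * Complex.I).re = ε - ħ / 2 := by simp
          rw [this]
          linarith [hε j]) (hlim _)
      refine this.congr fun γ => ?_
      simp only [gzTorus, LinearMap.coe_mk, AddHom.coe_mk]
      ring) (by
      simp only [hDval]
      exact (integrable_mellinBarnesIntegrand lam hħ hε x).const_mul _)
  refine ⟨h1, ?_⟩
  rw [parabolicWhittaker, gzMatrixElement, h2]
  simp only [hDval]
  rw [integral_const_mul, integral_const_mul, hK]
  have he : Complex.exp (-((ℓ : ℂ) / 2) * x) * Complex.exp ((ℓ : ℂ) / 2 * x) = 1 := by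
    rw [← Complex.exp_add, ← Complex.exp_zero]
    congr 1
    ring
  have hpi : (Real.pi : ℂ) ≠ 0 := by exact_mod_cast Real.pi_ne_zero
  have hI := Complex.I_ne_zero
  calc _ = (Complex.exp (-((ℓ : ℂ) / 2) * x) * Complex.exp ((ℓ : ℂ) / 2 * x)) *
        (Complex.I * (1 / (2 * (Real.pi : ℂ) * Complex.I * (ħ : ℂ)))) *
        ∫ y : ℝ, mellinBarnesIntegrand ħ lam x ((y : ℂ) - Complex.I * (ε : ℂ)) := by ring
    _ = _ := by
      rw [he, one_mul]
      congr 1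
      field_simp

end Whittaker

theorem mainTheorem1 (ℓ : ℕ) (hℓ : 1 ≤ ℓ) (ħ : ℝ) (hħ : 0 < ħ) (lam : Fin (ℓ + 1) → ℝ)
    (ε : ℝ) (hε : ∀ j, lam j < ε) :
    IsGlRepresentation (ℓ + 1) (gzCartan ħ lam) (gzRaise ħ lam) (gzLower ħ lam) ∧
    IsLeftWhittakerVector ħ lam (gzLeftVector ħ) ∧
    IsRightWhittakerVector ħ lam (ε - ħ / 2) (ℓ * (ℓ - 1) / 2 + 1) (gzRightVector ħ lam) ∧
    ∀ x : ℝ,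
      GZPairable ħ lam (ε - ħ / 2) (gzLeftVector ħ) (gzTorus ħ lam x (gzRightVector ħ lam)) ∧
      Integrable (fun y : ℝ => mellinBarnesIntegrand ħ lam x ((y : ℂ) - Complex.I * (ε : ℂ))) ∧
      parabolicWhittaker ħ lam ε x =
        1 / (2 * (Real.pi : ℂ) * (ħ : ℂ)) *
          ∫ y : ℝ, mellinBarnesIntegrand ħ lam x ((y : ℂ) - Complex.I * (ε : ℂ)) ∧
      Integrable (giventalIntegrand ħ lam x) ∧
      parabolicWhittaker ħ lam ε x = ((∫ t : Fin ℓ → ℝ, giventalIntegrand ħ lam x t : ℝ) : ℂ) := by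
  refine ⟨isGlRepresentation_gz ħ lam hħ.ne', isLeftWhittakerVector_gzLeftVector ħ lam hħ.ne',
    isRightWhittakerVector_gzRightVector lam hℓ hħ hε, fun x => ?_⟩
  obtain ⟨h1, h2⟩ := parabolicWhittaker_eq_mellinBarnes lam hℓ hħ hε x
  obtain ⟨h3, h4⟩ := integral_giventalIntegrand lam hħ hε x
  exact ⟨h1, integrable_mellinBarnesIntegrand lam hħ hε x, h2, h3, h2.trans h4.symm⟩

end
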